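/- Let $p,q,r\ge 0$ be integers. Let $\mathfrak{T}$ be the set of $(p+q)\times r$ matrices $\omega=\binom{\tau_1}{\tau_2}$ of rank $r$, where $\tau_1$ (of size $p\times r$) and $\tau_2$ (of size $q\times r$) have coefficients in $\{0,1\}$ with at most one $1$ in each row and each column, and let $\overline{\mathfrak{T}}=\mathfrak{T}/\mathfrak{S}_r$ be the quotient by permutations of the columns. For $\omega\in\overline{\mathfrak{T}}$, let $I\subset\{1,\dots,p\}$ and $J\subset\{1,\dots,q\}$ be the sets of all $i$, respectively $j$, such that some column of $\omega$ has a $1$ in position $i$ of $\tau_1$ and a $1$ in position $j$ of $\tau_2$, and let $\sigma:J\to I$ be the bijection that sends $j$ to $i$ for each such column. Let $L\subset\{1,\dots,p\}$ (respectively $M\subset\{1,\dots,q\}$) be the set of positions in $\tau_1$ (respectively $\tau_2$) of the $1$'s that are the only $1$ of their column of $\omega$, and put $L'=\{1,\dots,p\}\setminus(I\cup L)$, $M'=\{1,\dots,q\}\setminus(J\cup M)$. For a bijection $w:S\to R$ of finite sets of integers, $\mathrm{RS}_1(w)$ and $\mathrm{RS}_2(w)$ denote the insertion tableau (with set of entries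 $R$) and the recording tableau (with set of entries $S$) given by the Robinson–Schensted correspondence. For a finite set $A$ of integers, $[A]$ is the vertical (one-column) tableau with set of entries $A$. For tableaux $T,S$ with disjoint sets of entries, $T*S$ is the rectification by jeu de taquin of the skew tableau obtained by displaying $S$ on the top right corner of $T$; this product is associative. For Young diagrams, $\nu\subset\!\!\!\cdot\ \lambda$ means that $\nu$ is a subdiagram of $\lambda$ and that $\lambda\setminus\nu$ has at most one box in each row (column strip). For partitions $\lambda\vdash p$ and $\mu\vdash q$, let $\mathcal{T}_{\lambda,\mu}$ be the set of $5$-tuples $(T_1,T_2;\lambda',\mu';\nu)$ such that - $T_1$ and $T_2$ are standard Young tableaux of shapes $\lambda$ and $\mu$, respectively; - $\lambda',\mu',\nu$ are Young diagrams with $\nu\subset\!\!\!\cdot\ \lambda'\subset\!\!\!\cdot\ \lambda$, $\nu\subset\!\!\!\cdot\ \mu'\subset\!\!\!\cdot\ \mu$, and $|\lambda'|+|\mu'|=|\nu|+r$. Then the map $$\mathrm{gRS}(\omega)=\big([L]*\mathrm{RS}_1(\sigma)*[L'],\ [M]*\mathrm{RS}_2(\sigma)*[M'];\ \mathrm{shape}([L]*\mathrm{RS}_1(\sigma)),\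 \mathrm{shape}([M]*\mathrm{RS}_2(\sigma));\ \mathrm{shape}(\mathrm{RS}_1(\sigma))\big)$$ is a well-defined bijection $$\mathrm{gRS}:\overline{\mathfrak{T}}\ \xrightarrow{\ \sim\ }\ \bigsqcup_{\lambda\vdash p,\ \mu\vdash q}\mathcal{T}_{\lambda,\mu}.$$ -/

import Mathlib

noncomputable section

namespace GenRS

/-! ### Pairs of partial permutations, modulo permutation of the columns -/

/-- Matrices with entries `0` or `1`, with at most one `1` in each row and each column. -/
def IsPartialPerm {m r : ℕ} (τ : Matrix (Fin m) (Fin r) ℂ) : Prop :=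
  (∀ i c, τ i c = 0 ∨ τ i c = 1) ∧
  (∀ i c c', τ i c = 1 → τ i c' = 1 → c = c') ∧
  (∀ i i' c, τ i c = 1 → τ i' c = 1 → i = i')

/-- The `(p+q) × r` matrices of rank `r` obtained by stacking a `p × r` partial permutation
matrix on top of a `q × r` partial permutation matrix. -/
def PairMatrix (p q r : ℕ) : Type :=
  {ω : Matrix (Fin p ⊕ Fin q) (Fin r) ℂ //
    IsPartialPerm ω.toRows₁ ∧ IsPartialPerm ω.toRows₂ ∧ ω.rank = r}

theorem mul_permMatrix_apply {p q r : ℕ} (ω : Matrix (Fin p ⊕ Fin q) (Fin r) ℂ)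
    (g : Equiv.Perm (Fin r)) (x : Fin p ⊕ Fin q) (c : Fin r) :
    (ω * g.permMatrix ℂ) x c = ω x (g.symm c) := by
  rw [Equiv.Perm.permMatrix, PEquiv.mul_toMatrix_toPEquiv]
  rfl

/-- Equivalence under the action of the symmetric group by right multiplication. -/
instance pairSetoid (p q r : ℕ) : Setoid (PairMatrix p q r) where
  r ω ω' := ∃ g : Equiv.Perm (Fin r), ω'.1 = ω.1 * g.permMatrix ℂ
  iseqv := by
    refine ⟨fun ω => ⟨1, by simp⟩, ?_, ?_⟩
    · rintro ω ω' ⟨g, hg⟩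
      refine ⟨g.symm, ?_⟩
      ext x c
      rw [mul_permMatrix_apply, hg, mul_permMatrix_apply]
      simp
    · rintro ω ω' ω'' ⟨g, hg⟩ ⟨h, hh⟩
      refine ⟨g.trans h, ?_⟩
      ext x c
      rw [hh, mul_permMatrix_apply, hg, mul_permMatrix_apply, mul_permMatrix_apply]
      rfl

/-- The parameter set: pairs of partial permutations modulo permutation of the columns. -/
def Param (p q r : ℕ) : Type := Quotient (pairSetoid p q r)

/-! ### The graph of a parameter -/

/-- `i⁺` and `j⁻` are joined by an edge: some column has a `1` in both positions. -/
def Param.Edge {p q r : ℕ} (ω : Param p q r) (i : Fin p) (j : Fin q) : Prop :=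
  Quotient.liftOn ω (fun w => ∃ c, w.1 (Sum.inl i) c = 1 ∧ w.1 (Sum.inr j) c = 1) (by
    rintro w w' ⟨g, hg⟩
    simp only [hg, mul_permMatrix_apply, eq_iff_iff]
    exact ⟨fun ⟨c, h⟩ => ⟨g c, by simpa using h⟩, fun ⟨c, h⟩ => ⟨g.symm c, h⟩⟩)

/-- `i⁺` is marked: some column has its only `1` in the upper position `i`. -/
def Param.MarkPos {p q r : ℕ} (ω : Param p q r) (i : Fin p) : Prop :=
  Quotient.liftOn ω (fun w => ∃ c, w.1 (Sum.inl i) c = 1 ∧ ∀ j, w.1 (Sum.inr j) c = 0) (by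
    rintro w w' ⟨g, hg⟩
    simp only [hg, mul_permMatrix_apply, eq_iff_iff]
    exact ⟨fun ⟨c, h⟩ => ⟨g c, by simpa using h⟩, fun ⟨c, h⟩ => ⟨g.symm c, h⟩⟩)

/-- `j⁻` is marked: some column has its only `1` in the lower position `j`. -/
def Param.MarkNeg {p q r : ℕ} (ω : Param p q r) (j : Fin q) : Prop :=
  Quotient.liftOn ω (fun w => ∃ c, w.1 (Sum.inr j) c = 1 ∧ ∀ i, w.1 (Sum.inl i) c = 0) (by
    rintro w w' ⟨g, hg⟩
    simp only [hg, mul_permMatrix_apply, eq_iff_iff]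
    exact ⟨fun ⟨c, h⟩ => ⟨g c, by simpa using h⟩, fun ⟨c, h⟩ => ⟨g.symm c, h⟩⟩)

theorem Param.Edge.right_unique {p q r : ℕ} {ω : Param p q r} {i : Fin p} {j j' : Fin q}
    (h : ω.Edge i j) (h' : ω.Edge i j') : j = j' := by
  induction ω using Quotient.inductionOn with
  | _ w =>
    obtain ⟨c, h1, h2⟩ := h
    obtain ⟨c', h1', h2'⟩ := h'
    obtain rfl := w.2.1.2.1 i c c' h1 h1'
    exact w.2.2.1.2.2 j j' c h2 h2'

theorem Param.Edge.left_unique {p q r : ℕ} {ω : Param p q r} {i i' : Fin p} {j : Fin q}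
    (h : ω.Edge i j) (h' : ω.Edge i' j) : i = i' := by
  induction ω using Quotient.inductionOn with
  | _ w =>
    obtain ⟨c, h1, h2⟩ := h
    obtain ⟨c', h1', h2'⟩ := h'
    obtain rfl := w.2.2.1.2.1 j c c' h2 h2'
    exact w.2.1.2.2 i i' c h1 h1'

open Classical in
/-- Positive vertices on an edge (degree `1`). -/
def Param.I {p q r : ℕ} (ω : Param p q r) : Finset (Fin p) := {i | ∃ j, ω.Edge i j}

open Classical in
/-- Marked positive vertices (degree `2`). -/
def Param.L {p q r : ℕ} (ω : Param p q r) : Finset (Fin p) := {i | ω.MarkPos i}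

/-- Free positive vertices (degree `0`). -/
def Param.L' {p q r : ℕ} (ω : Param p q r) : Finset (Fin p) := (ω.I ∪ ω.L)ᶜ

open Classical in
/-- Negative vertices on an edge (degree `1`). -/
def Param.J {p q r : ℕ} (ω : Param p q r) : Finset (Fin q) := {j | ∃ i, ω.Edge i j}

open Classical in
/-- Marked negative vertices (degree `2`). -/
def Param.M {p q r : ℕ} (ω : Param p q r) : Finset (Fin q) := {j | ω.MarkNeg j}

/-- Free negative vertices (degree `0`). -/
def Param.M' {p q r : ℕ} (ω : Param p q r) : Finset (Fin q) := (ω.J ∪ ω.M)ᶜ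

theorem Param.mem_I {p q r : ℕ} (ω : Param p q r) {i : Fin p} :
    i ∈ ω.I ↔ ∃ j, ω.Edge i j := by
  simp [Param.I]

theorem Param.mem_J {p q r : ℕ} (ω : Param p q r) {j : Fin q} :
    j ∈ ω.J ↔ ∃ i, ω.Edge i j := by
  simp [Param.J]

theorem Param.exists_edge {p q r : ℕ} (ω : Param p q r) (j : ω.J) :
    ∃ i : ω.I, ω.Edge i.1 j.1 := by
  obtain ⟨i, hi⟩ := ω.mem_J.1 j.2
  exact ⟨⟨i, ω.mem_I.2 ⟨j.1, hi⟩⟩, hi⟩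

/-- The bijection `σ : J → I` sending `j` to the `i` such that `(i⁺, j⁻)` is an edge. -/
def Param.σ {p q r : ℕ} (ω : Param p q r) : ω.J ≃ ω.I :=
  Equiv.ofBijective (fun j => (ω.exists_edge j).choose) (by
    constructor
    · intro j j' h
      have h1 := (ω.exists_edge j).choose_spec
      have h2 := (ω.exists_edge j').choose_spec
      simp only at h
      rw [h] at h1
      exact Subtype.ext (h1.right_unique h2)
    · intro i
      obtain ⟨j, hj⟩ := ω.mem_I.1 i.2
      refine ⟨⟨j, ω.mem_J.2 ⟨i.1, hj⟩⟩, ?_⟩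
      exact Subtype.ext ((ω.exists_edge _).choose_spec.left_unique hj))

/-! ### Fillings, the Robinson-Schensted correspondence, jeu de taquin -/

/-- A filling of boxes `(row, column)` by elements of `α`; the box `(0, 0)` is the top left
corner, and `none` means that the box does not belong to the diagram. -/
abbrev Filling (α : Type) : Type := ℕ × ℕ → Option α

/-- The set of boxes of a filling. -/
def shape {α : Type} (T : Filling α) : Set (ℕ × ℕ) := {c | T c ≠ none}

/-- The filling with given rows, listed from top to bottom. -/
def ofRows {α : Type} (rows : List (List α)) : Filling α :=
  fun c => (rows[c.1]?).bind (fun row => row[c.2]?)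

/-- The vertical tableau `[L]` whose entries are the elements of `L`. -/
def column {α : Type} [LinearOrder α] (L : Finset α) : Filling α :=
  fun c => if c.2 = 0 then (L.sort (· ≤ ·))[c.1]? else none

/-- Row insertion of `x` into one row: `x` replaces the leftmost entry larger than `x`, which is
bumped (and returned); if there is none, `x` is added at the end of the row. -/
def insertRow {α : Type} [LinearOrder α] (x : α) : List α → List α × Option α
  | [] => ([x], none)
  | y :: ys =>
    if x < y then (x :: ys, some y)
    else (y :: (insertRow x ys).1, (insertRow x ys).2)

/-- Row insertion of `x` into a tableau (list of rows): bumped entries are inserted in the next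
row. The second component is the index of the row in which a new box is created. -/
def insertTableau {α : Type} [LinearOrder α] : α → List (List α) → List (List α) × ℕ
  | x, [] => ([[x]], 0)
  | x, row :: rows =>
    match insertRow x row with
    | (row', none) => (row' :: rows, 0)
    | (row', some y) => (row' :: (insertTableau y rows).1, (insertTableau y rows).2 + 1)

/-- Add a box with entry `y` at the end of the row of index `n` (which may be a new row). -/
def addBox {β : Type} (y : β) : ℕ → List (List β) → List (List β)
  | _, [] => [[y]]
  | 0, row :: rows => (row ++ [y]) :: rows
  | n + 1, row :: rows => row :: addBox y n rows

/-- The insertion and recording tableaux of a two-line array, given as the list of its columns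
`(top, bottom)`: the bottom entries are inserted from left to right, and the top entries record
the new boxes. -/
def rsRows {α β : Type} [LinearOrder α] (w : List (β × α)) : List (List α) × List (List β) :=
  w.foldl (fun PQ e =>
    ((insertTableau e.2 PQ.1).1, addBox e.1 (insertTableau e.2 PQ.1).2 PQ.2)) ([], [])

/-- The two-line array of a bijection between finite subsets of linearly ordered sets. -/
def twoLine {α β : Type} [LinearOrder α] [LinearOrder β] {S : Finset β} {R : Finset α}
    (w : S ≃ R) : List (β × α) :=
  ((Finset.univ : Finset S).sort (· ≤ ·)).map (fun s => (s.1, (w s).1))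

/-- The insertion tableau `RS₁(w)` of `w : S → R`; its set of entries is `R`. -/
def RS₁ {α β : Type} [LinearOrder α] [LinearOrder β] {S : Finset β} {R : Finset α}
    (w : S ≃ R) : Filling α := ofRows (rsRows (twoLine w)).1

/-- The recording tableau `RS₂(w)` of `w : S → R`; its set of entries is `S`. -/
def RS₂ {α β : Type} [LinearOrder α] [LinearOrder β] {S : Finset β} {R : Finset α}
    (w : S ≃ R) : Filling β := ofRows (rsRows (twoLine w)).2

/-- One move of a jeu de taquin slide, on a filling with a distinguished empty box (the hole):
the smaller of the right and lower neighbours of the hole is moved into the hole and leaves a new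
hole behind; nothing changes when there is no such neighbour. -/
def slideStep {α : Type} [LinearOrder α] (s : Filling α × (ℕ × ℕ)) : Filling α × (ℕ × ℕ) :=
  let T := s.1
  let hole := s.2
  let right := (hole.1, hole.2 + 1)
  let below := (hole.1 + 1, hole.2)
  let moveLeft := (Function.update (Function.update T hole (T right)) right none, right)
  let moveUp := (Function.update (Function.update T hole (T below)) below none, below)
  match T right, T below with
  | none, none => (T, hole)
  | some _, none => moveLeft
  | none, some _ => moveUp
  | some a, some b => if a < b then moveLeft else moveUp

/-- The jeu de taquin slide into the box `c`. The hole meets every box at most once, so the number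
of boxes of `T` bounds the number of moves, and after that many of them the hole has stopped. -/
def slide {α : Type} [LinearOrder α] (T : Filling α) (c : ℕ × ℕ) : Filling α :=
  (slideStep^[(shape T).ncard] (T, c)).1

/-- The number of rows of a tableau. -/
def numRows {α : Type} (T : Filling α) : ℕ := {i : ℕ | T (i, 0) ≠ none}.ncard

/-- The number of columns of a tableau. -/
def numCols {α : Type} (T : Filling α) : ℕ := {j : ℕ | T (0, j) ≠ none}.ncard

/-- The skew tableau obtained by displaying `S` on the top right corner of `T`. -/
def adjoin {α : Type} (T S : Filling α) : Filling α := fun c =>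
  if c.1 < numRows S then
    (if c.2 < numCols T then none else S (c.1, c.2 - numCols T))
  else T (c.1 - numRows S, c.2)

/-- The boxes of an `a × b` rectangle, from the last row to the first one, and from right to left
in each row. When boxes of the rectangle are removed in this order, each one is a corner. -/
def rectangle (a b : ℕ) : List (ℕ × ℕ) :=
  (List.range a).reverse.flatMap (fun i => (List.range b).reverse.map (fun j => (i, j)))

/-- The product `T * S` of two tableaux: the rectification by jeu de taquin of the skew tableau
obtained by displaying `S` on the top right corner of `T`. The inner shape of this skew tableau is
a rectangle; slides are performed successively into inner corners until it is exhausted. -/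
def product {α : Type} [LinearOrder α] (T S : Filling α) : Filling α :=
  (rectangle (numRows S) (numCols T)).foldl slide (adjoin T S)

/-! ### The target set -/

/-- Partitions of `n`, seen as Young diagrams. -/
abbrev Partitions (n : ℕ) : Type := {lam : YoungDiagram // lam.card = n}

/-- Standard Young tableaux of shape `lam ⊢ n`; the set of entries `{1, …, n}` is `Fin n`. -/
@[ext]
structure StandardTableau {n : ℕ} (lam : Partitions n) where
  /-- the entries -/
  toFilling : Filling (Fin n)
  shape_eq : shape toFilling = (lam.1 : Set (ℕ × ℕ))
  existsUnique_box : ∀ x : Fin n, ∃! c, toFilling c = some x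
  row_lt : ∀ i j a b, toFilling (i, j) = some a → toFilling (i, j + 1) = some b → a < b
  col_lt : ∀ i j a b, toFilling (i, j) = some a → toFilling (i + 1, j) = some b → a < b

/-- `IsColumnStrip mu lam`: `mu` is a subdiagram of `lam`, and the skew diagram `lam \ mu`
contains at most one box in each row. -/
def IsColumnStrip (mu lam : YoungDiagram) : Prop :=
  mu ≤ lam ∧ ∀ i j j' : ℕ,
    (i, j) ∈ lam → (i, j) ∉ mu → (i, j') ∈ lam → (i, j') ∉ mu → j = j'

/-- The set of 5-tuples `(T₁, T₂; λ', μ'; ν)` for given `(λ, μ)`. -/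
@[ext]
structure Quintuple {p q : ℕ} (r : ℕ) (lam : Partitions p) (mu : Partitions q) where
  /-- a standard tableau of shape `λ` -/
  T₁ : StandardTableau lam
  /-- a standard tableau of shape `μ` -/
  T₂ : StandardTableau mu
  /-- the diagram `λ'` -/
  lam' : YoungDiagram
  /-- the diagram `μ'` -/
  mu' : YoungDiagram
  /-- the diagram `ν` -/
  nu : YoungDiagram
  strip_nu_lam' : IsColumnStrip nu lam'
  strip_lam' : IsColumnStrip lam' lam.1
  strip_nu_mu' : IsColumnStrip nu mu'
  strip_mu' : IsColumnStrip mu' mu.1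
  card_add_card : lam'.card + mu'.card = nu.card + r

/-- The disjoint union of the sets of 5-tuples over all pairs of partitions of `p` and `q`. -/
abbrev Target (p q r : ℕ) : Type :=
  Σ lm : Partitions p × Partitions q, Quintuple r lm.1 lm.2

end GenRS

end

open GenRS

/-! ### Row insertion and the Knuth relations -/

namespace GenRS
variable {α : Type} [LinearOrder α]

/-! An element of the source is the same thing as a bijection `σ : J → I` together with sets `L`,
`M` disjoint from `I`, `J` such that `|I| + |L| + |M| = r`: rank `r` forbids zero columns, so every
column is an edge or a marked vertex (`Param.ext_graph`, `Param.exists_of_data`). Robinson–Schensted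
turns `σ` into a pair of tableaux of the same shape `ν` with contents `I` and `J` (`rs_spec`,
`rs_injective`, `exists_rs_eq`). What remains is a statement about each half separately: a standard
tableau `T` with a chain of column strips from `ν` through `λ'` to its shape is uniquely of the form
`[L] * P * [L']`, where `P` has shape `ν` and `[L] * P` has shape `λ'`. This is the Pieri rule for
multiplication by a column, applied on the right (`pieri_right`) and then on the left
(`pieri_left`). The cardinality condition of the target becomes the count of columns, since `|λ'| +
|μ'| = (|I| + |L|) + (|J| + |M|)` and `|ν| = |I| = |J|`.

The Pieri rule is proved by turning products into insertions. A jeu de taquin slide does not change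
the Knuth class of the row reading word (`Skew.slide`), so the word of `T * S` is Knuth equivalent
to the word of `T` followed by that of `S` (`product_spec`). Knuth equivalent words have the same
insertion tableau (`Knuth.insertWord_eq`), and inserting the reading word of a tableau gives the
tableau back (`Tab.insertWord_readRows`); hence `T * S` is obtained from `T` by inserting the word
of `S`. The word of a column is decreasing. By the row bumping lemma (`newBox_bumping`), decreasing
letters create boxes in strictly lower and lower rows, which is a column strip; conversely, removing
the boxes of a strip from the bottom up by reverse insertion recovers the tableau and the letters
(`Bumping.strip`, `Bumping.exists_word`, `Bumping.word_unique`).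

For multiplication on the left, everything is reflected across the diagonal. Reflection reverses
reading words up to Knuth equivalence (`knuth_readWord_transpose`), so the reflection of `[L] * F`
is the reflection of `F` with the increasing word of `L` inserted, and the rule for increasing words
applies.

All entries are distinct throughout, so rows are strictly increasing and only strict Knuth relations
occur. -/

theorem insertRow_perm (x : α) (r : List α) :
    ((insertRow x r).1 ++ (insertRow x r).2.toList).Perm (x :: r) := by
  induction r with
  | nil => simp [insertRow]
  | cons y r ih =>
    by_cases h : x < y
    · simp only [insertRow, h, if_true, Option.toList_some, List.cons_append, List.perm_cons]
      exact List.perm_append_singleton y r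
    · simp only [insertRow, h, if_false, List.cons_append]
      exact (ih.cons y).trans (List.Perm.swap x y r)

theorem mem_insertRow {x z : α} {r : List α} (h : z ∈ (insertRow x r).1) : z = x ∨ z ∈ r := by
  have := (insertRow_perm x r).subset (List.mem_append_left _ h)
  simpa using this

theorem mem_insertRow_self (x : α) (r : List α) : x ∈ (insertRow x r).1 := by
  induction r with
  | nil => simp [insertRow]
  | cons y r ih => by_cases h : x < y <;> simp [insertRow, h, ih]

theorem lt_of_insertRow_eq_some {x y : α} {r : List α} (h : (insertRow x r).2 = some y) :
    x < y ∧ y ∈ r := by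
  induction r with
  | nil => simp [insertRow] at h
  | cons z r ih =>
    by_cases hz : x < z
    · simp only [insertRow, hz, if_true, Option.some.injEq] at h
      subst h; simp [hz]
    · simp only [insertRow, hz, if_false] at h
      exact ⟨(ih h).1, List.mem_cons_of_mem _ (ih h).2⟩

theorem insertRow_sorted {x : α} {r : List α} (hr : r.Pairwise (· < ·)) (hx : x ∉ r) :
    (insertRow x r).1.Pairwise (· < ·) := by
  induction r with
  | nil => simp [insertRow]
  | cons y r ih =>
    rw [List.pairwise_cons] at hr
    simp only [List.mem_cons, not_or] at hx
    by_cases h : x < y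
    · simp only [insertRow, h, if_true, List.pairwise_cons]
      exact ⟨fun z hz => h.trans (hr.1 z hz), hr.2⟩
    · simp only [insertRow, h, if_false, List.pairwise_cons]
      refine ⟨fun z hz => ?_, ih hr.2 hx.2⟩
      rcases mem_insertRow hz with rfl | hz
      · exact lt_of_le_of_ne (not_lt.1 h) (Ne.symm hx.1)
      · exact hr.1 z hz

theorem exists_insertRow_eq_some {x b : α} {r : List α} (hr : r.Pairwise (· < ·))
    (hb : b ∈ r) (h : x < b) : ∃ c, (insertRow x r).2 = some c ∧ c ≤ b := by
  induction r with
  | nil => simp at hb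
  | cons y r ih =>
    rw [List.pairwise_cons] at hr
    by_cases hy : x < y
    · refine ⟨y, by simp [insertRow, hy], ?_⟩
      rcases List.mem_cons.1 hb with rfl | hb
      · exact le_rfl
      · exact (hr.1 b hb).le
    · rcases List.mem_cons.1 hb with rfl | hb
      · exact absurd h hy
      · obtain ⟨c, h1, h2⟩ := ih hr.2 hb
        exact ⟨c, by simp [insertRow, hy, h1], h2⟩

/-- The larger letter has to pass the place where the smaller one stopped, so anything it bumps
stood strictly to the right of the first bumped letter. If the first letter was appended at the end,
the second one is appended too. -/
theorem insertRow_insertRow_of_lt {x x' d : α} {r : List α} (hr : r.Pairwise (· < ·))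
    (h : x < x') (hd : (insertRow x' (insertRow x r).1).2 = some d) :
    ∃ b, (insertRow x r).2 = some b ∧ b < d := by
  induction r with
  | nil => simp [insertRow, h.not_gt] at hd
  | cons y r ih =>
    rw [List.pairwise_cons] at hr
    by_cases hy : x < y
    · simp only [insertRow, hy, if_true, h.not_gt, if_false] at hd
      exact ⟨y, by simp [insertRow, hy], hr.1 d (lt_of_insertRow_eq_some hd).2⟩
    · have hy' : ¬ x' < y := fun h' => hy (h.trans h')
      simp only [insertRow, hy, if_false, hy'] at hd ⊢
      exact ih hr.2 hd

/-- The first letter now belongs to the row and is larger than the second, so the second one must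
stop there or earlier. -/
theorem insertRow_insertRow_of_gt {x x' : α} {r : List α} (hr : r.Pairwise (· < ·)) (hx : x ∉ r)
    (h : x' < x) : ∃ b, (insertRow x' (insertRow x r).1).2 = some b ∧ b ≤ x :=
  exists_insertRow_eq_some (insertRow_sorted hr hx) (mem_insertRow_self x r) h

/-- Successive insertion of the letters of a word into a row; the second component is the word of
bumped letters. -/
def bumpRow : List α → List α → List α × List α
  | r, [] => (r, [])
  | r, x :: w =>
    ((bumpRow (insertRow x r).1 w).1, (insertRow x r).2.toList ++ (bumpRow (insertRow x r).1 w).2)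

theorem bumpRow_perm (r w : List α) : ((bumpRow r w).1 ++ (bumpRow r w).2).Perm (r ++ w) := by
  induction w generalizing r with
  | nil => simp [bumpRow]
  | cons x w ih =>
    simp only [bumpRow]
    have h1 := ih (insertRow x r).1
    have h2 := insertRow_perm x r
    rw [← Multiset.coe_eq_coe] at h1 h2 ⊢
    simp only [← Multiset.coe_add, ← Multiset.cons_coe] at h1 h2 ⊢
    rw [add_left_comm, h1, add_left_comm, ← add_assoc, h2, Multiset.cons_add, Multiset.add_cons]

/-- An entry below every letter of the word is inert; this allows induction on the row. -/
theorem bumpRow_cons_of_lt {a : α} {r w : List α} (h : ∀ x ∈ w, a < x) :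
    bumpRow (a :: r) w = (a :: (bumpRow r w).1, (bumpRow r w).2) := by
  induction w generalizing r with
  | nil => rfl
  | cons x w ih =>
    have hx : ¬ x < a := (h x (by simp)).not_gt
    simp only [bumpRow, insertRow, hx, if_false]
    rw [ih fun y hy => h y (by simp [hy])]

/-- Successive row insertion of the letters of a word into a tableau. -/
def insertWord (T : List (List α)) (w : List α) : List (List α) :=
  w.foldl (fun T x => (insertTableau x T).1) T

theorem insertTableau_cons (x : α) (r : List α) (T : List (List α)) :
    (insertTableau x (r :: T)).1 = (insertRow x r).1 :: insertWord T (insertRow x r).2.toList := by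
  simp only [insertTableau]
  rcases h : insertRow x r with ⟨r', _ | y⟩ <;> simp [insertWord]

theorem insertWord_append (T : List (List α)) (u v : List α) :
    insertWord T (u ++ v) = insertWord (insertWord T u) v := by
  simp [insertWord]

theorem insertWord_cons (T : List (List α)) (x : α) (v : List α) :
    insertWord T (x :: v) = insertWord (insertTableau x T).1 v := rfl

/-- The rows below see only the letters bumped from the first row, in the order in which they are
bumped. Statements about a whole tableau thereby reduce to statements about a single row. -/
theorem insertWord_row (r : List α) (T : List (List α)) (w : List α) :
    insertWord (r :: T) w = (bumpRow r w).1 :: insertWord T (bumpRow r w).2 := by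
  induction w generalizing r T with
  | nil => rfl
  | cons x w ih =>
    rw [insertWord_cons, insertTableau_cons, ih]
    simp [bumpRow, insertWord_append]

theorem insertWord_nil_cons (x : α) (w : List α) :
    insertWord [] (x :: w) = insertWord [[]] (x :: w) := rfl

theorem insertTableau_perm (x : α) (T : List (List α)) :
    (insertTableau x T).1.flatten.Perm (x :: T.flatten) := by
  induction T generalizing x with
  | nil => simp [insertTableau]
  | cons r T ih =>
    rw [insertTableau_cons]
    have h := insertRow_perm x r
    rcases hs : (insertRow x r).2 with _ | y
    · simp only [hs, Option.toList_none, List.append_nil] at h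
      simpa [insertWord] using h.append_right T.flatten
    · simp only [hs, Option.toList_some] at h
      have := (ih y).append_left (insertRow x r).1
      simp only [Option.toList_some, List.flatten_cons]
      refine this.trans ?_
      simpa using h.append_right T.flatten

theorem insertWord_perm (T : List (List α)) (w : List α) :
    (insertWord T w).flatten.Perm (T.flatten ++ w) := by
  induction w generalizing T with
  | nil => simp [insertWord]
  | cons x w ih =>
    rw [insertWord_cons]
    exact (ih _).trans (((insertTableau_perm x T).append_right w).trans List.perm_middle.symm)

theorem nodup_flatten_append_bumpRow {r w : List α} {T : List (List α)}
    (h : ((r :: T).flatten ++ w).Nodup) : (T.flatten ++ (bumpRow r w).2).Nodup := by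
  have h1 : ((r :: T).flatten ++ w).Perm (T.flatten ++ ((bumpRow r w).1 ++ (bumpRow r w).2)) := by
    refine List.Perm.trans ?_ ((bumpRow_perm r w).symm.append_left _)
    rw [List.flatten_cons, ← List.append_assoc T.flatten]
    exact List.perm_append_comm.append_right w
  refine (h1.nodup h).sublist ?_
  exact (List.sublist_append_right _ _).append_left _

/-- The elementary Knuth relations. -/
inductive KnuthStep : List α → List α → Prop
  | mid_first {x y z : α} : x < y → y < z → KnuthStep [y, z, x] [y, x, z]
  | mid_last {x y z : α} : x < y → y < z → KnuthStep [x, z, y] [z, x, y]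

theorem KnuthStep.perm {u v : List α} (h : KnuthStep u v) : u.Perm v := by
  cases h
  · exact (List.Perm.swap _ _ _).cons _
  · exact List.Perm.swap _ _ _

/-- The case analysis locates the head `a` of the row among the three letters `x < y < z`. If `a <
x` the head is inert and induction applies; otherwise `x` can bump at the head, and the two bumped
words are compared explicitly. They coincide when `z` bumps nothing. -/
theorem KnuthStep.bumpRow {u v : List α} (h : KnuthStep u v) {r : List α}
    (hr : r.Pairwise (· < ·)) (hd : ∀ a ∈ u, a ∉ r) :
    (bumpRow r u).1 = (bumpRow r v).1 ∧
      ((bumpRow r u).2 = (bumpRow r v).2 ∨ KnuthStep (bumpRow r u).2 (bumpRow r v).2 ∨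
        KnuthStep (bumpRow r v).2 (bumpRow r u).2) := by
  induction r with
  | nil =>
    cases h with
    | mid_first hxy hyz =>
      simp [GenRS.bumpRow, insertRow, hxy, hyz.not_gt, (hxy.trans hyz).not_gt]
    | mid_last hxy hyz =>
      simp [GenRS.bumpRow, insertRow, hyz, hxy.not_gt, (hxy.trans hyz).not_gt, hxy.trans hyz]
  | cons a r ih =>
    rw [List.pairwise_cons] at hr
    cases h with
    | @mid_first x y z hxy hyz =>
      have hx : x ≠ a := fun h => hd x (by simp) (by simp [h])
      have hy : y ≠ a := fun h => hd y (by simp) (by simp [h])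
      have hz : z ≠ a := fun h => hd z (by simp) (by simp [h])
      have hxr : x ∉ r := fun h => hd x (by simp) (by simp [h])
      have hyr : y ∉ r := fun h => hd y (by simp) (by simp [h])
      have hzr : z ∉ r := fun h => hd z (by simp) (by simp [h])
      rcases lt_or_gt_of_ne hx with hxa | hax
      · rcases lt_or_gt_of_ne hy with hya | hay
        · simp only [GenRS.bumpRow, insertRow, hya, hxy, hyz.not_gt, (hxy.trans hyz).not_gt,
            if_true, if_false, true_and]
          rcases hs : (insertRow z r).2 with _ | d
          · simp
          · simp only [Option.toList_some, List.append_nil, List.cons_append, List.nil_append]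
            exact Or.inr (Or.inl (.mid_first hya (hr.1 d (lt_of_insertRow_eq_some hs).2)))
        · simp only [GenRS.bumpRow, insertRow, hay.not_gt, (hay.trans hyz).not_gt, hxa,
            (hxy.trans hyz).not_gt, if_true, if_false, true_and]
          rcases hs : (insertRow z (insertRow y r).1).2 with _ | d
          · simp
          · obtain ⟨b, hb, hbd⟩ := insertRow_insertRow_of_lt hr.2 hyz hs
            rw [hb]
            simp only [Option.toList_some, List.append_nil, List.cons_append, List.nil_append]
            exact Or.inr (Or.inl (.mid_first (hr.1 b (lt_of_insertRow_eq_some hb).2) hbd))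
      · have h1 : ∀ w ∈ [y, z, x], a < w := by
          simp [hax, hax.trans hxy, hax.trans (hxy.trans hyz)]
        have h2 : ∀ w ∈ [y, x, z], a < w := by
          simp [hax, hax.trans hxy, hax.trans (hxy.trans hyz)]
        rw [bumpRow_cons_of_lt h1, bumpRow_cons_of_lt h2]
        have := ih hr.2 (fun w hw hw' => hd w hw (by simp [hw']))
        exact ⟨by simp [this.1], this.2⟩
    | @mid_last x y z hxy hyz =>
      have hx : x ≠ a := fun h => hd x (by simp) (by simp [h])
      have hy : y ≠ a := fun h => hd y (by simp) (by simp [h])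
      have hz : z ≠ a := fun h => hd z (by simp) (by simp [h])
      have hxr : x ∉ r := fun h => hd x (by simp) (by simp [h])
      have hyr : y ∉ r := fun h => hd y (by simp) (by simp [h])
      have hzr : z ∉ r := fun h => hd z (by simp) (by simp [h])
      have hxz := hxy.trans hyz
      rcases lt_or_gt_of_ne hx with hxa | hax
      · rcases lt_or_gt_of_ne hz with hza | haz
        · simp only [GenRS.bumpRow, insertRow, hxa, hza, hxz, hxz.not_gt, hxy.not_gt, if_true,
            if_false]
          cases r with
          | nil => simp [insertRow, hyz]
          | cons d r =>
            have had : a < d := hr.1 d (by simp)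
            have h1 : z < d := hza.trans had
            simp only [insertRow, h1, hyz, hyz.trans h1, if_true, true_and, Option.toList_some,
              List.append_nil, List.cons_append, List.nil_append]
            -- All three letters lie below the head, and a relation of the second kind becomes one
            -- of the first kind: the bumped words are `a, d, z` and `a, z, d`.
            exact Or.inr (Or.inl (.mid_first hza had))
        · simp only [GenRS.bumpRow, insertRow, hxa, haz.not_gt, hxz.not_gt, hxy.not_gt, if_true,
            if_false, true_and]
          rcases hs : (insertRow z r).2 with _ | d
          · simp
          · obtain ⟨b, hb, hbz⟩ := insertRow_insertRow_of_gt hr.2 hzr hyz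
            rw [hb]
            simp only [Option.toList_some, List.append_nil, List.cons_append, List.nil_append]
            -- The letter `b` bumped by `y` is at most `z`, and `d`, bumped by `z`, exceeds `z`.
            -- Moreover `b` is `z` itself or an entry of the tail, so `a < b < d`.
            refine Or.inr (Or.inl (.mid_last ?_ (hbz.trans_lt (lt_of_insertRow_eq_some hs).1)))
            rcases mem_insertRow (lt_of_insertRow_eq_some hb).2 with rfl | h
            · exact haz
            · exact hr.1 b h
      · have h1 : ∀ w ∈ [x, z, y], a < w := by
          simp [hax, hax.trans hxy, hax.trans (hxy.trans hyz)]
        have h2 : ∀ w ∈ [z, x, y], a < w := by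
          simp [hax, hax.trans hxy, hax.trans (hxy.trans hyz)]
        rw [bumpRow_cons_of_lt h1, bumpRow_cons_of_lt h2]
        have := ih hr.2 (fun w hw hw' => hd w hw (by simp [hw']))
        exact ⟨by simp [this.1], this.2⟩

/-- By `KnuthStep.bumpRow` the first row does not distinguish the two words, and it passes on words
that are equal or again one step apart; then induct on the rows. -/
theorem KnuthStep.insertWord_eq {u v : List α} (h : KnuthStep u v) {T : List (List α)}
    (hT : ∀ r ∈ T, r.Pairwise (· < ·)) (hd : (T.flatten ++ u).Nodup) :
    insertWord T u = insertWord T v := by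
  induction T generalizing u v with
  | nil =>
    cases h with
    | mid_first hxy hyz =>
      simp [insertWord, insertTableau, insertRow, hxy, hyz.not_gt, (hxy.trans hyz).not_gt]
    | mid_last hxy hyz =>
      simp [insertWord, insertTableau, insertRow, hyz, hxy.not_gt, (hxy.trans hyz).not_gt,
        hxy.trans hyz]
  | cons r T ih =>
    have hT' : ∀ r ∈ T, r.Pairwise (· < ·) := fun r hr => hT r (by simp [hr])
    have hdr : ∀ a ∈ u, a ∉ r := fun a ha har =>
      (List.nodup_append.1 hd).2.2 a (by simp [har]) a ha rfl
    obtain ⟨h1, h2⟩ := h.bumpRow (hT r (by simp)) hdr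
    rw [insertWord_row, insertWord_row, h1]
    rcases h2 with h2 | h2 | h2
    · rw [h2]
    · rw [ih h2 hT' (nodup_flatten_append_bumpRow hd)]
    · rw [ih h2 hT' (nodup_flatten_append_bumpRow ((h.perm.append_left _).nodup hd))]

theorem insertTableau_rows_sorted {x : α} {T : List (List α)}
    (hT : ∀ r ∈ T, r.Pairwise (· < ·)) (h : (x :: T.flatten).Nodup) :
    ∀ r ∈ (insertTableau x T).1, r.Pairwise (· < ·) := by
  induction T generalizing x with
  | nil => simp [insertTableau]
  | cons s T ih =>
    have hx : x ∉ s := fun hx => by simp [hx] at h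
    have hT' : ∀ r ∈ T, r.Pairwise (· < ·) := fun r hr => hT r (by simp [hr])
    rw [insertTableau_cons]
    intro r hr
    rcases List.mem_cons.1 hr with rfl | hr
    · exact insertRow_sorted (hT s (by simp)) hx
    · rcases hs : (insertRow x s).2 with _ | y
      · rw [hs] at hr; exact hT' r hr
      · rw [hs] at hr
        refine ih hT' ?_ r hr
        have hy := (lt_of_insertRow_eq_some hs).2
        simp only [List.flatten_cons, List.nodup_cons, List.nodup_append] at h ⊢
        exact ⟨fun hy' => h.2.2.2 y hy y hy' rfl, h.2.2.1⟩

theorem insertWord_rows_sorted {T : List (List α)} {w : List α}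
    (hT : ∀ r ∈ T, r.Pairwise (· < ·)) (h : (T.flatten ++ w).Nodup) :
    ∀ r ∈ insertWord T w, r.Pairwise (· < ·) := by
  induction w generalizing T with
  | nil => exact hT
  | cons x w ih =>
    have h' := List.perm_middle.nodup h
    rw [insertWord_cons]
    refine ih (insertTableau_rows_sorted hT (h'.sublist ?_)) ?_
    · exact (List.sublist_append_left _ _).cons_cons x
    · exact ((insertTableau_perm x T).symm.append_right w).nodup h'

/-- Knuth equivalence of words. -/
inductive Knuth : List α → List α → Prop
  | step (a b : List α) {u v : List α} : KnuthStep u v → Knuth (a ++ u ++ b) (a ++ v ++ b)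
  | refl (u : List α) : Knuth u u
  | symm {u v : List α} : Knuth u v → Knuth v u
  | trans {u v w : List α} : Knuth u v → Knuth v w → Knuth u w

/-! ### Knuth equivalence -/

namespace Knuth

theorem perm {u v : List α} (h : Knuth u v) : u.Perm v := by
  induction h with
  | step a b h => exact (h.perm.append_left a).append_right b
  | refl u => exact .refl u
  | symm _ ih => exact ih.symm
  | trans _ _ ih ih' => exact ih.trans ih'

theorem append_left {u v : List α} (w : List α) (h : Knuth u v) : Knuth (w ++ u) (w ++ v) := by
  induction h with
  | step a b h => simpa using Knuth.step (w ++ a) b h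
  | refl u => exact .refl _
  | symm _ ih => exact ih.symm
  | trans _ _ ih ih' => exact ih.trans ih'

theorem append_right {u v : List α} (h : Knuth u v) (w : List α) : Knuth (u ++ w) (v ++ w) := by
  induction h with
  | step a b h => simpa using Knuth.step a (b ++ w) h
  | refl u => exact .refl _
  | symm _ ih => exact ih.symm
  | trans _ _ ih ih' => exact ih.trans ih'

/-- Reversal of words exchanges the two elementary relations. -/
theorem reverse {u v : List α} (h : Knuth u v) : Knuth u.reverse v.reverse := by
  induction h with
  | step a b h =>
    simp only [List.reverse_append, ← List.append_assoc]
    cases h with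
    | mid_first hxy hyz => exact .step _ _ (.mid_last hxy hyz)
    | mid_last hxy hyz => exact .step _ _ (.mid_first hxy hyz)
  | refl u => exact .refl _
  | symm _ ih => exact ih.symm
  | trans _ _ ih ih' => exact ih.trans ih'

/-- Knuth equivalent words have the same insertion tableau. -/
theorem insertWord_eq {u v : List α} (h : Knuth u v) {T : List (List α)}
    (hT : ∀ r ∈ T, r.Pairwise (· < ·)) (hd : (T.flatten ++ u).Nodup) :
    insertWord T u = insertWord T v := by
  induction h with
  | step a b h =>
    rw [insertWord_append, insertWord_append, insertWord_append, insertWord_append,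
      h.insertWord_eq]
    · refine insertWord_rows_sorted hT (hd.sublist ?_)
      simp
    · refine ((insertWord_perm T a).symm.append_right _).nodup (hd.sublist ?_)
      simp
  | refl u => rfl
  | symm h ih => exact (ih ((h.perm.append_left _).symm.nodup hd)).symm
  | trans h _ ih ih' => exact (ih hd).trans (ih' ((h.perm.append_left _).nodup hd))

/-- The letter `x` travels left through `B`. Each exchange is a relation `mid_first` whose middle
letter is the one standing just before the exchanged pair. -/
theorem move_small_left {B : List α} {x y : α} (h : (y :: B).Pairwise (· < ·)) (hxy : x < y) :
    Knuth (y :: B ++ [x]) (y :: x :: B) := by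
  induction B generalizing y with
  | nil => exact .refl _
  | cons b B ih =>
    have hyb : y < b := List.rel_of_pairwise_cons h (by simp)
    refine ((ih h.of_cons (hxy.trans hyb)).append_left [y]).trans ?_
    exact Knuth.step [] B (KnuthStep.mid_first hxy hyb)

/-- The letter `y` travels left through `A`. Each exchange is a relation `mid_last` whose middle
letter is the one standing just after the exchanged pair. -/
theorem move_large_left {A : List α} {x y : α} (h : (A ++ [x]).Pairwise (· < ·)) (hxy : x < y) :
    Knuth (A ++ [y, x]) (y :: A ++ [x]) := by
  induction A using List.reverseRecOn generalizing x with
  | nil => exact .refl _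
  | append_singleton A a ih =>
    have h' := List.pairwise_append.1 h
    have hax : a < x := h'.2.2 a (by simp) x (by simp)
    have h1 : Knuth (A ++ [a] ++ [y, x]) (A ++ [y, a] ++ [x]) := by
      simpa using Knuth.step A [] (KnuthStep.mid_last hax hxy)
    refine h1.trans ?_
    simpa using (ih h'.1 (hax.trans hxy)).append_right [x]

/-- Insertion of a letter into a row, when a letter is bumped. -/
theorem bump {A B : List α} {x y : α} (hA : (A ++ [x]).Pairwise (· < ·))
    (hB : (y :: B).Pairwise (· < ·)) (hxy : x < y) :
    Knuth (A ++ y :: B ++ [x]) (y :: (A ++ x :: B)) := by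
  have h1 := (move_small_left hB hxy).append_left A
  have h2 := (move_large_left hA hxy).append_right B
  simp only [List.append_assoc, List.cons_append, List.nil_append] at h1 h2 ⊢
  exact h1.trans h2

/-- Insertion of a word into a row, when a segment of the row is bumped. -/
theorem bump_segment {A B x u : List α} (h : List.Forall₂ (· < ·) u x)
    (hA : (A ++ u).Pairwise (· < ·)) (hB : (x ++ B).Pairwise (· < ·)) :
    Knuth (A ++ x ++ B ++ u) (x ++ A ++ u ++ B) := by
  induction h generalizing A with
  | nil => simpa using Knuth.refl _
  | @cons a b u x hab _ ih =>
    -- The first letter `a` of `u` bumps `b`; it then joins the left part of the row for the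
    -- remaining letters.
    have h1 : Knuth (A ++ b :: (x ++ B) ++ [a]) (b :: (A ++ a :: (x ++ B))) :=
      bump (hA.sublist (by simp)) (by simpa using hB) hab
    have h2 := ih (A := A ++ [a]) (by simpa using hA) (by simpa using hB.of_cons)
    have h3 := (h1.append_right u).trans (by simpa using h2.append_left [b])
    simpa using h3

end Knuth

end GenRS

namespace GenRS
variable {α : Type} [LinearOrder α]

/-! ### Tableaux as lists of rows -/

/-- The row `s` can be placed below the row `r`. -/
def Dom (r s : List α) : Prop := ∀ (j : ℕ) (b : α), s[j]? = some b → ∃ a, r[j]? = some a ∧ a < b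

@[simp] theorem dom_nil (r : List α) : Dom r [] := by simp [Dom]

@[simp] theorem not_dom_nil_cons (b : α) (s : List α) : ¬ Dom [] (b :: s) := by
  intro h
  obtain ⟨a, ha, -⟩ := h 0 b rfl
  simp at ha

@[simp] theorem dom_cons_cons {a b : α} {r s : List α} :
    Dom (a :: r) (b :: s) ↔ a < b ∧ Dom r s := by
  constructor
  · intro h
    refine ⟨?_, fun j c hc => by simpa using h (j + 1) c (by simpa using hc)⟩
    simpa using h 0 b rfl
  · rintro ⟨h, h'⟩ (_ | j) c hc
    · simp only [List.getElem?_cons_zero, Option.some.injEq] at hc ⊢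
      subst hc; exact ⟨a, rfl, h⟩
    · simpa using h' j c (by simpa using hc)

theorem Dom.exists_lt {r s : List α} (h : Dom r s) {b : α} (hb : b ∈ s) : ∃ a ∈ r, a < b := by
  obtain ⟨j, hj⟩ := List.mem_iff_getElem?.1 hb
  obtain ⟨a, ha, hab⟩ := h j b hj
  exact ⟨a, List.mem_of_getElem? ha, hab⟩

/-- Lists of rows of tableaux. -/
def Tab : List (List α) → Prop
  | [] => True
  | r :: T => r ≠ [] ∧ r.Pairwise (· < ·) ∧ Dom r (T.headD []) ∧ Tab T

theorem Tab.rows_sorted {T : List (List α)} (h : Tab T) : ∀ r ∈ T, r.Pairwise (· < ·) := by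
  induction T with
  | nil => simp
  | cons r T ih =>
    intro s hs
    rcases List.mem_cons.1 hs with rfl | hs
    · exact h.2.1
    · exact ih h.2.2.2 s hs

theorem Tab.rows_ne_nil {T : List (List α)} (h : Tab T) : ∀ r ∈ T, r ≠ [] := by
  induction T with
  | nil => simp
  | cons r T ih =>
    intro s hs
    rcases List.mem_cons.1 hs with rfl | hs
    · exact h.1
    · exact ih h.2.2.2 s hs

theorem Tab.headD_sorted {T : List (List α)} (h : Tab T) : (T.headD []).Pairwise (· < ·) := by
  cases T with
  | nil => simp
  | cons r T => exact h.2.1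

theorem headD_insertTableau (x : α) (T : List (List α)) :
    (insertTableau x T).1.headD [] = (insertRow x (T.headD [])).1 := by
  cases T with
  | nil => rfl
  | cons r T => rw [insertTableau_cons]; rfl

/-- Insertion into the upper row only lowers an entry or lengthens the row. -/
theorem Dom.insertRow_left {r s : List α} (h : Dom r s) (x : α) : Dom (insertRow x r).1 s := by
  induction r generalizing s with
  | nil => cases s <;> simp_all
  | cons a r ih =>
    cases s with
    | nil => simp
    | cons b s =>
      rw [dom_cons_cons] at h
      by_cases hx : x < a
      · simp only [insertRow, hx, if_true, dom_cons_cons]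
        exact ⟨hx.trans h.1, h.2⟩
      · simp only [insertRow, hx, if_false, dom_cons_cons]
        exact ⟨h.1, ih h.2⟩

/-- The entry below the old place of `y` is larger than `y`, so `y` lands in the lower row no
further right than its old column. There the entries of the new upper row are smaller than `y`. -/
theorem Dom.insertRow_insertRow {r s : List α} (h : Dom r s) {x y : α}
    (hy : (insertRow x r).2 = some y) : Dom (insertRow x r).1 (insertRow y s).1 := by
  induction r generalizing s with
  | nil => simp [insertRow] at hy
  | cons a r ih =>
    have hxy := (lt_of_insertRow_eq_some hy).1
    by_cases hx : x < a
    · simp only [insertRow, hx, if_true, Option.some.injEq] at hy ⊢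
      subst hy
      cases s with
      | nil => simp [insertRow, hx]
      | cons b s =>
        rw [dom_cons_cons] at h
        simp [insertRow, hx, h]
    · simp only [insertRow, hx, if_false] at hy ⊢
      have hay : a < y := (not_lt.1 hx).trans_lt hxy
      cases s with
      | nil => simp [insertRow, hay]
      | cons b s =>
        rw [dom_cons_cons] at h
        by_cases hyb : y < b
        · simp only [insertRow, hyb, if_true, dom_cons_cons]
          exact ⟨hay, h.2.insertRow_left x⟩
        · simp only [insertRow, hyb, if_false, dom_cons_cons]
          exact ⟨h.1, ih h.2 hy⟩

theorem nodup_cons_flatten_of_bump {x y : α} {r : List α} {T : List (List α)}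
    (h : (x :: (r :: T).flatten).Nodup) (hy : (insertRow x r).2 = some y) :
    (y :: T.flatten).Nodup := by
  have hy := (lt_of_insertRow_eq_some hy).2
  simp only [List.flatten_cons, List.nodup_cons, List.nodup_append] at h ⊢
  exact ⟨fun hy' => h.2.2.2 y hy y hy' rfl, h.2.2.1⟩

theorem Tab.insertTableau {T : List (List α)} (h : Tab T) {x : α} (hd : (x :: T.flatten).Nodup) :
    Tab (insertTableau x T).1 := by
  induction T generalizing x with
  | nil => simp [GenRS.insertTableau, Tab]
  | cons r T ih =>
    have hx : x ∉ r := fun hx => by simp [hx] at hd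
    have hs := insertRow_sorted h.2.1 hx
    have hne := List.ne_nil_of_mem (mem_insertRow_self x r)
    rw [insertTableau_cons]
    rcases hy : (insertRow x r).2 with _ | y
    · exact ⟨hne, hs, h.2.2.1.insertRow_left x, h.2.2.2⟩
    · refine ⟨hne, hs, ?_, ih h.2.2.2 (nodup_cons_flatten_of_bump hd hy)⟩
      have := headD_insertTableau y T
      simp only [Option.toList_some, insertWord, List.foldl_cons, List.foldl_nil]
      rw [this]
      exact h.2.2.1.insertRow_insertRow hy

theorem Tab.insertWord {T : List (List α)} (h : Tab T) {w : List α}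
    (hd : (T.flatten ++ w).Nodup) : Tab (insertWord T w) := by
  induction w generalizing T with
  | nil => exact h
  | cons x w ih =>
    have hd' := List.perm_middle.nodup hd
    refine ih (h.insertTableau (hd'.sublist ?_)) ?_
    · exact (List.sublist_append_left _ _).cons_cons x
    · exact ((insertTableau_perm x T).symm.append_right w).nodup hd'

theorem insertTableau_snd_cons_none {x : α} {r : List α} {T : List (List α)}
    (h : (insertRow x r).2 = none) : (insertTableau x (r :: T)).2 = 0 := by
  simp only [insertTableau]
  rcases hr : insertRow x r with ⟨r', _ | y⟩
  · rfl
  · simp [hr] at h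

theorem insertTableau_snd_cons_some {x y : α} {r : List α} {T : List (List α)}
    (h : (insertRow x r).2 = some y) :
    (insertTableau x (r :: T)).2 = (insertTableau y T).2 + 1 := by
  simp only [insertTableau]
  rcases hr : insertRow x r with ⟨r', _ | y⟩
  · simp [hr] at h
  · simp only [hr, Option.some.injEq] at h; subst h; rfl

theorem insertTableau_fst_cons_none {x : α} {r : List α} {T : List (List α)}
    (h : (insertRow x r).2 = none) : (insertTableau x (r :: T)).1 = (insertRow x r).1 :: T := by
  rw [insertTableau_cons, h]; rfl

theorem insertTableau_fst_cons_some {x y : α} {r : List α} {T : List (List α)}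
    (h : (insertRow x r).2 = some y) :
    (insertTableau x (r :: T)).1 = (insertRow x r).1 :: (insertTableau y T).1 := by
  rw [insertTableau_cons, h]; rfl

/-- The row bumping lemma, for increasing insertions. -/
theorem insertTableau_snd_le {x x' : α} {T : List (List α)}
    (hT : ∀ r ∈ T, r.Pairwise (· < ·)) (h : x < x') :
    (insertTableau x' (insertTableau x T).1).2 ≤ (insertTableau x T).2 := by
  induction T generalizing x x' with
  | nil => simp [insertTableau, insertRow, h.not_gt]
  | cons r T ih =>
    have hr := hT r (by simp)
    rcases hy : (insertRow x' (insertRow x r).1).2 with _ | y'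
    · rw [insertTableau_cons x r, insertTableau_snd_cons_none hy]
      exact Nat.zero_le _
    · obtain ⟨y, hy', hlt⟩ := insertRow_insertRow_of_lt hr h hy
      rw [insertTableau_snd_cons_some hy', insertTableau_fst_cons_some hy',
        insertTableau_snd_cons_some hy]
      exact Nat.succ_le_succ (ih (fun r hr => hT r (by simp [hr])) hlt)

/-- The row bumping lemma, for decreasing insertions. -/
theorem insertTableau_snd_lt {x x' : α} {T : List (List α)}
    (hT : ∀ r ∈ T, r.Pairwise (· < ·)) (hx : (x :: T.flatten).Nodup) (h : x' < x) :
    (insertTableau x T).2 < (insertTableau x' (insertTableau x T).1).2 := by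
  induction T generalizing x x' with
  | nil => simp [insertTableau, insertRow, h]
  | cons r T ih =>
    have hr := hT r (by simp)
    have hxr : x ∉ r := fun hxr => by simp [hxr] at hx
    obtain ⟨y', hy', hle⟩ := insertRow_insertRow_of_gt hr hxr h
    rcases hy : (insertRow x r).2 with _ | y
    · rw [insertTableau_snd_cons_none hy, insertTableau_fst_cons_none hy,
        insertTableau_snd_cons_some hy']
      exact Nat.succ_pos _
    · rw [insertTableau_snd_cons_some hy, insertTableau_fst_cons_some hy,
        insertTableau_snd_cons_some hy']
      exact Nat.succ_lt_succ (ih (fun r hr => hT r (by simp [hr]))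
        (nodup_cons_flatten_of_bump hx hy) (hle.trans_lt (lt_of_insertRow_eq_some hy).1))

theorem insertRow_of_none {x : α} {r : List α} (h : (insertRow x r).2 = none) :
    (insertRow x r).1 = r ++ [x] := by
  induction r with
  | nil => rfl
  | cons a r ih =>
    by_cases hx : x < a
    · simp [insertRow, hx] at h
    · simp only [insertRow, hx, if_false] at h ⊢
      simp [ih h]

theorem insertRow_of_forall_lt {x : α} {r : List α} (h : ∀ a ∈ r, a < x) :
    insertRow x r = (r ++ [x], none) := by
  induction r with
  | nil => rfl
  | cons a r ih =>
    simp only [insertRow, (h a (by simp)).not_gt, if_false]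
    rw [ih fun b hb => h b (by simp [hb])]
    rfl

/-- The bumped letter determines the place of bumping: `x` is the last entry of the new row that is
smaller than `y`. -/
theorem insertRow_injective {x x' y : α} {r r' : List α} (hr : r.Pairwise (· < ·))
    (hr' : r'.Pairwise (· < ·)) (h1 : (insertRow x r).1 = (insertRow x' r').1)
    (h : (insertRow x r).2 = some y) (h' : (insertRow x' r').2 = some y) : x = x' ∧ r = r' := by
  -- One insertion cannot stop at the head while the other goes further: the bumped letter would be
  -- `a`, whereas `x'` would lie in the tail `r`, hence above `a`, although a letter only bumps a
  -- larger one.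
  have aux : ∀ {x x' a a' y : α} {r r' : List α}, x < a → ¬ x' < a' →
      (a :: r).Pairwise (· < ·) → (insertRow x (a :: r)).1 = (insertRow x' (a' :: r')).1 →
      (insertRow x (a :: r)).2 = some y → (insertRow x' (a' :: r')).2 = some y → False := by
    intro x x' a a' y r r' hx hx' hr h1 h h'
    simp only [insertRow, hx, hx', if_true, if_false, Option.some.injEq, List.cons.injEq]
      at h h1 h'
    subst h
    have h3 := mem_insertRow_self x' r'
    rw [← h1.2] at h3
    exact lt_asymm (List.rel_of_pairwise_cons hr h3) (lt_of_insertRow_eq_some h').1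
  induction r generalizing r' with
  | nil => simp [insertRow] at h
  | cons a r ih =>
    cases r' with
    | nil => simp [insertRow] at h'
    | cons a' r' =>
      by_cases hx : x < a <;> by_cases hx' : x' < a'
      · simp only [insertRow, hx, hx', if_true, Option.some.injEq, List.cons.injEq] at h h' h1
        exact ⟨h1.1, by rw [h, h', h1.2]⟩
      · exact (aux hx hx' hr h1 h h').elim
      · exact (aux hx' hx hr' h1.symm h' h).elim
      · simp only [insertRow, hx, hx', if_false, List.cons.injEq] at h h' h1
        obtain ⟨h2, h3⟩ := ih hr.of_cons hr'.of_cons h1.2 h h'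
        exact ⟨h2, by rw [h1.1, h3]⟩

/-- The index of the new row says where reverse bumping starts, and each row can then be undone by
`insertRow_injective`. -/
theorem insertTableau_injective {x x' : α} {T T' : List (List α)} (hT : Tab T) (hT' : Tab T')
    (h : insertTableau x T = insertTableau x' T') : x = x' ∧ T = T' := by
  -- An insertion into the empty tableau is not confused with one into a nonempty tableau. This
  -- relies on the absence of empty rows.
  have aux : ∀ {x x' : α} {r : List α} {T : List (List α)}, r ≠ [] →
      insertTableau x [] = insertTableau x' (r :: T) → False := by
    intro x x' r T hr h
    have h2 := congrArg Prod.snd h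
    have h1 := congrArg Prod.fst h
    rcases hy : (insertRow x' r).2 with _ | y
    · rw [insertTableau_fst_cons_none hy, insertRow_of_none hy] at h1
      have := congrArg List.length (List.cons.inj h1).1
      cases r <;> simp_all
    · rw [insertTableau_snd_cons_some hy] at h2
      simp [insertTableau] at h2
  induction T generalizing x x' T' with
  | nil =>
    cases T' with
    | nil => simpa [insertTableau] using h
    | cons r T' => exact (aux hT'.1 h).elim
  | cons r T ih =>
    cases T' with
    | nil => exact (aux hT.1 h.symm).elim
    | cons r' T' =>
      have h2 := congrArg Prod.snd h
      have h1 := congrArg Prod.fst h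
      rcases hy : (insertRow x r).2 with _ | y <;> rcases hy' : (insertRow x' r').2 with _ | y'
      · rw [insertTableau_fst_cons_none hy, insertTableau_fst_cons_none hy',
          insertRow_of_none hy, insertRow_of_none hy'] at h1
        obtain ⟨h3, rfl⟩ := List.cons.inj h1
        obtain ⟨rfl, h4⟩ := List.append_inj' h3 rfl
        simpa using h4
      · rw [insertTableau_snd_cons_none hy, insertTableau_snd_cons_some hy'] at h2
        omega
      · rw [insertTableau_snd_cons_none hy', insertTableau_snd_cons_some hy] at h2
        omega
      · rw [insertTableau_snd_cons_some hy, insertTableau_snd_cons_some hy'] at h2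
        rw [insertTableau_fst_cons_some hy, insertTableau_fst_cons_some hy'] at h1
        obtain ⟨h3, h4⟩ := List.cons.inj h1
        obtain ⟨rfl, rfl⟩ := ih hT.2.2.2 hT'.2.2.2 (Prod.ext h4 (Nat.succ_injective h2))
        obtain ⟨rfl, rfl⟩ := insertRow_injective hT.2.1 hT'.2.1 h3 hy hy'
        exact ⟨rfl, rfl⟩

/-- Reverse bumping: `y` takes the place of the largest entry smaller than `y`, which is expelled.
-/
theorem exists_insertRow_eq {y : α} {r : List α} (hr : r.Pairwise (· < ·)) (hy : y ∉ r)
    (h : ∃ a ∈ r, a < y) :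
    ∃ x s, s.Pairwise (· < ·) ∧ insertRow x s = (r, some y) ∧ x ∈ r := by
  induction r with
  | nil => simp at h
  | cons a r ih =>
    have hya : y ≠ a := fun h => hy (by simp [h])
    by_cases h' : ∃ a ∈ r, a < y
    · obtain ⟨x, s, hs, hxs, hx⟩ := ih hr.of_cons (fun h => hy (by simp [h])) h'
      have hax : a < x := List.rel_of_pairwise_cons hr hx
      refine ⟨x, a :: s, ?_, ?_, by simp [hx]⟩
      · rw [List.pairwise_cons]
        refine ⟨fun b hb => ?_, hs⟩
        have h1 := (insertRow_perm x s).symm.subset (List.mem_cons_of_mem x hb)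
        have hxy : (insertRow x s).2 = some y := by rw [hxs]
        rw [hxs] at h1
        simp only [Option.toList_some, List.mem_append, List.mem_singleton] at h1
        rcases h1 with h1 | rfl
        · exact List.rel_of_pairwise_cons hr h1
        · exact hax.trans (lt_of_insertRow_eq_some hxy).1
      · simp [insertRow, hax.not_gt, hxs]
    · push Not at h'
      have hay : a < y := by
        obtain ⟨b, hb, hby⟩ := h
        rcases List.mem_cons.1 hb with rfl | hb
        · exact hby
        · exact absurd hby (not_lt.2 (h' b hb))
      refine ⟨a, y :: r, ?_, by simp [insertRow, hay], by simp⟩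
      rw [List.pairwise_cons]
      refine ⟨fun b hb => lt_of_le_of_ne (h' b hb) ?_, hr.of_cons⟩
      rintro rfl
      exact hy (by simp [hb])

/-- Undoing the bump raises a single entry, to the value `y`, and all entries of `s` are larger than
that. -/
theorem Dom.of_insertRow_left {r s : List α} {x y : α} (h : Dom (insertRow x r).1 s)
    (hy : (insertRow x r).2 = some y) (hs : ∀ b ∈ s, y < b) : Dom r s := by
  induction r generalizing s with
  | nil => simp [insertRow] at hy
  | cons a r ih =>
    cases s with
    | nil => simp
    | cons b s =>
      by_cases hx : x < a
      · simp only [insertRow, hx, if_true, dom_cons_cons, Option.some.injEq] at h hy ⊢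
        exact ⟨by rw [hy]; exact hs b (by simp), h.2⟩
      · simp only [insertRow, hx, if_false, dom_cons_cons] at h hy ⊢
        exact ⟨h.1, ih h.2 hy fun b hb => hs b (by simp [hb])⟩

theorem Dom.of_insertRow_insertRow {r s : List α} {x y : α} (hr : r.Pairwise (· < ·))
    (hs : s.Pairwise (· < ·)) (hys : y ∉ s)
    (h : Dom (insertRow x r).1 (insertRow y s).1)
    (hy : (insertRow x r).2 = some y) : Dom r s := by
  induction r generalizing s with
  | nil => simp [insertRow] at hy
  | cons a r ih =>
    cases s with
    | nil => simp
    | cons b s =>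
      have hyb' : y ≠ b := fun h => hys (by simp [h])
      have hys' : y ∉ s := fun h => hys (by simp [h])
      by_cases hx : x < a
      · simp only [insertRow, hx, if_true, Option.some.injEq] at h hy
        subst hy
        by_cases hyb : a < b
        · simp only [hyb, if_true, dom_cons_cons] at h
          simp [hyb, h.2]
        -- Here the bumped letter is the head `a` and it would land in the tail of `s`. It would
        -- then have a smaller entry of `r` above it, while every entry of `r` exceeds `a`.
        · simp only [hyb, if_false, dom_cons_cons] at h
          obtain ⟨c, hc, hca⟩ := h.2.exists_lt (mem_insertRow_self a s)
          exact absurd hca (List.rel_of_pairwise_cons hr hc).not_gt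
      · simp only [insertRow, hx, if_false] at h hy
        have hay : a < y := (not_lt.1 hx).trans_lt (lt_of_insertRow_eq_some hy).1
        by_cases hyb : y < b
        · simp only [hyb, if_true, dom_cons_cons] at h
          rw [dom_cons_cons]
          exact ⟨hay.trans hyb, h.2.of_insertRow_left hy
            fun c hc => hyb.trans (List.rel_of_pairwise_cons hs hc)⟩
        · simp only [hyb, if_false, dom_cons_cons] at h
          rw [dom_cons_cons]
          exact ⟨h.1, ih hr.of_cons hs.of_cons hys' h.2 hy⟩

@[simp] theorem ofRows_nil {β : Type} (c : ℕ × ℕ) : ofRows ([] : List (List β)) c = none := rfl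

@[simp] theorem ofRows_cons_zero {β : Type} (r : List β) (T : List (List β)) (j : ℕ) :
    ofRows (r :: T) (0, j) = r[j]? := rfl

@[simp] theorem ofRows_cons_succ {β : Type} (r : List β) (T : List (List β)) (i j : ℕ) :
    ofRows (r :: T) (i + 1, j) = ofRows T (i, j) := rfl

theorem ofRows_zero {β : Type} (T : List (List β)) (j : ℕ) : ofRows T (0, j) = (T.headD [])[j]? := by
  cases T <;> rfl

/-- Reverse insertion from the corner `(n, m)`. The last entry of row `n` is removed and expels one
letter from each row above it in turn. -/
theorem Tab.exists_insertTableau_eq {n m : ℕ} {U : List (List α)} (hU : Tab U)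
    (hd : U.flatten.Nodup) (h : ofRows U (n, m) ≠ none) (hr : ofRows U (n, m + 1) = none)
    (hb : ofRows U (n + 1, m) = none) :
    ∃ x T, Tab T ∧ GenRS.insertTableau x T = (U, n) := by
  induction n generalizing U with
  | zero =>
    cases U with
    | nil => simp at h
    | cons r U =>
      simp only [ofRows_cons_zero, zero_add, ofRows_cons_succ] at h hr hb
      rw [ofRows_zero] at hb
      have hrs := hU.2.1
      obtain ⟨s, x, rfl⟩ : ∃ s x, r = s ++ [x] := by
        rcases List.eq_nil_or_concat r with h | ⟨s, x, h⟩
        · exact absurd h hU.1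
        · exact ⟨s, x, by simpa using h⟩
      have hm : s.length = m := by
        have h1 : m < (s ++ [x]).length := by simpa using h
        have h2 : (s ++ [x]).length ≤ m + 1 := by simpa using hr
        simp at h1 h2; omega
      have hx : insertRow x s = (s ++ [x], none) :=
        insertRow_of_forall_lt fun a ha => (List.pairwise_append.1 hrs).2.2 a ha x (by simp)
      rcases List.eq_nil_or_concat s with rfl | hs
      -- The first row consists of the corner alone. It must disappear rather than remain as an
      -- empty row, and there is no row beneath it.
      · refine ⟨x, [], trivial, ?_⟩
        cases U with
        | nil => rfl
        | cons r' U =>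
          simp only [List.length_nil] at hm
          subst hm
          have := hU.2.2.2.1
          cases r' <;> simp_all
      · refine ⟨x, s :: U, ⟨by rintro rfl; simp at hs, (List.pairwise_append.1 hrs).1, ?_,
          hU.2.2.2⟩, ?_⟩
        · intro j b hj
          obtain ⟨a, ha, hab⟩ := hU.2.2.1 j b hj
          refine ⟨a, ?_, hab⟩
          -- The next row has at most `m` boxes because the box below the corner is absent, so no
          -- entry of it is compared with the deleted `x`.
          have h1 : j < (U.headD []).length := by
            by_contra h1
            rw [List.getElem?_eq_none (not_lt.1 h1)] at hj
            simp at hj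
          have h2 : (U.headD []).length ≤ m := List.getElem?_eq_none_iff.1 hb
          rwa [List.getElem?_append_left (by omega)] at ha
        · simp [GenRS.insertTableau, hx]
  | succ n ih =>
    cases U with
    | nil => simp at h
    | cons r U =>
      simp only [ofRows_cons_succ] at h hr hb
      rw [List.flatten_cons, List.nodup_append] at hd
      obtain ⟨y, T, hT, hyT⟩ := ih hU.2.2.2 hd.2.1 h hr hb
      have hp := insertTableau_perm y T
      rw [hyT] at hp
      have hyU : y ∈ U.flatten := hp.symm.subset (by simp)
      have hhead := headD_insertTableau y T
      rw [hyT] at hhead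
      simp only at hhead hp
      have hyr : y ∉ r := fun hy => hd.2.2 y hy y hyU rfl
      have hdom := hU.2.2.1
      rw [hhead] at hdom
      -- The letter `y` expelled from the lower rows lies in the row just below `r`, so `r` has an
      -- entry smaller than `y` and reverse bumping can continue.
      obtain ⟨x, s, hs, hxs, -⟩ :=
        exists_insertRow_eq hU.2.1 hyr (hdom.exists_lt (mem_insertRow_self y _))
      refine ⟨x, s :: T, ⟨?_, hs, ?_, hT⟩, ?_⟩
      · rintro rfl; simp [insertRow] at hxs
      · refine Dom.of_insertRow_insertRow (x := x) (y := y) hs hT.headD_sorted ?_ ?_ (by rw [hxs])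
        · intro hy
          have h1 := hp.nodup hd.2.1
          rw [List.nodup_cons] at h1
          refine h1.1 ?_
          cases T with
          | nil => simp at hy
          | cons t T => simp only [List.headD_cons] at hy; simp [hy]
        · rw [hxs]; exact hdom
      · simp [GenRS.insertTableau, hxs, hyT]

theorem length_insertRow (x : α) (r : List α) :
    (insertRow x r).1.length + (insertRow x r).2.toList.length = r.length + 1 := by
  simpa using (insertRow_perm x r).length_eq

/-- Insertion adds a box to the shape, in the row recorded by `insertTableau`. -/
theorem exists_shape_insertTableau (x : α) (T : List (List α)) :
    ∃ m, ofRows T ((insertTableau x T).2, m) = none ∧ ∀ c,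
      (ofRows (insertTableau x T).1 c ≠ none ↔
        ofRows T c ≠ none ∨ c = ((insertTableau x T).2, m)) := by
  induction T generalizing x with
  | nil =>
    refine ⟨0, rfl, ?_⟩
    rintro ⟨_ | i, j⟩
    · simp [insertTableau]
    · simp [insertTableau]
  | cons r T ih =>
    have hl := length_insertRow x r
    rcases hy : (insertRow x r).2 with _ | y
    · rw [insertTableau_snd_cons_none hy, insertTableau_fst_cons_none hy]
      rw [hy] at hl
      refine ⟨r.length, by simp, ?_⟩
      rintro ⟨_ | i, j⟩
      · simp at hl ⊢; omega
      · simp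
    · rw [insertTableau_snd_cons_some hy, insertTableau_fst_cons_some hy]
      rw [hy] at hl
      obtain ⟨m, h1, h2⟩ := ih y
      refine ⟨m, by simpa using h1, ?_⟩
      rintro ⟨_ | i, j⟩
      · simp at hl ⊢; omega
      · simpa using h2 (i, j)

/-! ### The tableau of a reading word -/

/-- The letters of `r` replace those of `s` one by one from the left, and the letters in excess are
appended. `A` is the part of the row already replaced. -/
theorem bumpRow_of_dom {A r s : List α} (hr : (A ++ r).Pairwise (· < ·)) (h : Dom r s) :
    bumpRow (A ++ s) r = (A ++ r, s) := by
  induction r generalizing A s with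
  | nil => cases s <;> simp_all [bumpRow]
  | cons a r ih =>
    have hA : ∀ b ∈ A, ¬ a < b := fun b hb =>
      ((List.pairwise_append.1 hr).2.2 b hb a (by simp)).not_gt
    have hr' : (A ++ [a] ++ r).Pairwise (· < ·) := by simpa using hr
    cases s with
    | nil =>
      have h1 : insertRow a (A ++ []) = (A ++ [a] ++ [], none) := by
        rw [List.append_nil, List.append_nil]
        exact insertRow_of_forall_lt fun b hb => (List.pairwise_append.1 hr).2.2 b hb a (by simp)
      rw [bumpRow, h1]
      simpa using ih hr' (dom_nil r)
    | cons b s =>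
      rw [dom_cons_cons] at h
      have h1 : insertRow a (A ++ b :: s) = (A ++ [a] ++ s, some b) := by
        clear hr hr'
        induction A with
        | nil => simp [insertRow, h.1]
        | cons c A ihA =>
          have := ihA fun b hb => hA b (by simp [hb])
          simp [insertRow, hA c (by simp), this]
      rw [bumpRow, h1]
      simp only [ih hr' h.2]
      simp

/-- The row reading word of a tableau. -/
def readRows {β : Type} (T : List (List β)) : List β := T.reverse.flatten

@[simp] theorem readRows_cons {β : Type} (r : List β) (T : List (List β)) :
    readRows (r :: T) = readRows T ++ r := by
  simp [readRows]

theorem readRows_perm {β : Type} (T : List (List β)) : (readRows T).Perm T.flatten :=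
  (List.reverse_perm T).flatten

/-- Each row is expelled as a whole, in order, and pushes out the next one. -/
theorem insertWord_of_dom {r : List α} {T : List (List α)} (h : Tab T)
    (hr : r.Pairwise (· < ·)) (hne : r ≠ []) (hd : Dom r (T.headD [])) :
    insertWord T r = r :: T := by
  induction T generalizing r with
  | nil =>
    have := bumpRow_of_dom (A := []) (r := r) (s := []) (by simpa using hr) (by simp)
    cases r with
    | nil => simp at hne
    | cons a r =>
      rw [insertWord_nil_cons, insertWord_row]
      simp only [List.nil_append] at this
      rw [this]; rfl
  | cons s T ih =>
    have := bumpRow_of_dom (A := []) (r := r) (s := s) (by simpa using hr) hd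
    simp only [List.nil_append] at this
    rw [insertWord_row, this, ih h.2.2.2 h.2.1 h.1 h.2.2.1]

theorem Tab.insertWord_readRows {T : List (List α)} (h : Tab T) :
    GenRS.insertWord [] (readRows T) = T := by
  induction T with
  | nil => rfl
  | cons r T ih =>
    rw [readRows_cons, insertWord_append, ih h.2.2.2,
      insertWord_of_dom h.2.2.2 h.2.1 h.1 h.2.2.1]

/-- The form in which Knuth equivalence is used: a tableau is identified from the Knuth class of its
reading word alone. -/
theorem Tab.eq_insertWord_of_knuth {T U : List (List α)} {w : List α} (hT : Tab T) (hU : Tab U)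
    (hd : U.flatten.Nodup) (h : Knuth (readRows U) (readRows T ++ w)) :
    U = GenRS.insertWord T w := by
  rw [← hU.insertWord_readRows, h.insertWord_eq (by simp)
    (by simpa using (readRows_perm U).symm.nodup hd), insertWord_append, hT.insertWord_readRows]

end GenRS

namespace GenRS

/-! ### Tableaux as fillings -/

section Basic
variable {α : Type}

/-- The filling is supported in the `n × m` rectangle. -/
def Within (n m : ℕ) (F : Filling α) : Prop := ∀ c, F c ≠ none → c.1 < n ∧ c.2 < m

theorem Within.finite {n m : ℕ} {F : Filling α} (h : Within n m F) : (shape F).Finite :=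
  ((Set.finite_Iio n).prod (Set.finite_Iio m)).subset fun c hc => h c hc

theorem exists_within {F : Filling α} (h : (shape F).Finite) : ∃ n, Within n n F := by
  obtain ⟨⟨a, b⟩, hb⟩ := h.bddAbove
  refine ⟨a + b + 1, fun c hc => ?_⟩
  have := hb (show c ∈ shape F from hc)
  have h1 : c.1 ≤ a := this.1
  have h2 : c.2 ≤ b := this.2
  omega

/-- The reading word of row `i`, read up to column `m`. -/
def rowWord (m : ℕ) (F : Filling α) (i : ℕ) : List α := (List.range m).filterMap fun j => F (i, j)

/-- The row reading word of a filling supported in the `n × m` rectangle. -/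
def readWord (n m : ℕ) (F : Filling α) : List α := (List.range n).reverse.flatMap (rowWord m F)

/-- Removal of the first row. -/
def dropRow (F : Filling α) : Filling α := fun c => F (c.1 + 1, c.2)

/-- Reflection across the main diagonal. -/
def transpose (F : Filling α) : Filling α := fun c => F c.swap

@[simp] theorem transpose_transpose (F : Filling α) : transpose (transpose F) = F := rfl

theorem transpose_injective {F G : Filling α} (h : transpose F = transpose G) : F = G := by
  rw [← transpose_transpose F, h, transpose_transpose]

theorem mem_readWord {n m : ℕ} {F : Filling α} {a : α} :
    a ∈ readWord n m F ↔ ∃ i < n, ∃ j < m, F (i, j) = some a := by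
  simp [readWord, rowWord]

theorem readWord_succ (n m : ℕ) (F : Filling α) :
    readWord (n + 1) m F = readWord n m (dropRow F) ++ rowWord m F 0 := by
  simp only [readWord, List.range_succ_eq_map, List.reverse_cons, List.flatMap_append,
    List.flatMap_singleton, ← List.map_reverse, List.flatMap_map]
  rfl

theorem rowWord_succ (m : ℕ) (F : Filling α) (i : ℕ) :
    rowWord (m + 1) F i = (F (i, 0)).toList ++ (List.range m).filterMap fun j => F (i, j + 1) := by
  simp only [rowWord, List.range_succ_eq_map, List.filterMap_cons, List.filterMap_map]
  cases F (i, 0) <;> rfl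

theorem filterMap_getElem? {r : List α} {m : ℕ} (h : r.length ≤ m) :
    ((List.range m).filterMap fun j => r[j]?) = r := by
  induction m generalizing r with
  | zero => simp_all
  | succ m ih =>
    rw [List.range_succ_eq_map, List.filterMap_cons, List.filterMap_map]
    cases r with
    | nil => simp
    | cons a r =>
      have := ih (r := r) (by simpa using h)
      simpa [Function.comp_def] using this

theorem rowWord_ofRows_cons {r : List α} {T : List (List α)} {m : ℕ} (h : r.length ≤ m) :
    rowWord m (ofRows (r :: T)) 0 = r := filterMap_getElem? h

theorem readWord_ofRows {n m : ℕ} {T : List (List α)} (hn : T.length ≤ n)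
    (hm : ∀ r ∈ T, r.length ≤ m) : readWord n m (ofRows T) = readRows T := by
  induction T generalizing n with
  | nil =>
    refine List.eq_nil_iff_forall_not_mem.2 fun a ha => ?_
    simp [mem_readWord] at ha
  | cons r T ih =>
    obtain ⟨n, rfl⟩ : ∃ k, n = k + 1 := ⟨n - 1, by simp at hn; omega⟩
    rw [readWord_succ, rowWord_ofRows_cons (hm r (by simp)), readRows_cons,
      ← ih (n := n) (by simpa using hn) fun r hr => hm r (by simp [hr])]
    rfl

theorem mem_flatten_iff {T : List (List α)} {a : α} :
    a ∈ T.flatten ↔ ∃ c, ofRows T c = some a := by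
  induction T with
  | nil => simp
  | cons r T ih =>
    rw [List.flatten_cons, List.mem_append, ih, List.mem_iff_getElem?]
    constructor
    · rintro (⟨j, h⟩ | ⟨c, h⟩)
      · exact ⟨(0, j), h⟩
      · exact ⟨(c.1 + 1, c.2), h⟩
    · rintro ⟨⟨_ | i, j⟩, h⟩
      · exact Or.inl ⟨j, h⟩
      · exact Or.inr ⟨(i, j), h⟩

theorem within_ofRows {n m : ℕ} {T : List (List α)} (hne : ∀ r ∈ T, r ≠ []) :
    Within n m (ofRows T) ↔ T.length ≤ n ∧ ∀ r ∈ T, r.length ≤ m := by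
  induction T generalizing n with
  | nil => simp [Within]
  | cons r T ih =>
    have ih := @ih (n - 1) fun r hr => hne r (by simp [hr])
    have hr : 0 < r.length := List.length_pos_iff.2 (hne r (by simp))
    constructor
    · intro h
      have h0 := h (0, r.length - 1) (by rw [ofRows_cons_zero, ne_eq, List.getElem?_eq_none_iff]; omega)
      have h1 := ih.1 fun c hc => by
        have := h (c.1 + 1, c.2) hc
        exact ⟨by have := this.1; simp at this; omega, this.2⟩
      simp only at h0
      refine ⟨by simp; omega, ?_⟩
      intro s hs
      rcases List.mem_cons.1 hs with rfl | hs
      · omega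
      · exact h1.2 s hs
    · rintro ⟨h1, h2⟩ ⟨_ | i, j⟩ hc
      · have h3 : j < r.length := by simpa using hc
        have := h2 r (by simp)
        exact ⟨by simp at h1; simp; omega, by simp; omega⟩
      · have := ih.2 ⟨by simp at h1; omega, fun r hr => h2 r (by simp [hr])⟩ (i, j) hc
        exact ⟨by have := this.1; simp at this ⊢; omega, this.2⟩

theorem exists_within_ofRows (T : List (List α)) : ∃ n, Within n n (ofRows T) := by
  induction T with
  | nil => exact ⟨0, by simp [Within]⟩
  | cons r T ih =>
    obtain ⟨n, hn⟩ := ih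
    refine ⟨n + r.length + 1, ?_⟩
    rintro ⟨_ | i, j⟩ hc
    · have : j < r.length := by simpa using hc
      simp; omega
    · have := hn (i, j) hc
      simp only at this
      simp; omega

theorem ofRows_injective {T U : List (List α)} (hT : ∀ r ∈ T, r ≠ []) (hU : ∀ r ∈ U, r ≠ [])
    (h : ofRows T = ofRows U) : T = U := by
  have aux : ∀ {r : List α} {T : List (List α)}, r ≠ [] → ofRows [] = ofRows (r :: T) → False := by
    intro r T hr h
    have := congrFun h (0, 0)
    cases r <;> simp at this hr
  induction T generalizing U with
  | nil =>
    cases U with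
    | nil => rfl
    | cons r U => exact (aux (hU r (by simp)) h).elim
  | cons r T ih =>
    cases U with
    | nil => exact (aux (hT r (by simp)) h.symm).elim
    | cons s U =>
      have h1 : r = s := List.ext_getElem? fun j => congrFun h (0, j)
      have h2 := ih (fun r hr => hT r (by simp [hr])) (U := U) (fun r hr => hU r (by simp [hr]))
        (funext fun c => congrFun h (c.1 + 1, c.2))
      rw [h1, h2]

theorem isLowerSet_of_steps {s : Set (ℕ × ℕ)} (hr : ∀ i j, (i, j + 1) ∈ s → (i, j) ∈ s)
    (hc : ∀ i j, (i + 1, j) ∈ s → (i, j) ∈ s) : IsLowerSet s := by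
  have h1 : ∀ i j k, (i, j + k) ∈ s → (i, j) ∈ s := by
    intro i j k
    induction k with
    | zero => exact id
    | succ k ih => exact fun h => ih (hr _ _ h)
  have h2 : ∀ i j k, (i + k, j) ∈ s → (i, j) ∈ s := by
    intro i j k
    induction k with
    | zero => exact id
    | succ k ih => exact fun h => ih (hc _ _ h)
  rintro ⟨i', j'⟩ ⟨i, j⟩ ⟨hi, hj⟩ h
  obtain ⟨a, rfl⟩ := Nat.exists_eq_add_of_le (show i ≤ i' from hi)
  obtain ⟨b, rfl⟩ := Nat.exists_eq_add_of_le (show j ≤ j' from hj)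
  exact h2 _ _ a (h1 _ _ b h)

end Basic

variable {α : Type} [LinearOrder α]

/-- The entries of the filling increase towards the south-east. -/
def Increasing (F : Filling α) : Prop :=
  ∀ c c' a b, F c = some a → F c' = some b → c < c' → a < b

/-- Since the shape is a lower set, two comparable boxes are joined by a path of unit steps inside
the diagram; the last step gives strictness. -/
theorem increasing_of_steps {F : Filling α} (hl : IsLowerSet (shape F))
    (hr : ∀ i j a b, F (i, j) = some a → F (i, j + 1) = some b → a < b)
    (hc : ∀ i j a b, F (i, j) = some a → F (i + 1, j) = some b → a < b) : Increasing F := by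
  have hmem : ∀ {c c' b}, F c' = some b → c ≤ c' → ∃ a, F c = some a := by
    intro c c' b hb hle
    exact Option.ne_none_iff_exists'.1 (hl hle (show F c' ≠ none by simp [hb]))
  have h1 : ∀ k i j a b, F (i, j) = some a → F (i, j + k) = some b → a ≤ b := by
    intro k
    induction k with
    | zero => intro i j a b ha hb; simp_all
    | succ k ih =>
      intro i j a b ha hb
      obtain ⟨d, hd⟩ := hmem (c := (i, j + k)) hb ⟨le_rfl, by simp⟩
      exact (ih i j a d ha hd).trans (hr _ _ _ _ hd hb).le
  have h2 : ∀ k i j a b, F (i, j) = some a → F (i + k, j) = some b → a ≤ b := by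
    intro k
    induction k with
    | zero => intro i j a b ha hb; simp_all
    | succ k ih =>
      intro i j a b ha hb
      obtain ⟨d, hd⟩ := hmem (c := (i + k, j)) hb ⟨by simp, le_rfl⟩
      exact (ih i j a d ha hd).trans (hc _ _ _ _ hd hb).le
  have h3 : ∀ i j k l a b, F (i, j) = some a → F (i + k, j + l) = some b → a ≤ b := by
    intro i j k l a b ha hb
    obtain ⟨d, hd⟩ := hmem (c := (i, j + l)) hb ⟨by simp, le_rfl⟩
    exact (h1 l i j a d ha hd).trans (h2 k _ _ _ _ hd hb)
  rintro ⟨i, j⟩ ⟨i', j'⟩ a b ha hb hlt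
  have hle := hlt.le
  obtain ⟨k, rfl⟩ := Nat.exists_eq_add_of_le (show i ≤ i' from hle.1)
  obtain ⟨l, rfl⟩ := Nat.exists_eq_add_of_le (show j ≤ j' from hle.2)
  cases k with
  | succ k =>
    obtain ⟨d, hd⟩ := hmem (c := (i + k, j + l)) hb ⟨by simp, le_rfl⟩
    exact (h3 i j k l a d ha hd).trans_lt (hc _ _ _ _ hd hb)
  | zero =>
    cases l with
    | zero => simp at hlt
    | succ l =>
      obtain ⟨d, hd⟩ := hmem (c := (i, j + l)) hb ⟨by simp, by simp⟩
      exact (h1 l i j a d ha hd).trans_lt (hr _ _ _ _ hd hb)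

/-- Young tableaux of straight shape with distinct entries. -/
structure STab (F : Filling α) : Prop where
  finite : (shape F).Finite
  lower : IsLowerSet (shape F)
  increasing : Increasing F
  injective : ∀ c c' a, F c = some a → F c' = some a → c = c'

theorem STab.transpose {F : Filling α} (h : STab F) : STab (transpose F) where
  finite := h.finite.preimage Prod.swap_injective.injOn
  lower c c' hle hc := h.lower (show c'.swap ≤ c.swap from ⟨hle.2, hle.1⟩) hc
  increasing c c' a b ha hb hlt := by
    refine h.increasing c.swap c'.swap a b ha hb (lt_of_le_of_ne ⟨hlt.le.2, hlt.le.1⟩ ?_)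
    exact fun h => hlt.ne (Prod.swap_injective h)
  injective c c' a ha hb := Prod.swap_injective (h.injective _ _ a ha hb)

theorem Tab.sTab {T : List (List α)} (h : Tab T) (hd : T.flatten.Nodup) : STab (ofRows T) := by
  have hstep : ∀ i j b, ofRows T (i + 1, j) = some b → ∃ a, ofRows T (i, j) = some a ∧ a < b := by
    intro i
    clear hd
    induction i generalizing T with
    | zero =>
      intro j b hb
      cases T with
      | nil => simp at hb
      | cons r T =>
        rw [zero_add, ofRows_cons_succ, ofRows_zero] at hb
        exact h.2.2.1 j b hb
    | succ i ih =>
      intro j b hb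
      cases T with
      | nil => simp at hb
      | cons r T => exact ih h.2.2.2 j b hb
  have hlow : IsLowerSet (shape (ofRows T)) := by
    refine isLowerSet_of_steps ?_ ?_
    · intro i j hj
      simp only [shape, Set.mem_ofPred_eq, ofRows] at hj ⊢
      rcases hi : T[i]? with _ | r
      · simp [hi] at hj
      · simp only [hi, Option.bind_some, ne_eq, List.getElem?_eq_none_iff, not_le] at hj ⊢
        omega
    · intro i j hj
      obtain ⟨b, hb⟩ := Option.ne_none_iff_exists'.1 hj
      obtain ⟨a, ha, -⟩ := hstep i j b hb
      simp [shape, ha]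
  refine ⟨?_, hlow, increasing_of_steps hlow ?_ ?_, ?_⟩
  · obtain ⟨n, hn⟩ := exists_within_ofRows T
    exact hn.finite
  · intro i j a b ha hb
    simp only [ofRows] at ha hb
    rcases hi : T[i]? with _ | r
    · simp [hi] at ha
    · simp only [hi, Option.bind_some] at ha hb
      have hs := h.rows_sorted r (List.mem_of_getElem? hi)
      obtain ⟨hj, rfl⟩ := List.getElem?_eq_some_iff.1 ha
      obtain ⟨hj', rfl⟩ := List.getElem?_eq_some_iff.1 hb
      exact List.pairwise_iff_getElem.1 hs j (j + 1) hj hj' (Nat.lt_succ_self j)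
  · intro i j a b ha hb
    obtain ⟨a', ha', hlt⟩ := hstep i j b hb
    rw [ha] at ha'
    rwa [Option.some.inj ha']
  · clear hlow hstep h
    induction T with
    | nil => simp
    | cons r T ih =>
      rw [List.flatten_cons, List.nodup_append] at hd
      rintro ⟨_ | i, j⟩ ⟨_ | i', j'⟩ a ha hb
      · rw [ofRows_cons_zero] at ha hb
        obtain ⟨hj, rfl⟩ := List.getElem?_eq_some_iff.1 ha
        obtain ⟨hj', hjj⟩ := List.getElem?_eq_some_iff.1 hb
        rw [(List.Nodup.getElem_inj_iff hd.1).1 hjj]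
      · exact (hd.2.2 a (List.mem_of_getElem? ha) a (mem_flatten_iff.2 ⟨(i', j'), hb⟩) rfl).elim
      · exact (hd.2.2 a (List.mem_of_getElem? hb) a (mem_flatten_iff.2 ⟨(i, j), ha⟩) rfl).elim
      · have := ih hd.2.1 (i, j) (i', j') a ha hb
        simp_all

theorem exists_list_of_lower {β : Type} {m : ℕ} {f : ℕ → Option β}
    (hl : ∀ j, f (j + 1) ≠ none → f j ≠ none) (hm : ∀ j, f j ≠ none → j < m) :
    ∃ r : List β, ∀ j, r[j]? = f j := by
  induction m generalizing f with
  | zero => exact ⟨[], fun j => by by_contra h; simpa using hm j (by simpa using Ne.symm h)⟩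
  | succ m ih =>
    rcases h0 : f 0 with _ | a
    · refine ⟨[], fun j => ?_⟩
      induction j with
      | zero => simp [h0]
      | succ j ihj => by_contra h; exact hl j (by simpa using Ne.symm h) (by rw [← ihj]; simp)
    · obtain ⟨r, hr⟩ := ih (f := fun j => f (j + 1)) (fun j => hl (j + 1))
        (fun j hj => by have := hm _ hj; omega)
      refine ⟨a :: r, fun j => ?_⟩
      cases j with
      | zero => simp [h0]
      | succ j => simpa using hr j

theorem STab.dropRow {F : Filling α} (h : STab F) : STab (dropRow F) where
  finite := h.finite.preimage (f := fun c : ℕ × ℕ => (c.1 + 1, c.2)) (by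
    rintro ⟨a, b⟩ - ⟨c, d⟩ - h; simpa using h)
  lower c c' hle hc := h.lower (show (c'.1 + 1, c'.2) ≤ (c.1 + 1, c.2) from
    ⟨Nat.succ_le_succ hle.1, hle.2⟩) hc
  increasing c c' a b ha hb hlt := by
    refine h.increasing _ _ a b ha hb (lt_of_le_of_ne ⟨Nat.succ_le_succ hlt.le.1, hlt.le.2⟩ ?_)
    intro h
    simp only [Prod.mk.injEq, add_left_inj] at h
    exact hlt.ne (Prod.ext h.1 h.2)
  injective c c' a ha hb := by
    have := h.injective _ _ a ha hb
    simp only [Prod.mk.injEq, add_left_inj] at this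
    exact Prod.ext this.1 this.2

/-- The bridge between the two models: insertion works on lists of rows, whereas slides and
reflection work on fillings. The rows are peeled off from the top. -/
theorem STab.exists_tab {F : Filling α} (h : STab F) :
    ∃ T, Tab T ∧ T.flatten.Nodup ∧ ofRows T = F := by
  obtain ⟨m, hm⟩ := exists_within h.finite
  have key : ∀ n (F : Filling α), STab F → Within n m F →
      ∃ T, Tab T ∧ T.flatten.Nodup ∧ ofRows T = F := by
    intro n
    induction n with
    | zero =>
      intro F _ hn
      refine ⟨[], trivial, by simp, ?_⟩
      funext c
      by_contra hc
      exact absurd (hn c (Ne.symm hc)).1 (Nat.not_lt_zero _)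
    | succ n ih =>
      intro F hF hn
      by_cases h0 : F (0, 0) = none
      · refine ⟨[], trivial, by simp, ?_⟩
        funext c
        by_contra hc
        exact hF.lower (show (0, 0) ≤ c from ⟨Nat.zero_le _, Nat.zero_le _⟩) (Ne.symm hc) h0
      · obtain ⟨T, hT, hd, hTF⟩ := ih (GenRS.dropRow F) hF.dropRow fun c hc => by
          have := hn _ hc
          exact ⟨by have := this.1; simp at this; omega, this.2⟩
        obtain ⟨r, hr⟩ := exists_list_of_lower (f := fun j => F (0, j)) (m := m)
          (fun j hj => hF.lower (show (0, j) ≤ (0, j + 1) from ⟨le_rfl, Nat.le_succ j⟩) hj)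
          (fun j hj => (hn _ hj).2)
        have hEq : ofRows (r :: T) = F := by
          funext ⟨i, j⟩
          cases i with
          | zero => simpa using hr j
          | succ i => rw [ofRows_cons_succ, hTF]; rfl
        have hsort : r.Pairwise (· < ·) := by
          rw [List.pairwise_iff_getElem]
          intro j j' hj hj' hlt
          refine hF.increasing (0, j) (0, j') _ _ ((hr j).symm.trans (List.getElem?_eq_getElem hj))
            ((hr j').symm.trans (List.getElem?_eq_getElem hj')) ?_
          exact Prod.mk_lt_mk_iff_right.2 hlt
        refine ⟨r :: T, ⟨?_, hsort, ?_, hT⟩, ?_, hEq⟩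
        · rintro rfl
          exact h0 (hr 0).symm
        · intro j b hb
          rw [← ofRows_zero, hTF] at hb
          have hb' : F (1, j) = some b := hb
          obtain ⟨a, ha⟩ := Option.ne_none_iff_exists'.1
            (hF.lower (show (0, j) ≤ (1, j) from ⟨Nat.zero_le _, le_rfl⟩)
              (show F (1, j) ≠ none by simp [hb']))
          exact ⟨a, (hr j).trans ha, hF.increasing _ _ _ _ ha hb'
            (Prod.mk_lt_mk_iff_left.2 Nat.zero_lt_one)⟩
        · rw [List.flatten_cons, List.nodup_append]
          refine ⟨hsort.imp ne_of_lt, hd, ?_⟩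
          rintro a ha _ hb rfl
          obtain ⟨j, hj⟩ := List.mem_iff_getElem?.1 ha
          obtain ⟨c, hc⟩ := mem_flatten_iff.1 hb
          rw [hTF] at hc
          have := hF.injective (0, j) (c.1 + 1, c.2) a ((hr j).symm.trans hj) hc
          simp at this
  exact key m F h hm

theorem Tab.readWord_ofRows {n m : ℕ} {T : List (List α)} (hT : Tab T)
    (h : Within n m (ofRows T)) : readWord n m (ofRows T) = readRows T := by
  obtain ⟨h1, h2⟩ := (within_ofRows hT.rows_ne_nil).1 h
  exact GenRS.readWord_ofRows h1 h2

/-! ### Row and column reading words -/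

/-- A letter `c` smaller than the whole first column bumps the head of the top row, which bumps the
head of the next row, and so on. The column moves down by one place, its last letter `l` comes out
at the front of the word, and the tails of the rows are unchanged. -/
theorem knuth_shift_column {ps : List (α × List α)} {c : α}
    (h : ∀ p ∈ ps, (p.1 :: p.2).Pairwise (· < ·))
    (hc : (c :: ps.map Prod.fst).Pairwise (· < ·)) :
    ∃ (qs : List (α × List α)) (l : α), (∀ p ∈ qs, (p.1 :: p.2).Pairwise (· < ·)) ∧
      qs.map Prod.snd = ps.map Prod.snd ∧ qs.map Prod.fst ++ [l] = c :: ps.map Prod.fst ∧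
      Knuth (readRows (ps.map fun p => p.1 :: p.2) ++ [c])
        (l :: readRows (qs.map fun p => p.1 :: p.2)) := by
  induction ps generalizing c with
  | nil => exact ⟨[], c, by simp, rfl, rfl, .refl _⟩
  | cons p ps ih =>
    obtain ⟨d, r⟩ := p
    simp only [List.map_cons] at hc
    obtain ⟨qs, l, h1, h2, h3, h4⟩ := ih (fun p hp => h p (by simp [hp])) hc.of_cons
    have hdr : (d :: r).Pairwise (· < ·) := h (d, r) (by simp)
    have hcd : c < d := List.rel_of_pairwise_cons hc (by simp)
    have hcr : (c :: r).Pairwise (· < ·) := by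
      rw [List.pairwise_cons] at hdr ⊢
      exact ⟨fun a ha => hcd.trans (hdr.1 a ha), hdr.2⟩
    refine ⟨(c, r) :: qs, l, ?_, by simp [h2], by simp [h3], ?_⟩
    · intro p hp
      rcases List.mem_cons.1 hp with rfl | hp
      · exact hcr
      · exact h1 p hp
    · have h5 := (Knuth.bump (A := []) (x := c) (by simp) hdr hcd).append_left
        (readRows (ps.map fun p => p.1 :: p.2))
      have h6 := h4.append_right (c :: r)
      simp only [List.map_cons, readRows_cons, List.append_assoc, List.nil_append,
        List.cons_append] at h5 h6 ⊢
      exact h5.trans h6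

/-- The first column can be read before everything else. The head of the top row acts as the letter
`c` of `knuth_shift_column` on the rows below, which brings the bottom letter of the column to the
front; the shifted rows, one fewer in number, are treated by induction. -/
theorem knuth_split_column {ps : List (α × List α)}
    (h : ∀ p ∈ ps, (p.1 :: p.2).Pairwise (· < ·)) (hc : (ps.map Prod.fst).Pairwise (· < ·)) :
    Knuth (readRows (ps.map fun p => p.1 :: p.2))
      ((ps.map Prod.fst).reverse ++ readRows (ps.map Prod.snd)) := by
  induction hn : ps.length generalizing ps with
  | zero =>
    obtain rfl := List.length_eq_zero_iff.1 hn
    exact .refl _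
  | succ n ih =>
    cases ps with
    | nil => simp at hn
    | cons p ps =>
      obtain ⟨c, r⟩ := p
      obtain ⟨qs, l, h1, h2, h3, h4⟩ := knuth_shift_column (fun p hp => h p (by simp [hp])) hc
      have hlen : qs.length = n := by
        have := congrArg List.length h2
        simp at this hn
        omega
      have hq : (qs.map Prod.fst).Pairwise (· < ·) := by
        have : (qs.map Prod.fst ++ [l]).Pairwise (· < ·) := by rw [h3]; exact hc
        exact (List.pairwise_append.1 this).1
      have h5 := (h4.trans ((ih h1 hq hlen).append_left [l])).append_right r
      have h6 := congrArg List.reverse h3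
      rw [List.reverse_append] at h6
      simp only [List.reverse_singleton, List.singleton_append] at h6
      simp only [List.map_cons, readRows_cons, ← h6, ← h2]
      simpa using h5

theorem Tab.knuth_split_column {T : List (List α)} (hT : Tab T) :
    Knuth (readRows T) ((T.map (List.take 1)).flatten.reverse ++ readRows (T.map List.tail)) := by
  have key : ∃ ps : List (α × List α), T = ps.map (fun p => p.1 :: p.2) ∧
      (∀ p ∈ ps, (p.1 :: p.2).Pairwise (· < ·)) ∧ (ps.map Prod.fst).Pairwise (· < ·) := by
    induction T with
    | nil => exact ⟨[], by simp⟩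
    | cons r T ih =>
      obtain ⟨ps, rfl, h2, h3⟩ := ih hT.2.2.2
      cases r with
      | nil => exact absurd rfl hT.1
      | cons a r =>
        refine ⟨(a, r) :: ps, rfl, ?_, ?_⟩
        · intro p hp
          rcases List.mem_cons.1 hp with rfl | hp
          · exact hT.2.1
          · exact h2 p hp
        · cases ps with
          | nil => simp
          | cons p ps =>
            have hlt : a < p.1 := (dom_cons_cons.1 hT.2.2.1).1
            simp only [List.map_cons] at h3 ⊢
            rw [List.pairwise_cons]
            refine ⟨fun b hb => ?_, h3⟩
            rcases List.mem_cons.1 hb with rfl | hb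
            · exact hlt
            · exact hlt.trans (List.rel_of_pairwise_cons h3 hb)
  obtain ⟨ps, rfl, h2, h3⟩ := key
  have h4 := GenRS.knuth_split_column h2 h3
  have h5 : ((ps.map fun p => p.1 :: p.2).map (List.take 1)).flatten = ps.map Prod.fst := by
    clear h2 h3 h4 hT
    induction ps with
    | nil => rfl
    | cons p ps ih => simpa using ih
  rw [h5, List.map_map]
  exact h4

theorem rowWord_transpose_ofRows {β : Type} {n : ℕ} {T : List (List β)} (hn : T.length ≤ n) :
    rowWord n (transpose (ofRows T)) 0 = (T.map (List.take 1)).flatten := by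
  induction T generalizing n with
  | nil => simp [rowWord, transpose]
  | cons r T ih =>
    obtain ⟨n, rfl⟩ : ∃ k, n = k + 1 := ⟨n - 1, by simp at hn; omega⟩
    rw [rowWord_succ, List.map_cons, List.flatten_cons, ← ih (n := n) (by simpa using hn)]
    have : (transpose (ofRows (r :: T)) (0, 0)).toList = r.take 1 := by
      cases r <;> simp [transpose]
    rw [this]
    rfl

/-- Splitting off the columns one after another turns the row reading into the column reading, and
the latter is the reversed row reading of the reflected tableau. -/
theorem knuth_readWord_transpose_reverse {n m : ℕ} {F : Filling α} (h : STab F)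
    (hw : Within n m F) : Knuth (readWord n m F) (readWord m n (transpose F)).reverse := by
  induction m generalizing F with
  | zero =>
    have : readWord n 0 F = [] := List.eq_nil_iff_forall_not_mem.2 fun a ha => by
      simp [mem_readWord] at ha
    rw [this]
    exact .refl _
  | succ m ih =>
    obtain ⟨T, hT, -, rfl⟩ := h.exists_tab
    obtain ⟨h1, h2⟩ := (within_ofRows hT.rows_ne_nil).1 hw
    rw [hT.readWord_ofRows hw, readWord_succ, List.reverse_append, rowWord_transpose_ofRows h1]
    refine hT.knuth_split_column.trans (.append_left _ ?_)
    have hdrop : transpose (dropRow (transpose (ofRows T))) = ofRows (T.map List.tail) := by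
      funext c
      simp only [transpose, dropRow, ofRows, Prod.swap]
      rw [List.getElem?_map]
      cases T[c.1]? <;> simp
    have h3 := ih (F := transpose (dropRow (transpose (ofRows T)))) h.transpose.dropRow.transpose
      fun c hc => by
        have := hw (c.1, c.2 + 1) hc
        exact ⟨this.1, by have := this.2; simp at this; omega⟩
    rw [transpose_transpose] at h3
    -- Some tails may be empty, so the list of tails need not be a `Tab`; the version of the lemma
    -- for arbitrary lists of rows is needed.
    rw [hdrop, GenRS.readWord_ofRows (by simpa using h1)] at h3
    · exact h3
    · intro r hr
      obtain ⟨s, hs, rfl⟩ := List.mem_map.1 hr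
      have := h2 s hs
      simp; omega

theorem Within.transpose {β : Type} {n m : ℕ} {F : Filling β} (h : Within n m F) :
    Within m n (transpose F) := fun c hc => (h c.swap hc).symm

/-- Reflection of a tableau reverses its reading word, up to Knuth equivalence. -/
theorem knuth_readWord_transpose {n m : ℕ} {F : Filling α} (h : STab F)
    (hw : Within n m F) : Knuth (readWord m n (transpose F)) (readWord n m F).reverse := by
  simpa using (knuth_readWord_transpose_reverse h hw).reverse.symm

end GenRS

namespace GenRS

/-! ### Jeu de taquin slides preserve the Knuth class of the reading word -/

section Basic
variable {α : Type}

/-- Moving the content of the box `t` into the box `h`. -/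
def moveBox (F : Filling α) (h t : ℕ × ℕ) : Filling α :=
  Function.update (Function.update F h (F t)) t none

theorem moveBox_target (F : Filling α) (h t : ℕ × ℕ) : moveBox F h t t = none := by
  simp [moveBox]

theorem moveBox_hole {F : Filling α} {h t : ℕ × ℕ} (hne : h ≠ t) : moveBox F h t h = F t := by
  simp [moveBox, hne]

theorem moveBox_of_ne {F : Filling α} {h t c : ℕ × ℕ} (hc : c ≠ h) (hc' : c ≠ t) :
    moveBox F h t c = F c := by
  simp [moveBox, hc, hc']

theorem moveBox_ne_none {F : Filling α} {h t c : ℕ × ℕ} (hne : h ≠ t) (ht : F t ≠ none) :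
    moveBox F h t c ≠ none ↔ c ≠ t ∧ (F c ≠ none ∨ c = h) := by
  rcases eq_or_ne c t with rfl | hct
  · simp [moveBox_target]
  · rcases eq_or_ne c h with rfl | hch
    · simp [moveBox_hole hne, ht, hne]
    · simp [moveBox_of_ne hch hct, hct, hch]

theorem rowWord_congr {F G : Filling α} {m i : ℕ} (h : ∀ j, F (i, j) = G (i, j)) :
    rowWord m F i = rowWord m G i := by
  simp [rowWord, h]

theorem flatMap_rowWord_congr {F G : Filling α} {m : ℕ} {l : List ℕ}
    (h : ∀ i ∈ l, ∀ j, F (i, j) = G (i, j)) :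
    l.flatMap (rowWord m F) = l.flatMap (rowWord m G) :=
  List.flatMap_congr fun i hi => rowWord_congr (h i hi)

theorem range_split {j m : ℕ} (h : j < m) :
    List.range m = List.range j ++ j :: List.range' (j + 1) (m - j - 1) := by
  rw [List.range_eq_range', List.range_eq_range']
  have h1 : m = j + ((m - j - 1) + 1) := by omega
  conv_lhs => rw [h1]
  rw [← List.range'_append_1, zero_add, List.range'_succ]

theorem readWord_split {i n m : ℕ} (h : i + 1 < n) (F : Filling α) :
    readWord n m F = (List.range' (i + 2) (n - (i + 1) - 1)).reverse.flatMap (rowWord m F) ++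
      (rowWord m F (i + 1) ++ rowWord m F i) ++ (List.range i).reverse.flatMap (rowWord m F) := by
  rw [readWord, range_split h, List.range_succ]
  simp

/-- The entry moves to the adjacent empty place of the same row and jumps over no other entry. -/
theorem readWord_moveBox_right {F : Filling α} {i j n m : ℕ} (hm : j + 1 < m)
    (hh : F (i, j) = none) : readWord n m (moveBox F (i, j) (i, j + 1)) = readWord n m F := by
  refine List.flatMap_congr fun k _ => ?_
  rcases eq_or_ne k i with rfl | hk
  · rw [rowWord, rowWord, range_split hm, List.range_succ]
    simp only [List.filterMap_append, List.filterMap_cons, List.filterMap_nil]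
    rw [moveBox_target, moveBox_hole (by simp), hh]
    have h1 : (List.range j).filterMap (fun l => moveBox F (k, j) (k, j + 1) (k, l)) =
        (List.range j).filterMap fun l => F (k, l) := by
      refine List.filterMap_congr fun l hl => moveBox_of_ne ?_ ?_ <;> simp at hl ⊢ <;> omega
    have h2 : (List.range' (j + 1 + 1) (m - (j + 1) - 1)).filterMap
        (fun l => moveBox F (k, j) (k, j + 1) (k, l)) =
        (List.range' (j + 1 + 1) (m - (j + 1) - 1)).filterMap fun l => F (k, l) := by
      refine List.filterMap_congr fun l hl => moveBox_of_ne ?_ ?_ <;>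
        simp [List.mem_range'_1] at hl ⊢ <;> omega
    rw [h1, h2]
    cases F (k, j + 1) <;> simp
  · exact rowWord_congr fun l => moveBox_of_ne (by simp [hk]) (by simp [hk])

end Basic

variable {α : Type} [LinearOrder α]

theorem knuth_readWord_of_rows {F G : Filling α} {i n m : ℕ} (hi : i + 1 < n)
    (h : ∀ k l, k ≠ i → k ≠ i + 1 → F (k, l) = G (k, l))
    (hK : Knuth (rowWord m F (i + 1) ++ rowWord m F i) (rowWord m G (i + 1) ++ rowWord m G i)) :
    Knuth (readWord n m F) (readWord n m G) := by
  rw [readWord_split hi F, readWord_split hi G,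
    flatMap_rowWord_congr (F := F) (G := G) (l := (List.range i).reverse),
    flatMap_rowWord_congr (F := F) (G := G) (l := (List.range' (i + 2) _).reverse)]
  · exact (hK.append_left _).append_right _
  · intro k hk l
    simp [List.mem_range'_1] at hk
    exact h k l (by omega) (by omega)
  · intro k hk l
    simp at hk
    exact h k l (by omega) (by omega)

theorem forall₂_filterMap {f g : ℕ → Option α} {l : List ℕ}
    (h : ∀ k ∈ l, ∃ a b, f k = some a ∧ g k = some b ∧ a < b) :
    List.Forall₂ (· < ·) (l.filterMap f) (l.filterMap g) := by
  induction l with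
  | nil => simp
  | cons k l ih =>
    obtain ⟨a, b, ha, hb, hab⟩ := h k (by simp)
    rw [List.filterMap_cons_some ha, List.filterMap_cons_some hb]
    exact .cons hab (ih fun k hk => h k (by simp [hk]))

theorem pairwise_filterMap_of_lt {f : ℕ → Option α}
    (h : ∀ k l a b, f k = some a → f l = some b → k < l → a < b) {l : List ℕ}
    (hl : l.Pairwise (· < ·)) : (l.filterMap f).Pairwise (· < ·) := by
  rw [List.pairwise_filterMap]
  exact hl.imp fun hlt a ha b hb => h _ _ a b ha hb hlt

/-- The effect on the reading word of an upward move in jeu de taquin: `f` and `g` are two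
consecutive rows, with a hole in column `j` of the upper row `f`. -/
theorem knuth_filterMap_move_up {f g : ℕ → Option α} {j m : ℕ} {b : α} (hj : j < m)
    (hfj : f j = none) (hgj : g j = some b) (hgm : ∀ k, m ≤ k → g k = none)
    (h1 : ∀ k l, f k ≠ none → k ≤ l → l < j → f l ≠ none)
    (h2 : ∀ k, f k ≠ none → k < j → g k ≠ none)
    (h3 : ∀ k l, g l ≠ none → j < k → k ≤ l → g k ≠ none)
    (h4 : ∀ k, g k ≠ none → j < k → f k ≠ none)
    (hg : ∀ k l a b, g k = some a → g l = some b → k < l → a < b)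
    (hf : ∀ k l a c, Function.update f j (some b) k = some a →
      Function.update f j (some b) l = some c → k < l → a < c)
    (hfg : ∀ k a c, f k = some a → g k = some c → a < c) :
    Knuth ((List.range m).filterMap g ++ (List.range m).filterMap f)
      ((List.range m).filterMap (Function.update g j none) ++
        (List.range m).filterMap (Function.update f j (some b))) := by
  classical
  -- Column `s` is where the upper row begins, with `s = j` if nothing stands to the left of the
  -- hole.
  have hP : ∃ s, s ≤ j ∧ ∀ k, s ≤ k → k < j → f k ≠ none := ⟨j, le_rfl, by omega⟩
  obtain ⟨s, hsj, hs, hs'⟩ : ∃ s ≤ j, (∀ k, s ≤ k → k < j → f k ≠ none) ∧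
      ∀ k < s, f k = none := by
    refine ⟨Nat.find hP, (Nat.find_spec hP).1, (Nat.find_spec hP).2, fun k hk => ?_⟩
    by_contra hk'
    exact Nat.find_min hP hk ⟨hk.le.trans (Nat.find_spec hP).1, fun l hl hl' => h1 k l hk' hl hl'⟩
  -- Column `e` is where the lower row ends. The columns other than `j` then split into `L0` (upper
  -- row empty), `L1` and `L2` (both rows occupied), and `L3` (lower row empty).
  have hQ : ∃ e, j < e ∧ ∀ k, e ≤ k → g k = none := ⟨m, hj, hgm⟩
  obtain ⟨e, hje, hem, he, he'⟩ : ∃ e, j < e ∧ e ≤ m ∧ (∀ k, e ≤ k → g k = none) ∧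
      ∀ k, j < k → k < e → g k ≠ none := by
    refine ⟨Nat.find hQ, (Nat.find_spec hQ).1, Nat.find_min' hQ ⟨hj, hgm⟩, (Nat.find_spec hQ).2,
      fun k hk hke => ?_⟩
    have := Nat.find_min hQ hke
    push Not at this
    obtain ⟨l, hl, hl'⟩ := this hk
    exact h3 k l hl' hk hl
  set L0 := List.range s with hL0
  set L1 := List.range' s (j - s) with hL1
  set L2 := List.range' (j + 1) (e - (j + 1)) with hL2
  set L3 := List.range' e (m - e) with hL3
  have hrange : List.range m = L0 ++ (L1 ++ j :: (L2 ++ L3)) := by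
    have e1 : List.range j = L0 ++ L1 := by
      rw [hL0, hL1, List.range_eq_range', List.range_eq_range']
      have : j = s + (j - s) := by omega
      conv_lhs => rw [this]
      rw [← List.range'_append_1, zero_add]
    have e2 : List.range' (j + 1) (m - j - 1) = L2 ++ L3 := by
      have h5 : m - j - 1 = (e - (j + 1)) + (m - e) := by omega
      have h6 : e = (j + 1) + (e - (j + 1)) := by omega
      rw [hL2, hL3, h5, ← List.range'_append_1]
      rw [← h6]
    rw [range_split hj, e1, e2, List.append_assoc]
  have m1 : ∀ k ∈ L1, s ≤ k ∧ k < j := by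
    intro k hk; simp only [hL1, List.mem_range'_1] at hk; omega
  have m2 : ∀ k ∈ L2, j < k ∧ k < e := by
    intro k hk; simp only [hL2, List.mem_range'_1] at hk; omega
  have m3 : ∀ k ∈ L3, e ≤ k := by
    intro k hk; simp only [hL3, List.mem_range'_1] at hk; omega
  have m0 : ∀ k ∈ L0, k < s := by
    intro k hk; simpa [hL0] using hk
  have hsorted : (L0 ++ (L1 ++ j :: (L2 ++ L3))).Pairwise (· < ·) := by
    rw [← hrange]; exact List.pairwise_lt_range
  have upd : ∀ (f : ℕ → Option α) (v : Option α) (L : List ℕ), j ∉ L →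
      L.filterMap (Function.update f j v) = L.filterMap f := by
    intro f v L hL
    refine List.filterMap_congr fun k hk => Function.update_of_ne ?_ _ _
    rintro rfl; exact hL hk
  have n0 : j ∉ L0 := fun h => by have := m0 j h; omega
  have n1 : j ∉ L1 := fun h => by have := m1 j h; omega
  have n2 : j ∉ L2 := fun h => by have := m2 j h; omega
  have n3 : j ∉ L3 := fun h => by have := m3 j h; omega
  have f0 : L0.filterMap f = [] := by
    rw [List.filterMap_eq_nil_iff]; exact fun k hk => hs' k (m0 k hk)
  have g3 : L3.filterMap g = [] := by
    rw [List.filterMap_eq_nil_iff]; exact fun k hk => he k (m3 k hk)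
  have hB1 : List.Forall₂ (· < ·) (L1.filterMap f) (L1.filterMap g) := by
    refine forall₂_filterMap fun k hk => ?_
    have hfk := hs k (m1 k hk).1 (m1 k hk).2
    obtain ⟨a, ha⟩ := Option.ne_none_iff_exists'.1 hfk
    obtain ⟨c, hc⟩ := Option.ne_none_iff_exists'.1 (h2 k hfk (m1 k hk).2)
    exact ⟨a, c, ha, hc, hfg k a c ha hc⟩
  have hB2 : List.Forall₂ (· < ·) (L2.filterMap f) (L2.filterMap g) := by
    refine forall₂_filterMap fun k hk => ?_
    have hgk := he' k (m2 k hk).1 (m2 k hk).2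
    obtain ⟨c, hc⟩ := Option.ne_none_iff_exists'.1 hgk
    obtain ⟨a, ha⟩ := Option.ne_none_iff_exists'.1 (h4 k hgk (m2 k hk).1)
    exact ⟨a, c, ha, hc, hfg k a c ha hc⟩
  have sg : (L1.filterMap g ++ b :: L2.filterMap g).Pairwise (· < ·) := by
    have := pairwise_filterMap_of_lt hg (l := L1 ++ j :: L2) (hsorted.sublist (by simp))
    simpa [hgj] using this
  have sf : (L1.filterMap f ++ b :: L2.filterMap f).Pairwise (· < ·) := by
    have := pairwise_filterMap_of_lt hf (l := L1 ++ j :: L2) (hsorted.sublist (by simp))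
    simpa [upd f _ _ n1, upd f _ _ n2] using this
  rw [hrange]
  simp only [List.filterMap_append, List.filterMap_cons, hfj, hgj, Function.update_self,
    upd _ _ _ n0, upd _ _ _ n1, upd _ _ _ n2, upd _ _ _ n3, f0, g3, List.append_nil,
    List.nil_append]
  -- First the left segment of the upper row is inserted and bumps the left segment of the lower
  -- row, so that it comes to stand before `b`. Then the right segment of the upper row bumps that
  -- of the lower row, which leaves `b` in the upper word.
  have k1 := Knuth.bump_segment (A := []) (B := b :: L2.filterMap g) hB1
    (sf.sublist (by simp)) sg
  have k2 := Knuth.bump_segment (A := L1.filterMap f ++ [b]) (B := []) hB2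
    (by simpa using sf) (by simpa using sg.sublist (by simp))
  have k3 := ((k1.append_right (L2.filterMap f)).trans
    (by simpa using k2.append_left (L1.filterMap g))).append_left (L0.filterMap g)
  simpa using k3.append_right (L3.filterMap f)

/-- A skew tableau with inner shape `D`. -/
structure Skew (D : Set (ℕ × ℕ)) (n m : ℕ) (F : Filling α) : Prop where
  inner_lower : IsLowerSet D
  inner_empty : ∀ c ∈ D, F c = none
  lower : IsLowerSet {c | F c ≠ none ∨ c ∈ D}
  increasing : Increasing F
  injective : ∀ c c' a, F c = some a → F c' = some a → c = c'
  within : Within n m F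

/-- A skew tableau with inner shape `D` and a distinguished hole `h`. -/
structure Punctured (D : Set (ℕ × ℕ)) (n m : ℕ) (F : Filling α) (h : ℕ × ℕ) : Prop where
  inner_lower : IsLowerSet D
  inner_empty : ∀ c ∈ D, F c = none
  hole_empty : F h = none
  hole_notMem : h ∉ D
  hole_lt : h.1 < n ∧ h.2 < m
  lower : IsLowerSet {c | F c ≠ none ∨ c ∈ D ∨ c = h}
  increasing : Increasing F
  injective : ∀ c c' a, F c = some a → F c' = some a → c = c'
  within : Within n m F

/-! ### Moves of a hole in a skew tableau -/

namespace Punctured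
variable {D : Set (ℕ × ℕ)} {n m : ℕ} {F : Filling α} {h : ℕ × ℕ}

/-- A box north-west of an occupied box or of the hole is occupied, inner, or the hole. Either
alternative of `hlt` rules out the last two. -/
theorem ne_none_of_between (H : Punctured D n m F h) {c c' : ℕ × ℕ} (hc : F c' ≠ none ∨ c' = h)
    (hle : c ≤ c') (hlt : h < c ∨ ∃ d, F d ≠ none ∧ d ≤ c ∧ ¬ h ≤ c) : F c ≠ none := by
  have h1 : F c ≠ none ∨ c ∈ D ∨ c = h := H.lower hle (by tauto)
  rcases h1 with h1 | h1 | rfl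
  · exact h1
  · rcases hlt with hlt | ⟨d, hd, hdc, -⟩
    · exact absurd (H.inner_lower hlt.le h1) H.hole_notMem
    · exact absurd (H.inner_empty d (H.inner_lower hdc h1)) hd
  · rcases hlt with hlt | ⟨d, -, -, hd⟩
    · exact absurd hlt (lt_irrefl _)
    · exact absurd le_rfl hd

/-- The hypothesis `hmin` is what the choice of the smaller neighbour provides: the letter entering
the hole is smaller than all other letters south-east of the hole, so the filling stays increasing.
-/
theorem moveBox (H : Punctured D n m F h) {t : ℕ × ℕ} {a : α} (hlt : h < t) (ht : F t = some a)
    (hmin : ∀ c b, F c = some b → h < c → c ≠ t → a < b) :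
    Punctured D n m (moveBox F h t) t := by
  have ht' : F t ≠ none := by simp [ht]
  have htD : t ∉ D := fun h => ht' (H.inner_empty t h)
  refine ⟨H.inner_lower, ?_, moveBox_target F h t, htD, H.within t ht', ?_, ?_, ?_, ?_⟩
  · intro c hc
    rw [moveBox_of_ne, H.inner_empty c hc]
    · rintro rfl; exact H.hole_notMem hc
    · rintro rfl; exact htD hc
  · convert H.lower using 1
    ext c
    simp only [Set.mem_ofPred_eq, moveBox_ne_none hlt.ne ht']
    rcases eq_or_ne c t with rfl | hct
    · simp [ht']
    · simp [hct]; tauto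
  · intro c c' x y hx hy hcc
    have hct : c ≠ t := by rintro rfl; simp [moveBox_target] at hx
    have hct' : c' ≠ t := by rintro rfl; simp [moveBox_target] at hy
    rcases eq_or_ne c h with rfl | hch
    · rw [moveBox_hole hlt.ne, ht] at hx
      obtain rfl := Option.some.inj hx
      rw [moveBox_of_ne hcc.ne' hct'] at hy
      exact hmin c' y hy hcc hct'
    · rw [moveBox_of_ne hch hct] at hx
      rcases eq_or_ne c' h with rfl | hch'
      · rw [moveBox_hole hlt.ne] at hy
        exact H.increasing c t x y hx hy (hcc.trans hlt)
      · rw [moveBox_of_ne hch' hct'] at hy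
        exact H.increasing c c' x y hx hy hcc
  · have key : ∀ c x, GenRS.moveBox F h t c = some x → c ≠ t ∧
        F (if c = h then t else c) = some x := by
      intro c x hx
      have hct : c ≠ t := by rintro rfl; simp [moveBox_target] at hx
      rcases eq_or_ne c h with rfl | hch
      · simpa [moveBox_hole hlt.ne, hct] using hx
      · simpa [moveBox_of_ne hch hct, hch, hct] using hx
    intro c c' x hx hy
    obtain ⟨h1, h2⟩ := key c x hx
    obtain ⟨h3, h4⟩ := key c' x hy
    have := H.injective _ _ x h2 h4
    split_ifs at this with h5 h6 h6
    · rw [h5, h6]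
    · exact absurd this.symm h3
    · exact absurd this h1
    · exact this
  · intro c hc
    rcases ((moveBox_ne_none hlt.ne ht').1 hc).2 with hc | rfl
    · exact H.within c hc
    · exact H.hole_lt

/-- An entry south-east of the hole either lies weakly beyond the lower neighbour, which is then
present and larger than `a`, or lies in the row of the hole, beyond `a`. -/
theorem moveBox_right (H : Punctured D n m F h) {a : α} (ha : F (h.1, h.2 + 1) = some a)
    (hb : ∀ b, F (h.1 + 1, h.2) = some b → a < b) :
    Punctured D n m (GenRS.moveBox F h (h.1, h.2 + 1)) (h.1, h.2 + 1) := by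
  have hlt : h < (h.1, h.2 + 1) := Prod.lt_iff.2 (Or.inr ⟨le_rfl, Nat.lt_succ_self _⟩)
  refine H.moveBox hlt ha fun c b hc hhc hct => ?_
  rcases Nat.lt_or_ge h.1 c.1 with h1 | h1
  · have hle : (h.1 + 1, h.2) ≤ c := ⟨h1, hhc.le.2⟩
    have hlt' : h < (h.1 + 1, h.2) := Prod.lt_iff.2 (Or.inl ⟨Nat.lt_succ_self _, le_rfl⟩)
    obtain ⟨d, hd⟩ := Option.ne_none_iff_exists'.1
      (H.ne_none_of_between (Or.inl (by simp [hc])) hle (Or.inl hlt'))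
    rcases hle.eq_or_lt with rfl | hl
    · exact hb b hc
    · exact (hb d hd).trans (H.increasing _ _ d b hd hc hl)
  · have h2 : h.2 < c.2 := by
      rcases Prod.lt_iff.1 hhc with h | h
      · omega
      · exact h.2
    exact H.increasing _ c a b ha hc (lt_of_le_of_ne ⟨hhc.le.1, h2⟩ hct.symm)

theorem moveBox_up (H : Punctured D n m F h) {b : α} (hb : F (h.1 + 1, h.2) = some b)
    (ha : ∀ a, F (h.1, h.2 + 1) = some a → b < a) :
    Punctured D n m (GenRS.moveBox F h (h.1 + 1, h.2)) (h.1 + 1, h.2) := by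
  have hlt : h < (h.1 + 1, h.2) := Prod.lt_iff.2 (Or.inl ⟨Nat.lt_succ_self _, le_rfl⟩)
  refine H.moveBox hlt hb fun c a hc hhc hct => ?_
  rcases Nat.lt_or_ge h.2 c.2 with h1 | h1
  · have hle : (h.1, h.2 + 1) ≤ c := ⟨hhc.le.1, h1⟩
    have hlt' : h < (h.1, h.2 + 1) := Prod.lt_iff.2 (Or.inr ⟨le_rfl, Nat.lt_succ_self _⟩)
    obtain ⟨d, hd⟩ := Option.ne_none_iff_exists'.1
      (H.ne_none_of_between (Or.inl (by simp [hc])) hle (Or.inl hlt'))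
    rcases hle.eq_or_lt with rfl | hl
    · exact ha a hc
    · exact (ha d hd).trans (H.increasing _ _ d a hd hc hl)
  · have h2 : h.1 < c.1 := by
      rcases Prod.lt_iff.1 hhc with h | h
      · exact h.1
      · omega
    exact H.increasing _ c b a hb hc (lt_of_le_of_ne ⟨h2, hhc.le.2⟩ hct.symm)

theorem knuth_moveBox_up (H : Punctured D n m F h) {b : α} (hb : F (h.1 + 1, h.2) = some b)
    (ha : ∀ a, F (h.1, h.2 + 1) = some a → b < a) :
    Knuth (readWord n m F) (readWord n m (GenRS.moveBox F h (h.1 + 1, h.2))) := by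
  have H' := H.moveBox_up hb ha
  obtain ⟨i, j⟩ := h
  simp only at hb ha H' ⊢
  have hlt := H.within (i + 1, j) (by simp [hb])
  refine knuth_readWord_of_rows hlt.1 (fun k l hk hk' => ?_) ?_
  · exact (moveBox_of_ne (by simp [hk]) (by simp [hk'])).symm
  have e1 : (fun l => GenRS.moveBox F (i, j) (i + 1, j) (i + 1, l)) =
      Function.update (fun l => F (i + 1, l)) j none := by
    funext l
    rcases eq_or_ne l j with rfl | hl
    · simp [moveBox_target]
    · rw [moveBox_of_ne (by simp) (by simp [hl]), Function.update_of_ne hl]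
  have e2 : (fun l => GenRS.moveBox F (i, j) (i + 1, j) (i, l)) =
      Function.update (fun l => F (i, l)) j (some b) := by
    funext l
    rcases eq_or_ne l j with rfl | hl
    · simp [moveBox_hole, hb]
    · rw [moveBox_of_ne (by simp [hl]) (by simp), Function.update_of_ne hl]
  simp only [rowWord, e1, e2]
  refine knuth_filterMap_move_up hlt.2 H.hole_empty hb ?_ ?_ ?_ ?_ ?_ ?_ ?_ ?_
  · intro k hk
    by_contra hne
    have := (H.within _ hne).2
    simp only at this; omega
  · intro k l hk hkl hlj
    refine H.ne_none_of_between (c' := (i, j)) (Or.inr rfl) ⟨le_rfl, hlj.le⟩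
      (Or.inr ⟨(i, k), hk, ⟨le_rfl, hkl⟩, fun hle => ?_⟩)
    have : j ≤ l := hle.2
    omega
  · intro k hk hkj
    refine H.ne_none_of_between (c' := (i + 1, j)) (Or.inl (by simp [hb])) ⟨le_rfl, hkj.le⟩
      (Or.inr ⟨(i, k), hk, ⟨Nat.le_succ i, le_rfl⟩, fun hle => ?_⟩)
    have : j ≤ k := hle.2
    omega
  · intro k l hl hjk hkl
    refine H.ne_none_of_between (Or.inl hl) ⟨le_rfl, hkl⟩ (Or.inl ?_)
    exact Prod.lt_iff.2 (Or.inl ⟨Nat.lt_succ_self _, hjk.le⟩)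
  · intro k hk hjk
    refine H.ne_none_of_between (Or.inl hk) ⟨Nat.le_succ i, le_rfl⟩ (Or.inl ?_)
    exact Prod.lt_iff.2 (Or.inr ⟨le_rfl, hjk⟩)
  · intro k l a c hk hl hkl
    exact H.increasing _ _ a c hk hl (Prod.mk_lt_mk_iff_right.2 hkl)
  · intro k l a c hk hl hkl
    -- The upper row with `b` in the hole is a row of the filling after the move, already known to
    -- be increasing.
    rw [← e2] at hk hl
    exact H'.increasing _ _ a c hk hl (Prod.mk_lt_mk_iff_right.2 hkl)
  · intro k a c hk hl
    exact H.increasing _ _ a c hk hl (Prod.mk_lt_mk_iff_left.2 (Nat.lt_succ_self i))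

theorem slideStep (H : Punctured D n m F h) :
    (F (h.1, h.2 + 1) = none ∧ F (h.1 + 1, h.2) = none ∧ slideStep (F, h) = (F, h)) ∨
    ∃ t, h < t ∧ F t ≠ none ∧ slideStep (F, h) = (GenRS.moveBox F h t, t) ∧
      Punctured D n m (GenRS.moveBox F h t) t ∧
      Knuth (readWord n m F) (readWord n m (GenRS.moveBox F h t)) := by
  have hr : h < (h.1, h.2 + 1) := Prod.lt_iff.2 (Or.inr ⟨le_rfl, Nat.lt_succ_self _⟩)
  have hd : h < (h.1 + 1, h.2) := Prod.lt_iff.2 (Or.inl ⟨Nat.lt_succ_self _, le_rfl⟩)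
  have right : ∀ a, F (h.1, h.2 + 1) = some a → (∀ b, F (h.1 + 1, h.2) = some b → a < b) →
      GenRS.slideStep (F, h) = (GenRS.moveBox F h (h.1, h.2 + 1), (h.1, h.2 + 1)) →
      ∃ t, h < t ∧ F t ≠ none ∧ GenRS.slideStep (F, h) = (GenRS.moveBox F h t, t) ∧
      Punctured D n m (GenRS.moveBox F h t) t ∧
      Knuth (readWord n m F) (readWord n m (GenRS.moveBox F h t)) := by
    intro a ha hb he
    have ha' : F (h.1, h.2 + 1) ≠ none := by simp [ha]
    refine ⟨_, hr, ha', he, H.moveBox_right ha hb, ?_⟩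
    rw [readWord_moveBox_right (H.within _ ha').2 H.hole_empty]
    exact .refl _
  have up : ∀ b, F (h.1 + 1, h.2) = some b → (∀ a, F (h.1, h.2 + 1) = some a → b < a) →
      GenRS.slideStep (F, h) = (GenRS.moveBox F h (h.1 + 1, h.2), (h.1 + 1, h.2)) →
      ∃ t, h < t ∧ F t ≠ none ∧ GenRS.slideStep (F, h) = (GenRS.moveBox F h t, t) ∧
      Punctured D n m (GenRS.moveBox F h t) t ∧
      Knuth (readWord n m F) (readWord n m (GenRS.moveBox F h t)) := by
    intro b hb ha he
    exact ⟨_, hd, by simp [hb], he, H.moveBox_up hb ha, H.knuth_moveBox_up hb ha⟩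
  rcases ha : F (h.1, h.2 + 1) with _ | a <;> rcases hb : F (h.1 + 1, h.2) with _ | b
  · left; simp [GenRS.slideStep, ha, hb]
  · right
    refine up b hb (by simp [ha]) ?_
    simp [GenRS.slideStep, ha, hb, GenRS.moveBox]
  · right
    refine right a ha (by simp [hb]) ?_
    simp [GenRS.slideStep, ha, hb, GenRS.moveBox]
  · right
    by_cases hab : a < b
    · refine right a ha (by simpa [hb] using hab) ?_
      simp [GenRS.slideStep, ha, hb, GenRS.moveBox, hab]
    · refine up b hb ?_ ?_
      · intro a' ha'
        rw [ha] at ha'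
        obtain rfl := Option.some.inj ha'
        refine lt_of_le_of_ne (not_lt.1 hab) ?_
        -- Equal neighbours cannot occur, because entries are distinct.
        rintro rfl
        simpa using H.injective _ _ b hb ha
      · simp [GenRS.slideStep, ha, hb, GenRS.moveBox, hab]

/-- Each move takes the hole to an occupied box south-east of it, so the number of entries strictly
south-east of the hole decreases. Once the hole is stuck, further iterations change nothing. -/
theorem iterate_slideStep (H : Punctured D n m F h) {k : ℕ}
    (hk : {c | F c ≠ none ∧ h < c}.ncard ≤ k) :
    ∃ G t, GenRS.slideStep^[k] (F, h) = (G, t) ∧ Punctured D n m G t ∧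
      Knuth (readWord n m F) (readWord n m G) ∧
      G (t.1, t.2 + 1) = none ∧ G (t.1 + 1, t.2) = none := by
  have fin : ∀ {F : Filling α} {h}, Punctured D n m F h → {c | F c ≠ none ∧ h < c}.Finite :=
    fun H => H.within.finite.subset fun c hc => hc.1
  induction k generalizing F h with
  | zero =>
    have h0 := (Set.ncard_eq_zero (fin H)).1 (Nat.le_zero.1 hk)
    refine ⟨F, h, rfl, H, .refl _, ?_, ?_⟩
    · by_contra hc
      have : (h.1, h.2 + 1) ∈ {c | F c ≠ none ∧ h < c} :=
        ⟨hc, Prod.lt_iff.2 (Or.inr ⟨le_rfl, Nat.lt_succ_self _⟩)⟩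
      simp [h0] at this
    · by_contra hc
      have : (h.1 + 1, h.2) ∈ {c | F c ≠ none ∧ h < c} :=
        ⟨hc, Prod.lt_iff.2 (Or.inl ⟨Nat.lt_succ_self _, le_rfl⟩)⟩
      simp [h0] at this
  | succ k ih =>
    rcases H.slideStep with ⟨h1, h2, h3⟩ | ⟨t, hlt, ht, h3, H', hK⟩
    · refine ⟨F, h, ?_, H, .refl _, h1, h2⟩
      exact Function.iterate_fixed h3 _
    · have hsub : {c | GenRS.moveBox F h t c ≠ none ∧ t < c}.ncard <
          {c | F c ≠ none ∧ h < c}.ncard := by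
        refine Set.ncard_lt_ncard ⟨?_, fun hsup => ?_⟩ (fin H)
        · rintro c ⟨hc, htc⟩
          refine ⟨?_, hlt.trans htc⟩
          rcases ((moveBox_ne_none hlt.ne ht).1 hc).2 with hc | rfl
          · exact hc
          · exact absurd htc hlt.not_gt
        · exact lt_irrefl t (hsup ⟨ht, hlt⟩).2
      obtain ⟨G, t', h4, h5, h6, h7⟩ := ih H' (by omega)
      refine ⟨G, t', ?_, h5, hK.trans h6, h7⟩
      rw [Function.iterate_succ_apply, h3, h4]

/-- A hole without right and lower neighbours lies on the outer rim and can be forgotten. -/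
theorem skew_of_terminal (H : Punctured D n m F h) (hr : F (h.1, h.2 + 1) = none)
    (hd : F (h.1 + 1, h.2) = none) : Skew D n m F := by
  refine ⟨H.inner_lower, H.inner_empty, ?_, H.increasing, H.injective, H.within⟩
  intro c' c hle hc'
  rcases H.lower hle (show F c' ≠ none ∨ c' ∈ D ∨ c' = h by
    rcases hc' with h | h
    · exact Or.inl h
    · exact Or.inr (Or.inl h)) with h1 | h1 | rfl
  · exact Or.inl h1
  · exact Or.inr h1
  · rcases hc' with hc' | hc'
    · have hlt : c < c' := lt_of_le_of_ne hle (by rintro rfl; exact hc' H.hole_empty)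
      rcases Prod.lt_iff.1 hlt with h1 | h1
      · refine absurd hd (H.ne_none_of_between (Or.inl hc') ⟨h1.1, h1.2⟩ (Or.inl ?_))
        exact Prod.lt_iff.2 (Or.inl ⟨Nat.lt_succ_self _, le_rfl⟩)
      · refine absurd hr (H.ne_none_of_between (Or.inl hc') ⟨h1.1, h1.2⟩ (Or.inl ?_))
        exact Prod.lt_iff.2 (Or.inr ⟨le_rfl, Nat.lt_succ_self _⟩)
    · exact absurd (H.inner_lower hle hc') H.hole_notMem

end Punctured

theorem Skew.slide {D : Set (ℕ × ℕ)} {n m : ℕ} {F : Filling α} {c : ℕ × ℕ}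
    (H : Skew (insert c D) n m F) (hD : IsLowerSet D) (hc : c ∉ D) (hlt : c.1 < n ∧ c.2 < m) :
    Skew D n m (slide F c) ∧ Knuth (readWord n m F) (readWord n m (slide F c)) := by
  have HP : Punctured D n m F c := by
    refine ⟨hD, fun d hd => H.inner_empty d (Or.inr hd), H.inner_empty c (Or.inl rfl), hc, hlt, ?_,
      H.increasing, H.injective, H.within⟩
    convert H.lower using 1
    ext d
    simp only [Set.mem_ofPred_eq, Set.mem_insert_iff]
    tauto
  obtain ⟨G, t, h1, h2, h3, h4, h5⟩ := HP.iterate_slideStep (k := (shape F).ncard)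
    (Set.ncard_le_ncard (fun d hd => hd.1) H.within.finite)
  rw [GenRS.slide, h1]
  exact ⟨h2.skew_of_terminal h4 h5, h3⟩

/-- The order condition says that no box is north-west of a later one, so the boxes still to be used
always form a lower set and each slide starts at an inner corner. -/
theorem Skew.foldl_slide {n m : ℕ} {F : Filling α} {l : List (ℕ × ℕ)}
    (hl : l.Pairwise fun c d => ¬ c ≤ d) (hw : ∀ c ∈ l, c.1 < n ∧ c.2 < m)
    (H : Skew {c | c ∈ l} n m F) :
    Skew ∅ n m (l.foldl GenRS.slide F) ∧
      Knuth (readWord n m F) (readWord n m (l.foldl GenRS.slide F)) := by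
  induction l generalizing F with
  | nil =>
    have h0 : {c : ℕ × ℕ | c ∈ []} = ∅ := by ext c; simp
    exact ⟨h0 ▸ H, .refl _⟩
  | cons c l ih =>
    rw [List.pairwise_cons] at hl
    have hset : {d | d ∈ c :: l} = insert c {d | d ∈ l} := by ext d; simp
    have hlow : IsLowerSet {d | d ∈ l} := by
      intro d d' hle hd
      have := H.inner_lower hle (show d ∈ {d | d ∈ c :: l} from List.mem_cons_of_mem c hd)
      rcases List.mem_cons.1 this with rfl | h
      · exact absurd hle (hl.1 d hd)
      · exact h
    have hc : c ∉ {d | d ∈ l} := fun h => hl.1 c h le_rfl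
    rw [hset] at H
    obtain ⟨h1, h2⟩ := H.slide hlow hc (hw c (by simp))
    obtain ⟨h3, h4⟩ := ih hl.2 (fun d hd => hw d (by simp [hd])) h1
    exact ⟨h3, h2.trans h4⟩

/-! ### The product of tableaux -/

theorem mem_rectangle {a b : ℕ} {c : ℕ × ℕ} : c ∈ rectangle a b ↔ c.1 < a ∧ c.2 < b := by
  obtain ⟨i, j⟩ := c
  simp [rectangle]

theorem pairwise_rectangle (a b : ℕ) : (rectangle a b).Pairwise fun c d => ¬ c ≤ d := by
  rw [rectangle, List.pairwise_flatMap]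
  constructor
  · intro i _
    rw [List.pairwise_map, List.pairwise_reverse]
    refine List.pairwise_lt_range.imp fun hlt hle => ?_
    have := hle.2
    simp only at this; omega
  · rw [List.pairwise_reverse]
    refine List.pairwise_lt_range.imp fun hlt c hc d hd hle => ?_
    obtain ⟨j, -, rfl⟩ := List.mem_map.1 hc
    obtain ⟨j', -, rfl⟩ := List.mem_map.1 hd
    have := hle.1
    simp only at this; omega

theorem lt_ncard_of_isLowerSet {s : Set ℕ} (hs : IsLowerSet s) (hf : s.Finite) {i : ℕ}
    (hi : i ∈ s) : i < s.ncard := by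
  have h1 : Set.Iic i ⊆ s := fun j hj => hs hj hi
  have h2 := Set.ncard_le_ncard h1 hf
  rw [← Finset.coe_Iic, Set.ncard_coe_finset, Nat.card_Iic] at h2
  omega

theorem STab.within {F : Filling α} (h : STab F) : Within (numRows F) (numCols F) F := by
  intro c hc
  constructor
  · refine lt_ncard_of_isLowerSet (s := {i | F (i, 0) ≠ none}) ?_ ?_ ?_
    · exact fun i j hle hi => h.lower (show (j, 0) ≤ (i, 0) from ⟨hle, le_rfl⟩) hi
    · exact h.finite.preimage (f := fun i : ℕ => (i, 0)) (by intro i _ j _ h; simpa using h)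
    · exact h.lower (show (c.1, 0) ≤ c from ⟨le_rfl, Nat.zero_le _⟩) hc
  · refine lt_ncard_of_isLowerSet (s := {j | F (0, j) ≠ none}) ?_ ?_ ?_
    · exact fun i j hle hi => h.lower (show (0, j) ≤ (0, i) from ⟨le_rfl, hle⟩) hi
    · exact h.finite.preimage (f := fun i : ℕ => (0, i)) (by intro i _ j _ h; simpa using h)
    · exact h.lower (show (0, c.2) ≤ c from ⟨Nat.zero_le _, le_rfl⟩) hc

theorem readWord_congr_size {F : Filling α} (h : STab F) {n m n' m' : ℕ} (hw : Within n m F)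
    (hw' : Within n' m' F) : readWord n m F = readWord n' m' F := by
  obtain ⟨T, hT, -, rfl⟩ := h.exists_tab
  rw [hT.readWord_ofRows hw, hT.readWord_ofRows hw']

/-- Rows are read from the bottom, and `T` lies below `S`. -/
theorem readWord_adjoin {β : Type} (T S : Filling β) (n m : ℕ) :
    readWord (numRows S + n) (numCols T + m) (adjoin T S) =
      readWord n (numCols T + m) T ++ readWord (numRows S) m S := by
  rw [readWord, List.range_add, List.reverse_append, List.flatMap_append]
  congr 1
  · rw [← List.map_reverse, List.flatMap_map]
    refine List.flatMap_congr fun i _ => ?_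
    simp [rowWord, adjoin]
  · refine List.flatMap_congr fun i hi => ?_
    have hi : i < numRows S := by simpa using hi
    rw [rowWord, List.range_add, List.filterMap_append, List.filterMap_map]
    have h1 : (List.range (numCols T)).filterMap (fun j => adjoin T S (i, j)) = [] := by
      rw [List.filterMap_eq_nil_iff]
      intro j hj
      simp [adjoin, hi, List.mem_range.1 hj]
    rw [h1, List.nil_append]
    refine List.filterMap_congr fun j _ => ?_
    simp [adjoin, hi]

theorem skew_adjoin {T S : Filling α} (hT : STab T) (hS : STab S)
    (hd : ∀ c c' a, T c = some a → S c' ≠ some a) {n m : ℕ} (hTn : Within n (numCols T + m) T)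
    (hSm : Within (numRows S) m S) :
    Skew {c | c ∈ rectangle (numRows S) (numCols T)} (numRows S + n) (numCols T + m)
      (adjoin T S) := by
  have hTw := hT.within
  -- Occupied boxes lie in the top right or in the bottom left block. Boxes of different blocks are
  -- incomparable, so the order conditions can be checked block by block.
  have cases : ∀ c, adjoin T S c ≠ none →
      (c.1 < numRows S ∧ numCols T ≤ c.2 ∧ adjoin T S c = S (c.1, c.2 - numCols T)) ∨
      (numRows S ≤ c.1 ∧ c.2 < numCols T ∧ adjoin T S c = T (c.1 - numRows S, c.2)) := by
    intro c hc
    by_cases h1 : c.1 < numRows S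
    · left
      by_cases h2 : c.2 < numCols T
      · simp [adjoin, h1, h2] at hc
      · exact ⟨h1, not_lt.1 h2, by simp [adjoin, h1, h2]⟩
    · right
      have h2 : adjoin T S c = T (c.1 - numRows S, c.2) := by simp [adjoin, h1]
      rw [h2] at hc
      exact ⟨not_lt.1 h1, (hTw _ hc).2, h2⟩
  refine ⟨?_, ?_, ?_, ?_, ?_, ?_⟩
  · intro c d hle hc
    have := mem_rectangle.1 hc
    exact mem_rectangle.2 ⟨lt_of_le_of_lt hle.1 this.1, lt_of_le_of_lt hle.2 this.2⟩
  · intro c hc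
    have := mem_rectangle.1 hc
    simp [adjoin, this.1, this.2]
  · intro c d hle hc
    have hle1 : d.1 ≤ c.1 := hle.1
    have hle2 : d.2 ≤ c.2 := hle.2
    simp only [Set.mem_ofPred_eq, mem_rectangle] at hc ⊢
    rcases hc with hc | hc
    · rcases cases c hc with ⟨h1, h2, h3⟩ | ⟨h1, h2, h3⟩
      · by_cases h4 : d.2 < numCols T
        · right; omega
        · left
          have h5 : d.1 < numRows S := by omega
          rw [h3] at hc
          have h6 := hS.lower (show (d.1, d.2 - numCols T) ≤ (c.1, c.2 - numCols T) from
            ⟨hle1, Nat.sub_le_sub_right hle2 _⟩) hc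
          simpa [adjoin, h5, h4, shape] using h6
      · by_cases h4 : d.1 < numRows S
        · right; omega
        · left
          rw [h3] at hc
          have h6 := hT.lower (show (d.1 - numRows S, d.2) ≤ (c.1 - numRows S, c.2) from
            ⟨Nat.sub_le_sub_right hle1 _, hle2⟩) hc
          simpa [adjoin, h4, shape] using h6
    · right; omega
  · intro c d a b ha hb hlt
    have hle1 : c.1 ≤ d.1 := hlt.le.1
    have hle2 : c.2 ≤ d.2 := hlt.le.2
    have hne : c.1 ≠ d.1 ∨ c.2 ≠ d.2 := by
      by_contra h; push Not at h; exact hlt.ne (Prod.ext h.1 h.2)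
    rcases cases c (by simp [ha]) with ⟨h1, h2, h3⟩ | ⟨h1, h2, h3⟩ <;>
      rcases cases d (by simp [hb]) with ⟨h4, h5, h6⟩ | ⟨h4, h5, h6⟩
    · refine hS.increasing _ _ a b (h3.symm.trans ha) (h6.symm.trans hb)
        (lt_of_le_of_ne ⟨hle1, Nat.sub_le_sub_right hle2 _⟩ ?_)
      simp only [ne_eq, Prod.mk.injEq]; omega
    · omega
    · omega
    · refine hT.increasing _ _ a b (h3.symm.trans ha) (h6.symm.trans hb)
        (lt_of_le_of_ne ⟨Nat.sub_le_sub_right hle1 _, hle2⟩ ?_)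
      simp only [ne_eq, Prod.mk.injEq]; omega
  · intro c d a ha hb
    rcases cases c (by simp [ha]) with ⟨h1, h2, h3⟩ | ⟨h1, h2, h3⟩ <;>
      rcases cases d (by simp [hb]) with ⟨h4, h5, h6⟩ | ⟨h4, h5, h6⟩
    · have := hS.injective _ _ a (h3.symm.trans ha) (h6.symm.trans hb)
      simp only [Prod.mk.injEq] at this
      exact Prod.ext (by omega) (by omega)
    · exact absurd (h3.symm.trans ha) (hd _ _ a (h6.symm.trans hb))
    · exact absurd (h6.symm.trans hb) (hd _ _ a (h3.symm.trans ha))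
    · have := hT.injective _ _ a (h3.symm.trans ha) (h6.symm.trans hb)
      simp only [Prod.mk.injEq] at this
      exact Prod.ext (by omega) (by omega)
  · intro c hc
    rcases cases c hc with ⟨h1, h2, h3⟩ | ⟨h1, h2, h3⟩
    · rw [h3] at hc
      have := (hSm _ hc).2
      simp only at this
      omega
    · rw [h3] at hc
      have := (hTn _ hc).1
      simp only at this
      omega

/-- The product of two tableaux is a tableau whose reading word is Knuth equivalent to the
concatenation of the two reading words. -/
theorem product_spec {T S : Filling α} (hT : STab T) (hS : STab S)
    (hd : ∀ c c' a, T c = some a → S c' ≠ some a) {n m n' m' N M : ℕ} (hTw : Within n m T)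
    (hSw : Within n' m' S) :
    STab (product T S) ∧ (Within N M (product T S) →
      Knuth (readWord N M (product T S)) (readWord n m T ++ readWord n' m' S)) := by
  have hTw' : Within n (numCols T + m') T := fun c hc =>
    ⟨(hTw c hc).1, (hT.within c hc).2.trans_le (Nat.le_add_right _ _)⟩
  have hSw' : Within (numRows S) m' S := fun c hc => ⟨(hS.within c hc).1, (hSw c hc).2⟩
  obtain ⟨h1, h2⟩ := Skew.foldl_slide (n := numRows S + n) (m := numCols T + m')
    (pairwise_rectangle (numRows S) (numCols T)) (fun c hc => by
      have := mem_rectangle.1 hc; omega) (skew_adjoin hT hS hd hTw' hSw')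
  have h3 : STab (product T S) := by
    refine ⟨h1.within.finite, ?_, h1.increasing, h1.injective⟩
    convert h1.lower using 1
    ext c; simp [shape, product]
  refine ⟨h3, fun hw => ?_⟩
  rw [readWord_adjoin, readWord_congr_size hT hTw' hTw, readWord_congr_size hS hSw' hSw] at h2
  rw [readWord_congr_size h3 hw h1.within]
  exact h2.symm

end GenRS

namespace GenRS
variable {α : Type} [LinearOrder α]

/-! ### Insertion of monotone words and strips -/

/-- The box created by the insertion of `x` into the tableau `T`. -/
noncomputable def newBox (x : α) (T : List (List α)) : ℕ × ℕ :=
  ((insertTableau x T).2, (exists_shape_insertTableau x T).choose)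

theorem newBox_notMem (x : α) (T : List (List α)) : newBox x T ∉ shape (ofRows T) :=
  fun h => h (exists_shape_insertTableau x T).choose_spec.1

theorem shape_insertTableau (x : α) (T : List (List α)) :
    shape (ofRows (insertTableau x T).1) = insert (newBox x T) (shape (ofRows T)) := by
  ext c
  rw [Set.mem_insert_iff, or_comm]
  exact (exists_shape_insertTableau x T).choose_spec.2 c

/-- The comparison of rows is the row bumping lemma; the comparison of columns follows because all
the shapes involved are lower sets. -/
theorem newBox_bumping {x x' : α} {T : List (List α)} (hT : Tab T)
    (hd : (x' :: x :: T.flatten).Nodup) :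
    (x < x' → (newBox x T).2 < (newBox x' (insertTableau x T).1).2 ∧
      (newBox x' (insertTableau x T).1).1 ≤ (newBox x T).1) ∧
    (x' < x → (newBox x T).1 < (newBox x' (insertTableau x T).1).1 ∧
      (newBox x' (insertTableau x T).1).2 ≤ (newBox x T).2) := by
  have hd' : (x' :: (insertTableau x T).1.flatten).Nodup :=
    ((insertTableau_perm x T).symm.cons x').nodup hd
  have hT1 := hT.insertTableau hd.of_cons
  have hT2 := hT1.insertTableau hd'
  have low1 := (hT1.sTab hd'.of_cons).lower
  have low2 := (hT2.sTab ((insertTableau_perm x' _).symm.nodup hd')).lower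
  have hb1 : newBox x T ∈ shape (ofRows (insertTableau x T).1) := by
    rw [shape_insertTableau]; exact Set.mem_insert _ _
  have hb2 : newBox x' (insertTableau x T).1 ∉ shape (ofRows (insertTableau x T).1) :=
    newBox_notMem _ _
  have hnot : ¬ newBox x' (insertTableau x T).1 ≤ newBox x T := fun h => hb2 (low1 h hb1)
  constructor
  · intro h
    have h1 : (newBox x' (insertTableau x T).1).1 ≤ (newBox x T).1 :=
      insertTableau_snd_le hT.rows_sorted h
    refine ⟨?_, h1⟩
    by_contra h2
    exact hnot ⟨h1, not_lt.1 h2⟩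
  · intro h
    have h1 : (newBox x T).1 < (newBox x' (insertTableau x T).1).1 :=
      insertTableau_snd_lt hT.rows_sorted hd.of_cons h
    refine ⟨h1, ?_⟩
    by_contra h2
    have hb3 : newBox x' (insertTableau x T).1 ∈
        shape (ofRows (insertTableau x' (insertTableau x T).1).1) := by
      rw [shape_insertTableau]; exact Set.mem_insert _ _
    have hne : newBox x T ≠ newBox x' (insertTableau x T).1 := fun h => hb2 (h ▸ hb1)
    -- If the second new box were strictly to the right of the first as well as below it, the right
    -- neighbour of the first box would already belong to the shape of `T`, and so would the first
    -- box itself.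
    have h4 : ((newBox x T).1 , (newBox x T).2 + 1) ∈ shape (ofRows (insertTableau x T).1) := by
      have h5 : ((newBox x T).1 , (newBox x T).2 + 1) ∈
          shape (ofRows (insertTableau x' (insertTableau x T).1).1) :=
        low2 ⟨h1.le, not_le.1 h2⟩ hb3
      rw [shape_insertTableau] at h5
      rcases h5 with h5 | h5
      · have := congrArg Prod.fst h5
        simp only at this
        omega
      · exact h5
    rw [shape_insertTableau] at h4
    rcases h4 with h4 | h4
    · have := congrArg Prod.snd h4
      simp at this
    · exact newBox_notMem x T ((hT.sTab (hd.of_cons.of_cons)).lower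
        (show newBox x T ≤ ((newBox x T).1, (newBox x T).2 + 1) from ⟨le_rfl, Nat.le_succ _⟩) h4)

/-- Reverse insertion from a corner of a tableau. -/
theorem Tab.exists_remove_corner {U : List (List α)} (hU : Tab U) (hd : U.flatten.Nodup)
    {b : ℕ × ℕ} (hb : b ∈ shape (ofRows U)) (corner : ∀ c, b < c → c ∉ shape (ofRows U)) :
    ∃ x U₀, Tab U₀ ∧ (x :: U₀.flatten).Nodup ∧ GenRS.insertTableau x U₀ = (U, b.1) ∧
      newBox x U₀ = b := by
  obtain ⟨x, U₀, hU₀, hx⟩ := hU.exists_insertTableau_eq (n := b.1) (m := b.2) hd hb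
    (not_not.1 (corner (b.1, b.2 + 1) (Prod.lt_iff.2 (Or.inr ⟨le_rfl, Nat.lt_succ_self _⟩))))
    (not_not.1 (corner (b.1 + 1, b.2) (Prod.lt_iff.2 (Or.inl ⟨Nat.lt_succ_self _, le_rfl⟩))))
  have hx1 : (GenRS.insertTableau x U₀).1 = U := by rw [hx]
  have hdU : (x :: U₀.flatten).Nodup := by
    have := insertTableau_perm x U₀
    rw [hx1] at this
    exact this.nodup hd
  have hS₀ := hU₀.sTab hdU.of_cons
  have hshape : shape (ofRows U) = insert (newBox x U₀) (shape (ofRows U₀)) := by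
    rw [← shape_insertTableau, hx1]
  refine ⟨x, U₀, hU₀, hdU, hx, ?_⟩
  have h1 : (newBox x U₀).1 = b.1 := by
    change (GenRS.insertTableau x U₀).2 = b.1
    rw [hx]
  rcases lt_trichotomy (newBox x U₀).2 b.2 with h2 | h2 | h2
  · rw [hshape] at hb
    rcases hb with hb | hb
    · rw [hb] at h2; exact absurd h2 (lt_irrefl _)
    · exact absurd (hS₀.lower (show newBox x U₀ ≤ b from ⟨h1.le, h2.le⟩) hb)
        (newBox_notMem _ _)
  · exact Prod.ext h1 h2
  · refine absurd ?_ (corner (newBox x U₀) (Prod.lt_iff.2 (Or.inr ⟨h1.ge, h2⟩)))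
    rw [hshape]; exact Set.mem_insert _ _

/-- The coordinate `π` of the new boxes increases in successive insertions exactly when the inserted
letters are related by `ρ`. -/
structure Bumping (π : ℕ × ℕ → ℕ) (ρ : α → α → Prop) : Prop where
  mono : Monotone π
  trans : ∀ {a b c}, ρ a b → ρ b c → ρ a c
  iff : ∀ {T : List (List α)} {x x' : α}, Tab T → (x' :: x :: T.flatten).Nodup →
    (ρ x x' ↔ π (newBox x T) < π (newBox x' (insertTableau x T).1))

theorem bumping_fst : Bumping (α := α) Prod.fst (· > ·) where
  mono := monotone_fst
  trans := fun h h' => h'.trans h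
  iff {T x x'} hT hd := by
    have h := newBox_bumping hT hd
    refine ⟨fun hlt => (h.2 hlt).1, fun hlt => ?_⟩
    rcases lt_trichotomy x x' with h1 | rfl | h1
    · exact absurd hlt (not_lt.2 (h.1 h1).2)
    · simp at hd
    · exact h1

theorem bumping_snd : Bumping (α := α) Prod.snd (· < ·) where
  mono := monotone_snd
  trans := fun h h' => h.trans h'
  iff {T x x'} hT hd := by
    have h := newBox_bumping hT hd
    refine ⟨fun hlt => (h.1 hlt).1, fun hlt => ?_⟩
    rcases lt_trichotomy x x' with h1 | rfl | h1
    · exact h1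
    · simp at hd
    · exact absurd hlt (not_lt.2 (h.2 h1).2)

theorem insertWord_concat (T : List (List α)) (w : List α) (x : α) :
    insertWord T (w ++ [x]) = (insertTableau x (insertWord T w)).1 := by
  rw [insertWord_append]; rfl

theorem nodup_insertWord {T : List (List α)} {w : List α} (h : (T.flatten ++ w).Nodup) :
    (insertWord T w).flatten.Nodup := (insertWord_perm T w).symm.nodup h

theorem nodup_cons_insertWord {T : List (List α)} {w : List α} {x : α}
    (h : (T.flatten ++ (w ++ [x])).Nodup) : (x :: (insertWord T w).flatten).Nodup := by
  rw [← List.append_assoc] at h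
  have := (List.perm_append_singleton x (T.flatten ++ w)).nodup h
  exact ((insertWord_perm T w).symm.cons x).nodup this

/-! ### Words with monotone new boxes, and strips -/

section Strips
variable {π : ℕ × ℕ → ℕ} {ρ : α → α → Prop}

/-- The last clause carries the induction: the newest box has a larger coordinate than all boxes
added earlier, not only than the previous one. -/
theorem Bumping.strip (hB : Bumping π ρ) {T : List (List α)} (hT : Tab T) {w : List α}
    (hd : (T.flatten ++ w).Nodup) (hw : w.Pairwise ρ) :
    shape (ofRows T) ⊆ shape (ofRows (insertWord T w)) ∧
    Set.InjOn π (shape (ofRows (insertWord T w)) \ shape (ofRows T)) ∧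
    ∀ u x, w = u ++ [x] → ∀ c ∈ shape (ofRows (insertWord T u)) \ shape (ofRows T),
      π c < π (newBox x (insertWord T u)) := by
  induction w using List.reverseRecOn with
  | nil =>
    refine ⟨subset_rfl, by simp [insertWord], ?_⟩
    intro u x h; simp at h
  | append_singleton u x ih =>
    have hd' : (T.flatten ++ u).Nodup := hd.sublist (by simp)
    obtain ⟨h1, h2, h3⟩ := ih hd' (List.pairwise_append.1 hw).1
    have key : ∀ c ∈ shape (ofRows (insertWord T u)) \ shape (ofRows T),
        π c < π (newBox x (insertWord T u)) := by
      rcases List.eq_nil_or_concat u with rfl | ⟨v, y, rfl⟩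
      · intro c hc; exact absurd hc.1 hc.2
      · simp only [List.concat_eq_append] at *
        have hxy : ρ y x := (List.pairwise_append.1 hw).2.2 y (by simp) x (by simp)
        have hdv : (T.flatten ++ v).Nodup := hd'.sublist (by simp)
        have hlt := (hB.iff (hT.insertWord hdv) (x := y) (x' := x) ?_).1 hxy
        · rw [← insertWord_concat] at hlt
          intro c hc
          rcases hc with ⟨hc, hcT⟩
          rw [insertWord_concat, shape_insertTableau] at hc
          rcases hc with rfl | hc
          · exact hlt
          · exact (h3 v y rfl c ⟨hc, hcT⟩).trans hlt
        · have := nodup_cons_insertWord hd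
          rw [insertWord_concat] at this
          exact ((insertTableau_perm y _).cons x).nodup this
    rw [insertWord_concat, shape_insertTableau]
    refine ⟨h1.trans (Set.subset_insert _ _), ?_, ?_⟩
    · rintro c ⟨hc, hcT⟩ d ⟨hd, hdT⟩ hcd
      rcases hc with rfl | hc <;> rcases hd with rfl | hd
      · rfl
      · exact absurd hcd (key d ⟨hd, hdT⟩).ne'
      · exact absurd hcd (key c ⟨hc, hcT⟩).ne
      · exact h2 ⟨hc, hcT⟩ ⟨hd, hdT⟩ hcd
    · intro v y hv
      obtain ⟨rfl, h⟩ := List.append_inj' hv rfl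
      obtain rfl : x = y := by simpa using h
      exact key

/-- The boxes of the strip are removed by reverse insertion in decreasing order of `π`. The converse
direction of the bumping lemma shows that the expelled letters are related by `ρ`. -/
theorem Bumping.exists_word (hB : Bumping π ρ) {k : ℕ} {U : List (List α)} {κ : Set (ℕ × ℕ)}
    (hU : Tab U) (hd : U.flatten.Nodup) (hκ : IsLowerSet κ) (hsub : κ ⊆ shape (ofRows U))
    (hinj : Set.InjOn π (shape (ofRows U) \ κ)) (hk : (shape (ofRows U) \ κ).ncard = k) :
    ∃ T w, Tab T ∧ shape (ofRows T) = κ ∧ (T.flatten ++ w).Nodup ∧ w.Pairwise ρ ∧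
      insertWord T w = U := by
  have hS := hU.sTab hd
  have hfin : (shape (ofRows U) \ κ).Finite := hS.finite.subset Set.sdiff_subset
  induction k generalizing U with
  | zero =>
    have h0 := (Set.ncard_eq_zero hfin).1 hk
    exact ⟨U, [], hU, (Set.sdiff_eq_empty.1 h0).antisymm hsub, by simpa using hd, .nil, rfl⟩
  | succ k ih =>
    have hne : (shape (ofRows U) \ κ).Nonempty := by
      rw [← Set.ncard_pos hfin]; omega
    obtain ⟨b, hb, hmax⟩ := Set.exists_max_image _ π hfin hne
    -- The box `b` with maximal `π` is a corner: a box beyond it would also lie in the strip and,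
    -- `π` being monotone, would have the same coordinate.
    obtain ⟨x, U₀, hU₀, hdU, hx, hnb⟩ := hU.exists_remove_corner hd hb.1 (by
      intro c hbc hc
      have hcκ : c ∉ κ := fun h => hb.2 (hκ hbc.le h)
      exact hbc.ne (hinj hb ⟨hc, hcκ⟩ (le_antisymm (hB.mono hbc.le) (hmax c ⟨hc, hcκ⟩))))
    have hx1 : (insertTableau x U₀).1 = U := by rw [hx]
    have hS₀ := hU₀.sTab hdU.of_cons
    have hshape : shape (ofRows U) = insert (newBox x U₀) (shape (ofRows U₀)) := by
      rw [← shape_insertTableau, hx1]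
    rw [hnb] at hshape
    have hbU₀ : b ∉ shape (ofRows U₀) := hnb ▸ newBox_notMem x U₀
    have hdiff : shape (ofRows U₀) \ κ = (shape (ofRows U) \ κ) \ {b} := by
      ext c
      rw [hshape]
      simp only [Set.mem_sdiff, Set.mem_insert_iff, Set.mem_singleton_iff]
      constructor
      · rintro ⟨h1, h2⟩
        exact ⟨⟨Or.inr h1, h2⟩, fun h => hbU₀ (h ▸ h1)⟩
      · rintro ⟨⟨h1 | h1, h2⟩, h3⟩
        · exact absurd h1 h3
        · exact ⟨h1, h2⟩
    have hdsub : shape (ofRows U₀) \ κ ⊆ shape (ofRows U) \ κ := by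
      rw [hdiff]; exact Set.sdiff_subset
    obtain ⟨T, w, hT, hTκ, hdT, hw, hTU⟩ := ih hU₀ hdU.of_cons (by
      intro c hc
      have := hsub hc
      rw [hshape] at this
      rcases this with rfl | h
      · exact absurd hc hb.2
      · exact h) (hinj.mono hdsub) (by
        rw [hdiff, Set.ncard_sdiff_singleton_of_mem hb, hk]; rfl) hS₀ (hfin.subset hdsub)
    have hdx : (T.flatten ++ (w ++ [x])).Nodup := by
      rw [← List.append_assoc]
      refine (List.perm_append_singleton x _).symm.nodup ?_
      refine ((insertWord_perm T w).cons x).nodup ?_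
      rw [hTU]; exact hdU
    refine ⟨T, w ++ [x], hT, hTκ, hdx, ?_, by rw [insertWord_concat, hTU, hx1]⟩
    rw [List.pairwise_append]
    refine ⟨hw, by simp, ?_⟩
    simp only [List.mem_singleton, forall_eq]
    rcases List.eq_nil_or_concat w with rfl | ⟨v, y, rfl⟩
    · simp
    · simp only [List.concat_eq_append] at *
      have hdv : (T.flatten ++ v).Nodup := hdT.sublist (by simp)
      have hyx : ρ y x := by
        refine (hB.iff (hT.insertWord hdv) (x := y) (x' := x) ?_).2 ?_
        · have := nodup_cons_insertWord hdx
          rw [insertWord_concat] at this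
          exact ((insertTableau_perm y _).cons x).nodup this
        · rw [← insertWord_concat, hTU, hnb]
          -- The box created by the preceding letter `y` is another box of the strip, so its
          -- coordinate is smaller than that of `b`.
          have hmem : newBox y (insertWord T v) ∈ shape (ofRows U₀) \ κ := by
            refine ⟨?_, fun h => ?_⟩
            · rw [← hTU, insertWord_concat, shape_insertTableau]; exact Set.mem_insert _ _
            · rw [← hTκ] at h
              exact newBox_notMem _ _
                ((hB.strip hT hdv (List.pairwise_append.1 hw).1).1 h)
          refine lt_of_le_of_ne (hmax _ (hdsub hmem)) fun h => ?_
          have := hinj (hdsub hmem) hb h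
          exact hbU₀ (this ▸ hmem.1)
      intro z hz
      rcases List.mem_append.1 hz with hz | hz
      · exact hB.trans ((List.pairwise_append.1 hw).2.2 z hz y (by simp)) hyx
      · obtain rfl : z = y := by simpa using hz
        exact hyx

/-- The box created last is the box of the strip with the largest coordinate, hence it is determined
by the two shapes; reverse insertion from it is unique. -/
theorem Bumping.word_unique (hB : Bumping π ρ) {T T' : List (List α)} {w w' : List α}
    (hT : Tab T) (hT' : Tab T') (hs : shape (ofRows T) = shape (ofRows T'))
    (hd : (T.flatten ++ w).Nodup) (hd' : (T'.flatten ++ w').Nodup) (hw : w.Pairwise ρ)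
    (hw' : w'.Pairwise ρ) (h : insertWord T w = insertWord T' w') : T = T' ∧ w = w' := by
  have aux : ∀ {T T' : List (List α)} {w : List α} {x : α}, Tab T' →
      shape (ofRows T) = shape (ofRows T') → (T'.flatten ++ (w ++ [x])).Nodup →
      (w ++ [x]).Pairwise ρ → T = insertWord T' (w ++ [x]) → False := by
    intro T T' w x hT' hs hd hw h
    have h1 := (hB.strip hT' (hd.sublist (by simp)) (List.pairwise_append.1 hw).1).1
    have h2 : newBox x (insertWord T' w) ∈ shape (ofRows T) := by
      rw [h, insertWord_concat, shape_insertTableau]; exact Set.mem_insert _ _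
    rw [hs] at h2
    exact newBox_notMem _ _ (h1 h2)
  induction w using List.reverseRecOn generalizing w' with
  | nil =>
    rcases List.eq_nil_or_concat w' with rfl | ⟨v, y, rfl⟩
    · exact ⟨h, rfl⟩
    · simp only [List.concat_eq_append] at *
      exact (aux hT' hs hd' hw' h).elim
  | append_singleton w x ih =>
    rcases List.eq_nil_or_concat w' with rfl | ⟨w', x', rfl⟩
    · exact (aux hT hs.symm hd hw h.symm).elim
    · simp only [List.concat_eq_append] at *
      have hw1 := (List.pairwise_append.1 hw).1
      have hw1' := (List.pairwise_append.1 hw').1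
      have hd1 : (T.flatten ++ w).Nodup := hd.sublist (by simp)
      have hd1' : (T'.flatten ++ w').Nodup := hd'.sublist (by simp)
      have s := (hB.strip hT hd hw).2.2 w x rfl
      have s' := (hB.strip hT' hd' hw').2.2 w' x' rfl
      have sub := (hB.strip hT hd1 hw1).1
      have sub' := (hB.strip hT' hd1' hw1').1
      rw [insertWord_concat, insertWord_concat] at h
      have hshape := congrArg (fun T => shape (ofRows T)) h
      simp only [shape_insertTableau] at hshape
      -- If the two last boxes differed, each would have been created earlier by the other word, and
      -- each would have a smaller coordinate than the other.
      have hnb : newBox x (insertWord T w) = newBox x' (insertWord T' w') := by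
        by_contra hne
        have h1 : newBox x (insertWord T w) ∈ shape (ofRows (insertWord T' w')) := by
          have : newBox x (insertWord T w) ∈
              insert (newBox x' (insertWord T' w')) (shape (ofRows (insertWord T' w'))) := by
            rw [← hshape]; exact Set.mem_insert _ _
          exact this.resolve_left hne
        have h2 : newBox x' (insertWord T' w') ∈ shape (ofRows (insertWord T w)) := by
          have : newBox x' (insertWord T' w') ∈
              insert (newBox x (insertWord T w)) (shape (ofRows (insertWord T w))) := by
            rw [hshape]; exact Set.mem_insert _ _
          exact this.resolve_left (Ne.symm hne)
        refine lt_asymm (s' _ ⟨h1, fun h => ?_⟩) (s _ ⟨h2, fun h => ?_⟩)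
        · rw [← hs] at h; exact newBox_notMem _ _ (sub h)
        · rw [hs] at h; exact newBox_notMem _ _ (sub' h)
      obtain ⟨rfl, h1⟩ := insertTableau_injective (hT.insertWord hd1) (hT'.insertWord hd1')
        (Prod.ext h (congrArg Prod.fst hnb))
      obtain ⟨h2, h3⟩ := ih hd1 hd1' hw1 hw1' h1
      exact ⟨h2, by rw [h3]⟩

end Strips
end GenRS

namespace GenRS
variable {α : Type} [LinearOrder α]

/-! ### Multiplication by a column -/

/-- The set of entries of a filling. -/
def content {β : Type} (F : Filling β) : Set β := {a | ∃ c, F c = some a}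

theorem content_ofRows {β : Type} (T : List (List β)) :
    content (ofRows T) = {a | a ∈ T.flatten} := by
  ext a; exact mem_flatten_iff.symm

theorem content_transpose {β : Type} (F : Filling β) : content (transpose F) = content F := by
  ext a
  constructor
  · rintro ⟨c, hc⟩; exact ⟨c.swap, hc⟩
  · rintro ⟨c, hc⟩; exact ⟨c.swap, hc⟩

/-- The operation `op` on tableaux and sets of letters satisfies the Pieri rule, the
coordinate `π` being injective on the added strips. -/
structure Pieri (π : ℕ × ℕ → ℕ) (op : Filling α → Finset α → Filling α) : Prop where
  sTab : ∀ {F L}, STab F → (∀ a ∈ L, a ∉ content F) → STab (op F L)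
  content_eq : ∀ {F L}, STab F → (∀ a ∈ L, a ∉ content F) → content (op F L) = content F ∪ L
  subset : ∀ {F L}, STab F → (∀ a ∈ L, a ∉ content F) → shape F ⊆ shape (op F L)
  injOn : ∀ {F L}, STab F → (∀ a ∈ L, a ∉ content F) → Set.InjOn π (shape (op F L) \ shape F)
  exists_eq : ∀ {U κ}, STab U → IsLowerSet κ → κ ⊆ shape U → Set.InjOn π (shape U \ κ) →
    ∃ F L, STab F ∧ (∀ a ∈ L, a ∉ content F) ∧ shape F = κ ∧ op F L = U
  unique : ∀ {F F' L L'}, STab F → STab F' → (∀ a ∈ L, a ∉ content F) →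
    (∀ a ∈ L', a ∉ content F') → shape F = shape F' → op F L = op F' L' → F = F' ∧ L = L'

/-- Here `word L` is the unique listing of `L` that is monotone for `ρ`, so that sets of letters and
monotone words correspond and the results on insertion pass to fillings. -/
theorem Bumping.pieri {π : ℕ × ℕ → ℕ} {ρ : α → α → Prop} (hB : Bumping π ρ)
    {word : Finset α → List α} (hw : ∀ L, (word L).Pairwise ρ)
    (hmem : ∀ L a, a ∈ word L ↔ a ∈ L) (hnd : ∀ L, (word L).Nodup)
    (hsurj : ∀ w : List α, w.Pairwise ρ → w.Nodup → ∃ L, word L = w)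
    {op : Filling α → Finset α → Filling α}
    (hop : ∀ T L, Tab T → (T.flatten ++ word L).Nodup →
      op (ofRows T) L = ofRows (insertWord T (word L))) : Pieri π op := by
  have red : ∀ {F : Filling α} {L}, STab F → (∀ a ∈ L, a ∉ content F) →
      ∃ T, Tab T ∧ ofRows T = F ∧ (T.flatten ++ word L).Nodup ∧
        op F L = ofRows (insertWord T (word L)) := by
    intro F L hF hL
    obtain ⟨T, hT, hd, rfl⟩ := hF.exists_tab
    have hdL : (T.flatten ++ word L).Nodup := by
      rw [List.nodup_append]
      refine ⟨hd, hnd L, ?_⟩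
      rintro a ha _ hb rfl
      refine hL a ((hmem L a).1 hb) ?_
      rw [content_ofRows]; exact ha
    exact ⟨T, hT, rfl, hdL, hop T L hT hdL⟩
  refine ⟨?_, ?_, ?_, ?_, ?_, ?_⟩
  · intro F L hF hL
    obtain ⟨T, hT, -, hd, h⟩ := red hF hL
    rw [h]
    exact (hT.insertWord hd).sTab (nodup_insertWord hd)
  · intro F L hF hL
    obtain ⟨T, hT, rfl, hd, h⟩ := red hF hL
    rw [h]
    ext a
    simp only [content_ofRows, Set.mem_ofPred_eq, Set.mem_union, (insertWord_perm T _).mem_iff,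
      List.mem_append, hmem, Finset.mem_coe]
  · intro F L hF hL
    obtain ⟨T, hT, rfl, hd, h⟩ := red hF hL
    rw [h]
    exact (hB.strip hT hd (hw L)).1
  · intro F L hF hL
    obtain ⟨T, hT, rfl, hd, h⟩ := red hF hL
    rw [h]
    exact (hB.strip hT hd (hw L)).2.1
  · intro U κ hU hκ hsub hinj
    obtain ⟨V, hV, hd, rfl⟩ := hU.exists_tab
    obtain ⟨T, w, hT, hTκ, hdT, hwρ, hTV⟩ := hB.exists_word hV hd hκ hsub hinj rfl
    obtain ⟨L, rfl⟩ := hsurj w hwρ (hdT.sublist (by simp))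
    refine ⟨ofRows T, L, hT.sTab (hdT.sublist (by simp)), ?_, hTκ, ?_⟩
    · intro a ha ha'
      rw [content_ofRows] at ha'
      exact (List.nodup_append.1 hdT).2.2 a ha' a ((hmem L a).2 ha) rfl
    · rw [hop T L hT hdT, hTV]
  · intro F F' L L' hF hF' hL hL' hs heq
    obtain ⟨T, hT, rfl, hd, h⟩ := red hF hL
    obtain ⟨T', hT', rfl, hd', h'⟩ := red hF' hL'
    rw [h, h'] at heq
    obtain ⟨rfl, h2⟩ := hB.word_unique hT hT' hs hd hd' (hw L) (hw L')
      (ofRows_injective (hT.insertWord hd).rows_ne_nil (hT'.insertWord hd').rows_ne_nil heq)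
    refine ⟨rfl, ?_⟩
    ext a
    rw [← hmem, ← hmem, h2]

theorem Pieri.of_transpose {op : Filling α → Finset α → Filling α}
    (h : Pieri Prod.snd fun F L => transpose (op (transpose F) L)) : Pieri Prod.fst op := by
  have hop : ∀ F L, op F L = transpose (transpose (op (transpose (transpose F)) L)) :=
    fun F L => rfl
  have hav : ∀ {F : Filling α} {L : Finset α}, (∀ a ∈ L, a ∉ content F) →
      ∀ a ∈ L, a ∉ content (transpose F) := by
    intro F L hL a ha; rw [content_transpose]; exact hL a ha
  have hshape : ∀ {F : Filling α}, shape (transpose F) = Prod.swap ⁻¹' shape F := fun {F} => rfl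
  refine ⟨?_, ?_, ?_, ?_, ?_, ?_⟩
  · intro F L hF hL
    exact (h.sTab hF.transpose (hav hL)).transpose
  · intro F L hF hL
    have := h.content_eq hF.transpose (hav hL)
    rwa [content_transpose, content_transpose] at this
  · intro F L hF hL c hc
    exact h.subset hF.transpose (hav hL) (a := c.swap) hc
  · intro F L hF hL c hc d hd hcd
    exact Prod.swap_injective (h.injOn hF.transpose (hav hL)
      (x₁ := c.swap) (x₂ := d.swap) hc hd hcd)
  · intro U κ hU hκ hsub hinj
    obtain ⟨F, L, hF, hL, hs, hFU⟩ := h.exists_eq (U := transpose U) (κ := Prod.swap ⁻¹' κ)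
      hU.transpose (fun c d hle hc => hκ (show d.swap ≤ c.swap from ⟨hle.2, hle.1⟩) hc)
      (fun c hc => hsub hc)
      (fun c hc d hd hcd => Prod.swap_injective (hinj (x₁ := c.swap) (x₂ := d.swap) hc hd hcd))
    refine ⟨transpose F, L, hF.transpose, hav hL, ?_, transpose_injective hFU⟩
    rw [hshape, hs]; rfl
  · intro F F' L L' hF hF' hL hL' hs heq
    obtain ⟨h1, h2⟩ := h.unique hF.transpose hF'.transpose (hav hL) (hav hL')
      (by rw [hshape, hshape, hs]) (congrArg transpose heq)
    exact ⟨transpose_injective h1, h2⟩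

theorem column_eq_ofRows (L : Finset α) :
    column L = ofRows ((L.sort (· ≤ ·)).map fun a => [a]) := by
  funext ⟨i, j⟩
  simp only [column, ofRows, List.getElem?_map]
  cases (L.sort (· ≤ ·))[i]? <;> cases j <;> simp

theorem pairwise_lt_sort (L : Finset α) : (L.sort (· ≤ ·)).Pairwise (· < ·) := by
  refine ((L.pairwise_sort (· ≤ ·)).and (L.sort_nodup (· ≤ ·))).imp ?_
  exact fun h => lt_of_le_of_ne h.1 h.2

theorem tab_map_singleton {l : List α} (h : l.Pairwise (· < ·)) : Tab (l.map fun a => [a]) := by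
  induction l with
  | nil => trivial
  | cons a l ih =>
    refine ⟨by simp, by simp, ?_, ih h.of_cons⟩
    cases l with
    | nil => simp
    | cons b l => simpa using List.rel_of_pairwise_cons h (by simp)

theorem tab_column (L : Finset α) : Tab ((L.sort (· ≤ ·)).map fun a => [a]) :=
  tab_map_singleton (pairwise_lt_sort L)

theorem flatten_map_singleton {β : Type} (l : List β) : (l.map fun a => [a]).flatten = l := by
  induction l with
  | nil => rfl
  | cons a l ih => simpa using ih

theorem sTab_column (L : Finset α) : STab (column L) := by
  rw [column_eq_ofRows]
  refine (tab_column L).sTab ?_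
  rw [flatten_map_singleton]
  exact L.sort_nodup _

theorem content_column (L : Finset α) : content (column L) = L := by
  ext a
  rw [column_eq_ofRows, content_ofRows, flatten_map_singleton]
  simp

theorem readWord_column (L : Finset α) {n m : ℕ} (hw : Within n m (column L)) :
    readWord n m (column L) = (L.sort (· ≤ ·)).reverse := by
  rw [column_eq_ofRows] at hw ⊢
  rw [(tab_column L).readWord_ofRows hw, readRows, ← List.map_reverse, flatten_map_singleton]

/-- The reading word of a column is decreasing, and the product inserts it into `F`. -/
theorem pieri_right : Pieri (α := α) Prod.fst fun F L => product F (column L) := by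
  refine bumping_fst.pieri (word := fun L => (L.sort (· ≤ ·)).reverse) ?_ ?_ ?_ ?_ ?_
  · intro L
    exact List.pairwise_reverse.2 (pairwise_lt_sort L)
  · simp
  · intro L
    exact List.nodup_reverse.2 (L.sort_nodup _)
  · intro w hw hd
    refine ⟨w.toFinset, ?_⟩
    have : w.toFinset = w.reverse.toFinset := by simp
    simp only [this]
    rw [(List.toFinset_sort (r := (· ≤ ·)) (List.nodup_reverse.2 hd)).2, List.reverse_reverse]
    exact List.pairwise_reverse.2 (hw.imp le_of_lt)
  · intro T L hT hd
    have hS := hT.sTab (hd.sublist (by simp))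
    obtain ⟨n, hn⟩ := exists_within hS.finite
    obtain ⟨m, hm⟩ := exists_within (sTab_column L).finite
    have hdis : ∀ c c' a, ofRows T c = some a → column L c' ≠ some a := by
      intro c c' a hc hc'
      have h1 : a ∈ content (column L) := ⟨c', hc'⟩
      rw [content_column] at h1
      exact (List.nodup_append.1 hd).2.2 a (mem_flatten_iff.2 ⟨c, hc⟩) a (by simpa using h1) rfl
    have hP := (product_spec (N := 0) (M := 0) hS (sTab_column L) hdis hn hm).1
    obtain ⟨N, hN⟩ := exists_within hP.finite
    have hK := (product_spec hS (sTab_column L) hdis hn hm).2 hN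
    obtain ⟨V, hV, hVd, hVP⟩ := hP.exists_tab
    rw [← hVP] at hK hN ⊢
    rw [hV.readWord_ofRows hN, hT.readWord_ofRows hn, readWord_column L hm] at hK
    rw [hT.eq_insertWord_of_knuth hV hVd hK]

/-- The word of the column now comes first, which is the wrong side for insertion. Reflection
reverses words, so the column becomes an increasing word inserted last into the reflected tableau.
-/
theorem pieri_left : Pieri (α := α) Prod.fst fun F L => product (column L) F := by
  refine Pieri.of_transpose ?_
  refine bumping_snd.pieri (word := fun L => L.sort (· ≤ ·)) pairwise_lt_sort ?_ ?_ ?_ ?_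
  · simp
  · intro L
    exact L.sort_nodup _
  · intro w hw hd
    refine ⟨w.toFinset, ?_⟩
    exact (List.toFinset_sort (r := (· ≤ ·)) hd).2 (hw.imp le_of_lt)
  · intro T L hT hd
    have hS' := hT.sTab (hd.sublist (by simp))
    have hS := hS'.transpose
    obtain ⟨n, hn⟩ := exists_within hS.finite
    obtain ⟨m, hm⟩ := exists_within (sTab_column L).finite
    have hdis : ∀ c c' a, column L c = some a → transpose (ofRows T) c' ≠ some a := by
      intro c c' a hc hc'
      have h1 : a ∈ content (column L) := ⟨c, hc⟩
      rw [content_column] at h1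
      exact (List.nodup_append.1 hd).2.2 a (mem_flatten_iff.2 ⟨c'.swap, hc'⟩) a
        (by simpa using h1) rfl
    have hP := (product_spec (N := 0) (M := 0) (sTab_column L) hS hdis hm hn).1
    obtain ⟨N, hN⟩ := exists_within hP.finite
    have hK := (product_spec (sTab_column L) hS hdis hm hn).2 hN
    have hK' := (knuth_readWord_transpose hP hN).trans hK.reverse
    obtain ⟨V, hV, hVd, hVP⟩ := hP.transpose.exists_tab
    have hN' := hN.transpose
    have hn' := hn.transpose
    have hK'' := knuth_readWord_transpose_reverse hS' hn'
    rw [transpose_transpose] at hn'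
    rw [← hVP] at hK' hN' ⊢
    rw [hV.readWord_ofRows hN', readWord_column L hm, List.reverse_append,
      List.reverse_reverse] at hK'
    rw [hT.readWord_ofRows hn'] at hK''
    rw [hT.eq_insertWord_of_knuth hV hVd (hK'.trans (hK''.symm.append_right _))]

end GenRS

namespace GenRS

/-! ### The Robinson-Schensted correspondence -/

/-! ### Recording a new box -/

section AddBox
variable {β : Type}

theorem addBox_perm (y : β) (n : ℕ) (Q : List (List β)) :
    (addBox y n Q).flatten.Perm (y :: Q.flatten) := by
  induction Q generalizing n with
  | nil => simp [addBox]
  | cons r Q ih =>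
    cases n with
    | zero => simp [addBox]
    | succ n =>
      simp only [addBox, List.flatten_cons]
      exact ((ih n).append_left r).trans List.perm_middle

theorem addBox_rows_ne_nil {y : β} {n : ℕ} {Q : List (List β)} (h : ∀ r ∈ Q, r ≠ []) :
    ∀ r ∈ addBox y n Q, r ≠ [] := by
  induction Q generalizing n with
  | nil => simp [addBox]
  | cons r Q ih =>
    intro s hs
    cases n with
    | zero =>
      rcases List.mem_cons.1 hs with rfl | hs
      · simp
      · exact h s (by simp [hs])
    | succ n =>
      rcases List.mem_cons.1 hs with rfl | hs
      · exact h s (by simp)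
      · exact ih (fun r hr => h r (by simp [hr])) s hs

theorem ofRows_addBox (y : β) {n m : ℕ} {Q : List (List β)} (hn : n ≤ Q.length)
    (hm : ofRows Q (n, m) = none) (hlt : ∀ j < m, ofRows Q (n, j) ≠ none) :
    ofRows (addBox y n Q) = Function.update (ofRows Q) (n, m) (some y) := by
  induction Q generalizing n with
  | nil =>
    obtain rfl : n = 0 := by simpa using hn
    obtain rfl : m = 0 := by
      by_contra h
      exact hlt 0 (Nat.pos_of_ne_zero h) rfl
    funext ⟨i, j⟩
    cases i <;> cases j <;> simp [addBox]
  | cons r Q ih =>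
    cases n with
    | zero =>
      have h1 : r.length = m := by
        simp only [ofRows_cons_zero, List.getElem?_eq_none_iff, ne_eq, not_le] at hm hlt
        refine le_antisymm hm ?_
        by_contra h
        exact lt_irrefl _ (hlt r.length (by omega))
      subst h1
      funext ⟨i, j⟩
      cases i with
      | zero =>
        simp only [addBox, ofRows_cons_zero, Function.update_apply, Prod.mk.injEq, true_and]
        split_ifs with h
        · simp [h]
        · rcases lt_or_gt_of_ne h with h | h
          · rw [List.getElem?_append_left h]
          · rw [List.getElem?_eq_none (by simp; omega), List.getElem?_eq_none (by omega)]
      | succ i => simp [addBox]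
    | succ n =>
      have := ih (n := n) (by simpa using hn) hm hlt
      funext ⟨i, j⟩
      cases i with
      | zero => simp [addBox]
      | succ i => simp [addBox, this, Function.update_apply]

end AddBox

variable {α β : Type} [LinearOrder α] [LinearOrder β]

theorem sTab_update {F : Filling α} (hF : STab F) {b : ℕ × ℕ} {y : α}
    (hlow : IsLowerSet (insert b (shape F))) (hb : b ∉ shape F) (hy : ∀ a ∈ content F, a < y) :
    STab (Function.update F b (some y)) := by
  have hs : shape (Function.update F b (some y)) = insert b (shape F) := by
    ext c
    rcases eq_or_ne c b with rfl | hc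
    · simp [shape]
    · simp [shape, hc]
  refine ⟨?_, ?_, ?_, ?_⟩
  · rw [hs]; exact hF.finite.insert b
  · rw [hs]; exact hlow
  · intro c d u v hu hv hcd
    rcases eq_or_ne c b with rfl | hc
    · rw [Function.update_of_ne hcd.ne'] at hv
      exact absurd (hF.lower hcd.le (show d ∈ shape F by simp [shape, hv])) hb
    · rw [Function.update_of_ne hc] at hu
      rcases eq_or_ne d b with rfl | hd
      · rw [Function.update_self] at hv
        obtain rfl := Option.some.inj hv
        exact hy u ⟨c, hu⟩
      · rw [Function.update_of_ne hd] at hv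
        exact hF.increasing c d u v hu hv hcd
  · intro c d u hu hv
    by_cases hc : c = b <;> by_cases hd : d = b
    · rw [hc, hd]
    · rw [hc, Function.update_self] at hu
      rw [Function.update_of_ne hd, ← hu] at hv
      exact absurd (hy _ ⟨d, hv⟩) (lt_irrefl _)
    · rw [hd, Function.update_self] at hv
      rw [Function.update_of_ne hc, ← hv] at hu
      exact absurd (hy _ ⟨c, hu⟩) (lt_irrefl _)
    · rw [Function.update_of_ne hc] at hu
      rw [Function.update_of_ne hd] at hv
      exact hF.injective c d u hu hv

theorem shape_update_none {γ : Type} (F : Filling γ) (b : ℕ × ℕ) :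
    shape (Function.update F b none) = shape F \ {b} := by
  ext c
  rcases eq_or_ne c b with rfl | hc
  · simp [shape]
  · simp [shape, hc]

theorem sTab_erase {F : Filling α} (hF : STab F) {b : ℕ × ℕ} (hb : ∀ c, b < c → c ∉ shape F) :
    STab (Function.update F b none) := by
  have red : ∀ {c a}, Function.update F b none c = some a → F c = some a := by
    intro c a h
    rcases eq_or_ne c b with rfl | hc
    · simp at h
    · rwa [Function.update_of_ne hc] at h
  refine ⟨?_, ?_, ?_, ?_⟩
  · rw [shape_update_none]; exact hF.finite.subset Set.sdiff_subset
  · rw [shape_update_none]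
    rintro c d hle ⟨hc, hcb⟩
    refine ⟨hF.lower hle hc, ?_⟩
    rintro rfl
    exact hb c (lt_of_le_of_ne hle (Ne.symm hcb)) hc
  · exact fun c d u v hu hv => hF.increasing c d u v (red hu) (red hv)
  · exact fun c d u hu hv => hF.injective c d u (red hu) (red hv)

/-- Only the row of the new box is recorded, but `P` and `Q` have the same shape, so the end of that
row in `Q` is the new box. -/
theorem ofRows_addBox_newBox {γ : Type} {P : List (List α)} {Q : List (List γ)} {x : α} (y : γ)
    (hP : Tab P) (hd : (x :: P.flatten).Nodup) (hs : shape (ofRows P) = shape (ofRows Q)) :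
    ofRows (addBox y (insertTableau x P).2 Q) =
      Function.update (ofRows Q) (newBox x P) (some y) := by
  have hlow := ((hP.insertTableau hd).sTab ((insertTableau_perm x P).symm.nodup hd)).lower
  rw [shape_insertTableau] at hlow
  have key : ∀ c, c < newBox x P → c ∈ shape (ofRows Q) := by
    intro c hc
    rw [← hs]
    exact (hlow hc.le (Set.mem_insert _ _)).resolve_left hc.ne
  have hnot := newBox_notMem x P
  rw [hs] at hnot
  refine ofRows_addBox y ?_ (not_not.1 hnot) fun j hj => ?_
  · rcases Nat.eq_zero_or_pos (insertTableau x P).2 with h0 | h0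
    · rw [h0]; exact Nat.zero_le _
    · by_contra hlt
      -- The box above the new one is occupied, so the new row is at most one beyond the existing
      -- rows.
      have h1 : ((insertTableau x P).2 - 1, (newBox x P).2) ∈ shape (ofRows Q) := by
        refine key _ (Prod.lt_iff.2 (Or.inl ⟨?_, le_rfl⟩))
        change (insertTableau x P).2 - 1 < (insertTableau x P).2
        omega
      refine h1 ?_
      simp only [ofRows]
      rw [List.getElem?_eq_none (by omega)]
      rfl
  · exact key (_, j) (Prod.lt_iff.2 (Or.inr ⟨le_rfl, hj⟩))

/-- The check is made on fillings, where a new maximal entry at an outer corner is harmless, and is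
carried back to lists of rows by `ofRows_injective`. -/
theorem tab_addBox {P : List (List α)} {Q : List (List β)} {x : α} {y : β}
    (hP : Tab P) (hd : (x :: P.flatten).Nodup) (hs : shape (ofRows P) = shape (ofRows Q))
    (hQ : Tab Q) (hdQ : Q.flatten.Nodup) (hy : ∀ a ∈ Q.flatten, a < y) :
    Tab (addBox y (insertTableau x P).2 Q) := by
  have hlow := ((hP.insertTableau hd).sTab ((insertTableau_perm x P).symm.nodup hd)).lower
  have hnot := newBox_notMem x P
  rw [shape_insertTableau, hs] at hlow
  rw [hs] at hnot
  have hS := sTab_update (hQ.sTab hdQ) hlow hnot (y := y) (by rw [content_ofRows]; exact hy)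
  obtain ⟨T, hT, -, hTe⟩ := hS.exists_tab
  rw [← ofRows_addBox_newBox y hP hd hs] at hTe
  rwa [← ofRows_injective hT.rows_ne_nil (addBox_rows_ne_nil hQ.rows_ne_nil) hTe]

theorem rsRows_concat {γ : Type} (w : List (γ × α)) (e : γ × α) :
    rsRows (w ++ [e]) = ((insertTableau e.2 (rsRows w).1).1,
      addBox e.1 (insertTableau e.2 (rsRows w).1).2 (rsRows w).2) := by
  simp [rsRows]

/-- The properties of the pair of tableaux of a two-line array. -/
structure RSSpec (w : List (β × α)) (P : List (List α)) (Q : List (List β)) : Prop where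
  tab_left : Tab P
  perm_left : P.flatten.Perm (w.map Prod.snd)
  tab_right : Tab Q
  perm_right : Q.flatten.Perm (w.map Prod.fst)
  shape_eq : shape (ofRows P) = shape (ofRows Q)

theorem nodup_map_snd_concat {γ δ : Type} {w : List (γ × δ)} {e : γ × δ}
    (h : ((w ++ [e]).map Prod.snd).Nodup) : (e.2 :: w.map Prod.snd).Nodup := by
  rw [List.map_append] at h
  exact (List.perm_append_singleton e.2 _).nodup h

theorem rsRows_spec {w : List (β × α)} (ht : (w.map Prod.fst).Pairwise (· < ·))
    (hb : (w.map Prod.snd).Nodup) : RSSpec w (rsRows w).1 (rsRows w).2 := by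
  induction w using List.reverseRecOn with
  | nil => exact ⟨trivial, by simp [rsRows], trivial, by simp [rsRows], by simp [rsRows, shape]⟩
  | append_singleton w e ih =>
    have hb1 := nodup_map_snd_concat hb
    rw [List.map_append, List.pairwise_append] at ht
    have H := ih ht.1 hb1.of_cons
    have hd : (e.2 :: (rsRows w).1.flatten).Nodup := (H.perm_left.symm.cons _).nodup hb1
    have hdQ : (rsRows w).2.flatten.Nodup := H.perm_right.symm.nodup (ht.1.imp ne_of_lt)
    have hy : ∀ a ∈ (rsRows w).2.flatten, a < e.1 := fun a ha =>
      ht.2.2 a (H.perm_right.subset ha) e.1 (by simp)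
    rw [rsRows_concat]
    refine ⟨H.tab_left.insertTableau hd, ?_, tab_addBox H.tab_left hd H.shape_eq H.tab_right hdQ hy,
      ?_, ?_⟩
    · rw [List.map_append]
      exact (insertTableau_perm _ _).trans
        ((H.perm_left.cons _).trans (List.perm_append_singleton e.2 _).symm)
    · rw [List.map_append]
      exact (addBox_perm _ _ _).trans
        ((H.perm_right.cons _).trans (List.perm_append_singleton e.1 _).symm)
    · simp only
      rw [ofRows_addBox_newBox e.1 H.tab_left hd H.shape_eq, shape_insertTableau, H.shape_eq]
      ext c
      rcases eq_or_ne c (newBox e.2 (rsRows w).1) with rfl | hc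
      · simp [shape]
      · simp [shape, hc]

/-- The last step can be undone: the largest entry of the recording tableau marks the box created
last, and reverse insertion from that box is unique. -/
theorem rsRows_injective {w w' : List (β × α)} (ht : (w.map Prod.fst).Pairwise (· < ·))
    (hb : (w.map Prod.snd).Nodup) (ht' : (w'.map Prod.fst).Pairwise (· < ·))
    (hb' : (w'.map Prod.snd).Nodup) (h : rsRows w = rsRows w') : w = w' := by
  have hlen : w.length = w'.length := by
    have h1 := (rsRows_spec ht hb).perm_left.length_eq
    have h2 := (rsRows_spec ht' hb').perm_left.length_eq
    rw [h, h2] at h1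
    simpa using h1.symm
  induction w using List.reverseRecOn generalizing w' with
  | nil => exact (List.length_eq_zero_iff.1 hlen.symm).symm
  | append_singleton w e ih =>
    rcases List.eq_nil_or_concat w' with rfl | ⟨w', e', rfl⟩
    · simp at hlen
    simp only [List.concat_eq_append] at *
    have hb1 := nodup_map_snd_concat hb
    have hb1' := nodup_map_snd_concat hb'
    have hQ := rsRows_spec ht hb
    rw [List.map_append, List.pairwise_append] at ht ht'
    have H := rsRows_spec ht.1 hb1.of_cons
    have H' := rsRows_spec ht'.1 hb1'.of_cons
    have hd : (e.2 :: (rsRows w).1.flatten).Nodup := (H.perm_left.symm.cons _).nodup hb1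
    have hd' : (e'.2 :: (rsRows w').1.flatten).Nodup := (H'.perm_left.symm.cons _).nodup hb1'
    have hy : ∀ a ∈ (rsRows w).2.flatten, a < e.1 := fun a ha =>
      ht.2.2 a (H.perm_right.subset ha) e.1 (by simp)
    have hy' : ∀ a ∈ (rsRows w').2.flatten, a < e'.1 := fun a ha =>
      ht'.2.2 a (H'.perm_right.subset ha) e'.1 (by simp)
    rw [rsRows_concat, rsRows_concat, Prod.mk.injEq] at h
    -- Both are the maximum of the entries of the same recording tableau.
    have htop : e.1 = e'.1 := by
      have hp := (addBox_perm e.1 (insertTableau e.2 (rsRows w).1).2 (rsRows w).2)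
      have hp' := (addBox_perm e'.1 (insertTableau e'.2 (rsRows w').1).2 (rsRows w').2)
      rw [h.2] at hp
      have hp2 := hp.symm.trans hp'
      have h1 : e.1 ∈ e'.1 :: (rsRows w').2.flatten := hp2.subset (by simp)
      have h2 : e'.1 ∈ e.1 :: (rsRows w).2.flatten := hp2.symm.subset (by simp)
      rcases List.mem_cons.1 h1 with h1 | h1
      · exact h1
      · rcases List.mem_cons.1 h2 with h2 | h2
        · exact h2.symm
        · exact absurd (hy' _ h1) (hy _ h2).not_gt
    have hF := congrArg ofRows h.2
    have hSt := hQ.tab_right.sTab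
      (hQ.perm_right.symm.nodup (by
        rw [List.map_append, List.nodup_append]
        refine ⟨ht.1.imp ne_of_lt, by simp, fun a ha b hb hab => ?_⟩
        exact (ht.2.2 a ha b hb).ne hab))
    rw [rsRows_concat] at hSt
    simp only at hSt
    rw [ofRows_addBox_newBox e.1 H.tab_left hd H.shape_eq] at hF hSt
    rw [ofRows_addBox_newBox e'.1 H'.tab_left hd' H'.shape_eq] at hF
    have hnb : newBox e.2 (rsRows w).1 = newBox e'.2 (rsRows w').1 := by
      refine hSt.injective _ _ e.1 (Function.update_self _ _ _) ?_
      rw [hF, Function.update_self, htop]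
    have hPP := insertTableau_injective H.tab_left H'.tab_left
      (Prod.ext h.1 (congrArg Prod.fst hnb))
    have hQQ : ofRows (rsRows w).2 = ofRows (rsRows w').2 := by
      have n1 : ofRows (rsRows w).2 (newBox e.2 (rsRows w).1) = none := by
        have := newBox_notMem e.2 (rsRows w).1
        rw [H.shape_eq] at this
        exact not_not.1 this
      have n2 : ofRows (rsRows w').2 (newBox e'.2 (rsRows w').1) = none := by
        have := newBox_notMem e'.2 (rsRows w').1
        rw [H'.shape_eq] at this
        exact not_not.1 this
      funext c
      have hc := congrFun hF c
      rw [hnb] at hc n1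
      rcases eq_or_ne c (newBox e'.2 (rsRows w').1) with rfl | hne
      · rw [n1, n2]
      · rwa [Function.update_of_ne hne, Function.update_of_ne hne] at hc
    have hQ' := ofRows_injective H.tab_right.rows_ne_nil H'.tab_right.rows_ne_nil hQQ
    rw [ih ht.1 hb1.of_cons ht'.1 hb1'.of_cons (Prod.ext hPP.2 hQ') (by simpa using hlen),
      Prod.ext htop hPP.1]

/-- The algorithm run backwards: the largest entry of `Q` sits in a corner, and reverse insertion in
`P` from that corner expels the last letter of the array. -/
theorem exists_rsRows_eq {P : List (List α)} {Q : List (List β)} (hP : Tab P)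
    (hdP : P.flatten.Nodup) (hQ : Tab Q) (hdQ : Q.flatten.Nodup)
    (hs : shape (ofRows P) = shape (ofRows Q)) :
    ∃ w, (w.map Prod.fst).Pairwise (· < ·) ∧ (w.map Prod.snd).Nodup ∧ rsRows w = (P, Q) := by
  induction hk : Q.flatten.length generalizing P Q with
  | zero =>
    have hQ0 : Q = [] := by
      cases Q with
      | nil => rfl
      | cons r Q => simp at hk; exact absurd hk.1 hQ.1
    subst hQ0
    have hP0 : P = [] := by
      cases P with
      | nil => rfl
      | cons r P =>
        have h0 : (0, 0) ∈ shape (ofRows (r :: P)) := by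
          have hr := hP.1
          clear hP hdP hs
          cases r <;> simp [shape] at hr ⊢
        rw [hs] at h0
        simp [shape] at h0
    exact ⟨[], by simp [rsRows, hP0]⟩
  | succ k ih =>
    have hQS := hQ.sTab hdQ
    have hne : Q.flatten.toFinset.Nonempty := by
      rw [List.toFinset_nonempty_iff, ← List.length_pos_iff]; omega
    obtain ⟨y, hy, hmax⟩ := Finset.exists_max_image _ id hne
    simp only [List.mem_toFinset, id] at hy hmax
    obtain ⟨b, hb⟩ := mem_flatten_iff.1 hy
    have corner : ∀ c, b < c → c ∉ shape (ofRows Q) := by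
      intro c hbc hc
      obtain ⟨z, hz⟩ := Option.ne_none_iff_exists'.1 hc
      exact absurd (hQS.increasing b c y z hb hz hbc)
        (not_lt.2 (hmax z (mem_flatten_iff.2 ⟨c, hz⟩)))
    have hbQ : b ∈ shape (ofRows Q) := by simp [shape, hb]
    obtain ⟨x, P₀, hP₀, hd₀, hx, hnb⟩ :=
      hP.exists_remove_corner hdP (b := b) (by rw [hs]; exact hbQ) (by rw [hs]; exact corner)
    obtain ⟨Q₀, hQ₀, hdQ₀, hQ₀e⟩ := (sTab_erase hQS corner).exists_tab
    have hs₀ : shape (ofRows P₀) = shape (ofRows Q₀) := by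
      rw [hQ₀e, shape_update_none, ← hs]
      have h1 := shape_insertTableau x P₀
      have h2 := newBox_notMem x P₀
      rw [hnb] at h1 h2
      rw [hx] at h1
      rw [h1]
      ext c
      simp only [Set.mem_sdiff, Set.mem_insert_iff, Set.mem_singleton_iff]
      constructor
      · exact fun hc => ⟨Or.inr hc, fun h => h2 (h ▸ hc)⟩
      · rintro ⟨h3 | h3, h4⟩
        · exact absurd h3 h4
        · exact h3
    have hadd : addBox y b.1 Q₀ = Q := by
      refine ofRows_injective (addBox_rows_ne_nil hQ₀.rows_ne_nil) hQ.rows_ne_nil ?_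
      have := ofRows_addBox_newBox y hP₀ hd₀ hs₀
      rw [hx, hnb, hQ₀e] at this
      rw [this, Function.update_idem, ← hb, Function.update_eq_self]
    have hperm := addBox_perm y b.1 Q₀
    rw [hadd] at hperm
    obtain ⟨w, ht, hbw, hw⟩ := ih hP₀ hd₀.of_cons hQ₀ hdQ₀ hs₀ (by
      have := hperm.length_eq
      simp only [List.length_cons] at this
      omega)
    have H := rsRows_spec ht hbw
    rw [hw] at H
    refine ⟨w ++ [(y, x)], ?_, ?_, ?_⟩
    · rw [List.map_append, List.pairwise_append]
      refine ⟨ht, by simp, ?_⟩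
      intro a ha z hz
      obtain rfl : z = y := by simpa using hz
      have ha' := H.perm_right.symm.subset ha
      refine lt_of_le_of_ne (hmax a (hperm.symm.subset (by simp [ha']))) ?_
      rintro rfl
      exact (List.nodup_cons.1 (hperm.nodup hdQ)).1 ha'
    · rw [List.map_append]
      exact (List.perm_append_singleton x _).symm.nodup ((H.perm_left.cons x).nodup hd₀)
    · rw [rsRows_concat, hw, hx, hadd]

/-! ### Two-line arrays of bijections -/

section TwoLine
variable {S : Finset β} {R : Finset α}

theorem pairwise_twoLine (w : S ≃ R) : (twoLine w).Pairwise fun a b => a.1 < b.1 := by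
  rw [twoLine, List.pairwise_map]
  exact pairwise_lt_sort (Finset.univ : Finset S)

theorem mem_twoLine {w : S ≃ R} {e : β × α} :
    e ∈ twoLine w ↔ ∃ s : S, (s.1, (w s).1) = e := by
  simp [twoLine]

theorem tops_twoLine (w : S ≃ R) : ((twoLine w).map Prod.fst).Pairwise (· < ·) := by
  rw [List.pairwise_map]; exact pairwise_twoLine w

theorem bottoms_twoLine (w : S ≃ R) : ((twoLine w).map Prod.snd).Nodup := by
  rw [twoLine, List.map_map, List.nodup_map_iff]
  · exact Finset.sort_nodup _ _
  · intro s t h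
    exact w.injective (Subtype.ext h)

theorem rs_spec (w : S ≃ R) : STab (RS₁ w) ∧ STab (RS₂ w) ∧ content (RS₁ w) = R ∧
    content (RS₂ w) = S ∧ shape (RS₁ w) = shape (RS₂ w) := by
  have H := rsRows_spec (tops_twoLine w) (bottoms_twoLine w)
  refine ⟨H.tab_left.sTab (H.perm_left.symm.nodup (bottoms_twoLine w)),
    H.tab_right.sTab (H.perm_right.symm.nodup ((tops_twoLine w).imp ne_of_lt)), ?_, ?_, H.shape_eq⟩
  · ext a
    rw [RS₁, content_ofRows, Set.mem_ofPred_eq, H.perm_left.mem_iff]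
    simp only [List.mem_map, mem_twoLine, Finset.mem_coe]
    constructor
    · rintro ⟨_, ⟨s, rfl⟩, rfl⟩; exact (w s).2
    · intro ha; exact ⟨_, ⟨w.symm ⟨a, ha⟩, rfl⟩, by simp⟩
  · ext a
    rw [RS₂, content_ofRows, Set.mem_ofPred_eq, H.perm_right.mem_iff]
    simp only [List.mem_map, mem_twoLine, Finset.mem_coe]
    constructor
    · rintro ⟨_, ⟨s, rfl⟩, rfl⟩; exact s.2
    · intro ha; exact ⟨_, ⟨⟨a, ha⟩, rfl⟩, rfl⟩

theorem rs_injective {w w' : S ≃ R} (h₁ : RS₁ w = RS₁ w') (h₂ : RS₂ w = RS₂ w') : w = w' := by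
  have H := rsRows_spec (tops_twoLine w) (bottoms_twoLine w)
  have H' := rsRows_spec (tops_twoLine w') (bottoms_twoLine w')
  have h : twoLine w = twoLine w' := by
    refine rsRows_injective (tops_twoLine w) (bottoms_twoLine w) (tops_twoLine w')
      (bottoms_twoLine w') (Prod.ext ?_ ?_)
    · exact ofRows_injective H.tab_left.rows_ne_nil H'.tab_left.rows_ne_nil h₁
    · exact ofRows_injective H.tab_right.rows_ne_nil H'.tab_right.rows_ne_nil h₂
  ext s
  have hs : (s.1, (w s).1) ∈ twoLine w' := by rw [← h]; exact mem_twoLine.2 ⟨s, rfl⟩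
  obtain ⟨t, ht⟩ := mem_twoLine.1 hs
  rw [Prod.mk.injEq] at ht
  rw [← ht.2, Subtype.ext ht.1]

/-- In the array obtained by running the algorithm backwards, each element of `S` occurs once on top
and each element of `R` once at the bottom. It is therefore the graph of a bijection, listed by
increasing top entries. -/
theorem exists_rs_eq {P : Filling α} {Q : Filling β} (hP : STab P) (hQ : STab Q)
    (hs : shape P = shape Q) (hR : content P = R) (hS : content Q = S) :
    ∃ w : S ≃ R, RS₁ w = P ∧ RS₂ w = Q := by
  obtain ⟨T, hT, hdT, rfl⟩ := hP.exists_tab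
  obtain ⟨U, hU, hdU, rfl⟩ := hQ.exists_tab
  obtain ⟨l, ht, hb, hl⟩ := exists_rsRows_eq hT hdT hU hdU hs
  have H := rsRows_spec ht hb
  rw [hl] at H
  have htop : ∀ s, s ∈ S ↔ ∃ a, (s, a) ∈ l := by
    intro s
    rw [← Finset.mem_coe, ← hS, content_ofRows, Set.mem_ofPred_eq, H.perm_right.mem_iff]
    simp
  have hbot : ∀ a, a ∈ R ↔ ∃ s, (s, a) ∈ l := by
    intro a
    rw [← Finset.mem_coe, ← hR, content_ofRows, Set.mem_ofPred_eq, H.perm_left.mem_iff]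
    simp
  have huniq : ∀ {e e'}, e ∈ l → e' ∈ l → e.1 = e'.1 → e = e' := fun he he' h =>
    List.inj_on_of_nodup_map (ht.imp ne_of_lt) he he' h
  have huniq' : ∀ {e e'}, e ∈ l → e' ∈ l → e.2 = e'.2 → e = e' := fun he he' h =>
    List.inj_on_of_nodup_map hb he he' h
  choose f hf using fun s : S => (htop s).1 s.2
  let g : S → R := fun s => ⟨f s, (hbot _).2 ⟨s, hf s⟩⟩
  have hg : Function.Bijective g := by
    constructor
    · intro s t hst
      have h1 : f s = f t := congrArg Subtype.val hst
      have := huniq' (hf s) (hf t) h1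
      exact Subtype.ext (congrArg Prod.fst this)
    · rintro ⟨a, ha⟩
      obtain ⟨s, hs⟩ := (hbot a).1 ha
      refine ⟨⟨s, (htop s).2 ⟨a, hs⟩⟩, Subtype.ext ?_⟩
      exact congrArg Prod.snd (huniq (hf ⟨s, (htop s).2 ⟨a, hs⟩⟩) hs rfl)
  have hw : twoLine (Equiv.ofBijective g hg) = l := by
    have p1 := pairwise_twoLine (Equiv.ofBijective g hg)
    have p2 : l.Pairwise fun a b => a.1 < b.1 := List.pairwise_map.1 ht
    refine List.Perm.eq_of_pairwise (le := fun a b => a.1 < b.1) ?_ p1 p2 ?_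
    · intro a b _ _ h h'
      exact absurd h h'.not_gt
    · refine (List.perm_ext_iff_of_nodup ?_ ?_).2 fun e => ?_
      · exact p1.imp fun h h' => h.ne (congrArg Prod.fst h')
      · exact p2.imp fun h h' => h.ne (congrArg Prod.fst h')
      · rw [mem_twoLine]
        constructor
        · rintro ⟨s, rfl⟩; exact hf s
        · intro he
          have hs : e.1 ∈ S := (htop _).2 ⟨e.2, he⟩
          exact ⟨⟨e.1, hs⟩, huniq (hf ⟨e.1, hs⟩) he rfl⟩
  refine ⟨Equiv.ofBijective g hg, ?_, ?_⟩
  · rw [RS₁, hw, hl]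
  · rw [RS₂, hw, hl]

end TwoLine

end GenRS

namespace GenRS

/-! ### Pairs of partial permutations and their graphs -/

/-! ### Columns of partial permutation matrices -/

section Matrices
variable {m r : ℕ} {τ : Matrix (Fin m) (Fin r) ℂ}

theorem IsPartialPerm.eq_zero_of_ne (h : IsPartialPerm τ) {i i' : Fin m} {c : Fin r}
    (hi : τ i c = 1) (hne : i' ≠ i) : τ i' c = 0 :=
  (h.1 i' c).resolve_right fun h' => hne (h.2.2 i' i c h' hi)

theorem IsPartialPerm.column_eq {τ' : Matrix (Fin m) (Fin r) ℂ} (h : IsPartialPerm τ)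
    (h' : IsPartialPerm τ') {i : Fin m} {c c' : Fin r} (hi : τ i c = 1) (hi' : τ' i c' = 1)
    (k : Fin m) : τ k c = τ' k c' := by
  rcases eq_or_ne k i with rfl | hk
  · rw [hi, hi']
  · rw [h.eq_zero_of_ne hi hk, h'.eq_zero_of_ne hi' hk]

theorem IsPartialPerm.forall_eq_zero_or (h : IsPartialPerm τ) (c : Fin r) :
    (∀ i, τ i c = 0) ∨ ∃ i, τ i c = 1 := by
  by_cases h' : ∃ i, τ i c = 1
  · exact Or.inr h'
  · exact Or.inl fun i => (h.1 i c).resolve_right fun hi => h' ⟨i, hi⟩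

end Matrices

theorem rank_eq_iff_linearIndependent {ι : Type} [Fintype ι] {r : ℕ} (A : Matrix ι (Fin r) ℂ) :
    A.rank = r ↔ LinearIndependent ℂ A.col := by
  rw [linearIndependent_iff_card_eq_finrank_span, Matrix.rank_eq_finrank_span_cols,
    Fintype.card_fin, Set.finrank, eq_comm]

variable {p q r : ℕ}

namespace PairMatrix
variable (w : PairMatrix p q r)

theorem upper : IsPartialPerm fun i c => w.1 (Sum.inl i) c := w.2.1

theorem lower : IsPartialPerm fun i c => w.1 (Sum.inr i) c := w.2.2.1

/-- The three possible types of columns. -/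
theorem column_cases (c : Fin r) :
    (∃ i j, w.1 (Sum.inl i) c = 1 ∧ w.1 (Sum.inr j) c = 1) ∨
    (∃ i, w.1 (Sum.inl i) c = 1 ∧ ∀ j, w.1 (Sum.inr j) c = 0) ∨
    (∃ j, w.1 (Sum.inr j) c = 1 ∧ ∀ i, w.1 (Sum.inl i) c = 0) := by
  rcases w.upper.forall_eq_zero_or c with h | ⟨i, hi⟩ <;>
    rcases w.lower.forall_eq_zero_or c with h' | ⟨j, hj⟩
  -- A zero column is excluded by the rank condition.
  · refine absurd ?_ (((rank_eq_iff_linearIndependent w.1).1 w.2.2.2).ne_zero c)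
    funext x
    cases x with
    | inl i => exact h i
    | inr j => exact h' j
  · exact Or.inr (Or.inr ⟨j, hj, h⟩)
  · exact Or.inr (Or.inl ⟨i, hi, h'⟩)
  · exact Or.inl ⟨i, j, hi, hj⟩

theorem eq_of_inl {i : Fin p} {c c' : Fin r} (h : w.1 (Sum.inl i) c = 1)
    (h' : w.1 (Sum.inl i) c' = 1) : c = c' := w.upper.2.1 i c c' h h'

theorem eq_of_inr {j : Fin q} {c c' : Fin r} (h : w.1 (Sum.inr j) c = 1)
    (h' : w.1 (Sum.inr j) c' = 1) : c = c' := w.lower.2.1 j c c' h h'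

end PairMatrix

/-- Parameters with the same graph are equal. -/
theorem Param.ext_graph {ω ω' : Param p q r} (hE : ∀ i j, ω.Edge i j ↔ ω'.Edge i j)
    (hP : ∀ i, ω.MarkPos i ↔ ω'.MarkPos i) (hN : ∀ j, ω.MarkNeg j ↔ ω'.MarkNeg j) : ω = ω' := by
  induction ω using Quotient.inductionOn with
  | _ w =>
  induction ω' using Quotient.inductionOn with
  | _ w' =>
  -- The graph determines the set of columns. As the columns are pairwise distinct, matching equal
  -- columns gives a permutation.
  have key : ∀ c, ∃ c', ∀ x, w'.1 x c = w.1 x c' := by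
    intro c
    rcases w'.column_cases c with ⟨i, j, hi, hj⟩ | ⟨i, hi, hj⟩ | ⟨j, hj, hi⟩
    · obtain ⟨c', hi', hj'⟩ := (hE i j).2 ⟨c, hi, hj⟩
      refine ⟨c', Sum.rec ?_ ?_⟩
      · exact w'.upper.column_eq w.upper hi hi'
      · exact w'.lower.column_eq w.lower hj hj'
    · obtain ⟨c', hi', hj'⟩ := (hP i).2 ⟨c, hi, hj⟩
      refine ⟨c', Sum.rec ?_ ?_⟩
      · exact w'.upper.column_eq w.upper hi hi'
      · exact fun j => (hj j).trans (hj' j).symm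
    · obtain ⟨c', hj', hi'⟩ := (hN j).2 ⟨c, hj, hi⟩
      refine ⟨c', Sum.rec ?_ ?_⟩
      · exact fun i => (hi i).trans (hi' i).symm
      · exact w'.lower.column_eq w.lower hj hj'
  choose f hf using key
  have hinj : Function.Injective f := by
    intro c d hcd
    have h : ∀ x, w'.1 x c = w'.1 x d := fun x => by rw [hf, hf, hcd]
    rcases w'.column_cases c with ⟨i, -, hi, -⟩ | ⟨i, hi, -⟩ | ⟨j, hj, -⟩
    · exact w'.eq_of_inl hi ((h _).symm.trans hi)
    · exact w'.eq_of_inl hi ((h _).symm.trans hi)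
    · exact w'.eq_of_inr hj ((h _).symm.trans hj)
  refine Quotient.sound ⟨(Equiv.ofBijective f (Finite.injective_iff_bijective.1 hinj)).symm, ?_⟩
  ext x c
  rw [mul_permMatrix_apply, hf]
  rfl

namespace Param
variable (ω : Param p q r)

theorem mem_L {i : Fin p} : i ∈ ω.L ↔ ω.MarkPos i := by simp [Param.L]

theorem mem_M {j : Fin q} : j ∈ ω.M ↔ ω.MarkNeg j := by simp [Param.M]

theorem notMem_I_of_mem_L {i : Fin p} (h : i ∈ ω.L) : i ∉ ω.I := by
  rw [mem_L] at h
  rw [mem_I]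
  rintro ⟨j, h'⟩
  induction ω using Quotient.inductionOn with
  | _ w =>
  obtain ⟨c, h1, h2⟩ := h
  obtain ⟨c', h3, h4⟩ := h'
  obtain rfl := w.eq_of_inl h1 h3
  rw [h2] at h4
  exact zero_ne_one h4

theorem notMem_J_of_mem_M {j : Fin q} (h : j ∈ ω.M) : j ∉ ω.J := by
  rw [mem_M] at h
  rw [mem_J]
  rintro ⟨i, h'⟩
  induction ω using Quotient.inductionOn with
  | _ w =>
  obtain ⟨c, h1, h2⟩ := h
  obtain ⟨c', h3, h4⟩ := h'
  obtain rfl := w.eq_of_inr h1 h4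
  rw [h2] at h3
  exact zero_ne_one h3

theorem edge_σ (j : ω.J) : ω.Edge (ω.σ j).1 j.1 := (ω.exists_edge j).choose_spec

theorem edge_iff {i : Fin p} {j : Fin q} : ω.Edge i j ↔ ∃ hj : j ∈ ω.J, (ω.σ ⟨j, hj⟩).1 = i := by
  constructor
  · intro h
    have hj : j ∈ ω.J := ω.mem_J.2 ⟨i, h⟩
    exact ⟨hj, (ω.edge_σ ⟨j, hj⟩).left_unique h⟩
  · rintro ⟨hj, rfl⟩
    exact ω.edge_σ ⟨j, hj⟩

/-- Every column is an edge, a marked positive vertex or a marked negative vertex. -/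
theorem card_add_card_add_card : ω.I.card + ω.L.card + ω.M.card = r := by
  induction ω using Quotient.inductionOn with
  | _ w =>
  set ω : Param p q r := Quotient.mk _ w
  have hI : ∀ i : ω.I, ∃ c, w.1 (Sum.inl i.1) c = 1 ∧ ∃ j, w.1 (Sum.inr j) c = 1 := by
    intro i
    obtain ⟨j, c, h1, h2⟩ := ω.mem_I.1 i.2
    exact ⟨c, h1, j, h2⟩
  have hL : ∀ i : ω.L, ∃ c, w.1 (Sum.inl i.1) c = 1 ∧ ∀ j, w.1 (Sum.inr j) c = 0 :=
    fun i => ω.mem_L.1 i.2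
  have hM : ∀ j : ω.M, ∃ c, w.1 (Sum.inr j.1) c = 1 ∧ ∀ i, w.1 (Sum.inl i) c = 0 :=
    fun j => ω.mem_M.1 j.2
  choose f hf hf' using hI
  choose g hg hg' using hL
  choose h hh hh' using hM
  have hbij : Function.Bijective (Sum.elim (Sum.elim f g) h) := by
    constructor
    · refine Function.Injective.sumElim (Function.Injective.sumElim ?_ ?_ ?_) ?_ ?_
      · intro a b hab
        exact Subtype.ext (w.upper.2.2 a.1 b.1 (f a) (hf a) (by rw [hab]; exact hf b))
      · intro a b hab
        exact Subtype.ext (w.upper.2.2 a.1 b.1 (g a) (hg a) (by rw [hab]; exact hg b))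
      · intro a b hab
        obtain ⟨j, hj⟩ := hf' a
        rw [hab, hg'] at hj
        exact zero_ne_one hj
      · intro a b hab
        exact Subtype.ext (w.lower.2.2 a.1 b.1 (h a) (hh a) (by rw [hab]; exact hh b))
      · rintro (a | a) b hab
        · have := hf a
          simp only [Sum.elim_inl] at hab
          rw [hab, hh'] at this
          exact zero_ne_one this
        · have := hg a
          simp only [Sum.elim_inr] at hab
          rw [hab, hh'] at this
          exact zero_ne_one this
    · intro c
      rcases w.column_cases c with ⟨i, j, hi, hj⟩ | ⟨i, hi, hj⟩ | ⟨j, hj, hi⟩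
      · exact ⟨Sum.inl (Sum.inl ⟨i, ω.mem_I.2 ⟨j, c, hi, hj⟩⟩), w.eq_of_inl (hf _) hi⟩
      · exact ⟨Sum.inl (Sum.inr ⟨i, ω.mem_L.2 ⟨c, hi, hj⟩⟩), w.eq_of_inl (hg _) hi⟩
      · exact ⟨Sum.inr ⟨j, ω.mem_M.2 ⟨c, hj, hi⟩⟩, w.eq_of_inr (hh _) hj⟩
  have := Fintype.card_of_bijective hbij
  simpa using this

/-- The columns are indexed by the disjoint union of `I`, `L` and `M`; `up` and `dn` give the
positions of the upper and lower `1`, if any. -/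
theorem exists_of_data {I L : Finset (Fin p)} {J M : Finset (Fin q)} (σ : J ≃ I)
    (hIL : ∀ i ∈ L, i ∉ I) (hJM : ∀ j ∈ M, j ∉ J) (hr : I.card + L.card + M.card = r) :
    ∃ ω : Param p q r, ω.I = I ∧ ω.J = J ∧ ω.L = L ∧ ω.M = M ∧ ∀ j : J, ω.Edge (σ j).1 j.1 := by
  classical
  have hcard : Fintype.card ((I ⊕ L) ⊕ M) = Fintype.card (Fin r) := by simpa using hr
  let e := Fintype.equivOfCardEq hcard
  let up : (I ⊕ L) ⊕ M → Option (Fin p) :=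
    Sum.elim (Sum.elim (fun i => some i.1) fun i => some i.1) fun _ => none
  let dn : (I ⊕ L) ⊕ M → Option (Fin q) :=
    Sum.elim (Sum.elim (fun i => some (σ.symm i).1) fun _ => none) fun j => some j.1
  let A : Matrix (Fin p ⊕ Fin q) (Fin r) ℂ := fun x c =>
    Sum.elim (fun i => if up (e.symm c) = some i then 1 else 0)
      (fun j => if dn (e.symm c) = some j then 1 else 0) x
  have hup : ∀ {i k k'}, up k = some i → up k' = some i → k = k' := by
    rintro i ((a | a) | a) ((b | b) | b) h h' <;> simp [up] at h h'
    · rw [Subtype.ext (h.trans h'.symm)]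
    · exact absurd a.2 (hIL a (by rw [h, ← h']; exact b.2))
    · exact absurd b.2 (hIL b (by rw [h', ← h]; exact a.2))
    · rw [Subtype.ext (h.trans h'.symm)]
  have hdn : ∀ {j k k'}, dn k = some j → dn k' = some j → k = k' := by
    rintro j ((a | a) | a) ((b | b) | b) h h' <;> simp [dn] at h h'
    · rw [σ.symm.injective (Subtype.ext (h.trans h'.symm))]
    · exact absurd (σ.symm a).2 (hJM _ (by rw [h, ← h']; exact b.2))
    · exact absurd (σ.symm b).2 (hJM _ (by rw [h', ← h]; exact a.2))
    · rw [Subtype.ext (h.trans h'.symm)]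
  have hA1 : ∀ i c, A (Sum.inl i) c = 1 ↔ up (e.symm c) = some i := by
    intro i c; simp [A]
  have hA2 : ∀ j c, A (Sum.inr j) c = 1 ↔ dn (e.symm c) = some j := by
    intro j c; simp [A]
  have hA01 : ∀ x c, A x c = 0 ∨ A x c = 1 := by
    rintro (i | j) c
    · by_cases h : up (e.symm c) = some i <;> simp [A, h]
    · by_cases h : dn (e.symm c) = some j <;> simp [A, h]
  have hA1' : ∀ i c, A (Sum.inl i) c = 0 ↔ up (e.symm c) ≠ some i := by
    intro i c; simp [A]
  have hA2' : ∀ j c, A (Sum.inr j) c = 0 ↔ dn (e.symm c) ≠ some j := by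
    intro j c; simp [A]
  have hu : IsPartialPerm A.toRows₁ := by
    refine ⟨fun i c => hA01 (Sum.inl i) c, fun i c c' h h' => ?_, fun i i' c h h' => ?_⟩
    · exact e.symm.injective (hup ((hA1 i c).1 h) ((hA1 i c').1 h'))
    · exact Option.some.inj (((hA1 i c).1 h).symm.trans ((hA1 i' c).1 h'))
  have hl : IsPartialPerm A.toRows₂ := by
    refine ⟨fun i c => hA01 (Sum.inr i) c, fun i c c' h h' => ?_, fun i i' c h h' => ?_⟩
    · exact e.symm.injective (hdn ((hA2 i c).1 h) ((hA2 i c').1 h'))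
    · exact Option.some.inj (((hA2 i c).1 h).symm.trans ((hA2 i' c).1 h'))
  have hrank : A.rank = r := by
    rw [rank_eq_iff_linearIndependent, Fintype.linearIndependent_iff]
    intro g hg c
    -- Every column has a `1` in a row where all other columns vanish; reading a linear relation in
    -- that row kills its coefficient.
    obtain ⟨x, hx, hx'⟩ : ∃ x, A x c = 1 ∧ ∀ d, d ≠ c → A x d = 0 := by
      have hcase : (∃ i, up (e.symm c) = some i) ∨ ∃ j, dn (e.symm c) = some j := by
        rcases e.symm c with (a | a) | a <;> simp [up, dn]
      rcases hcase with ⟨i, hi⟩ | ⟨j, hj⟩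
      · refine ⟨Sum.inl i, (hA1 i c).2 hi, fun d hd => (hA1' i d).2 fun h => hd ?_⟩
        exact e.symm.injective (hup h hi)
      · refine ⟨Sum.inr j, (hA2 j c).2 hj, fun d hd => (hA2' j d).2 fun h => hd ?_⟩
        exact e.symm.injective (hdn h hj)
    have h := congrFun hg x
    simp only [Finset.sum_apply, Pi.smul_apply, Matrix.col_apply, smul_eq_mul, Pi.zero_apply] at h
    rw [Finset.sum_eq_single c] at h
    · simpa [hx] using h
    · intro d _ hd
      rw [hx' d hd, mul_zero]
    · simp
  let ω : Param p q r := Quotient.mk _ ⟨A, hu, hl, hrank⟩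
  have hE : ∀ i j, ω.Edge i j ↔ ∃ k, up k = some i ∧ dn k = some j := by
    intro i j
    constructor
    · rintro ⟨c, h1, h2⟩
      exact ⟨e.symm c, (hA1 i c).1 h1, (hA2 j c).1 h2⟩
    · rintro ⟨k, h1, h2⟩
      exact ⟨e k, (hA1 i _).2 (by simpa using h1), (hA2 j _).2 (by simpa using h2)⟩
  have hP : ∀ i, ω.MarkPos i ↔ ∃ k, up k = some i ∧ dn k = none := by
    intro i
    constructor
    · rintro ⟨c, h1, h2⟩
      refine ⟨e.symm c, (hA1 i c).1 h1, Option.eq_none_iff_forall_ne_some.2 fun j => ?_⟩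
      exact (hA2' j c).1 (h2 j)
    · rintro ⟨k, h1, h2⟩
      exact ⟨e k, (hA1 i _).2 (by simpa using h1), fun j => (hA2' j _).2 (by simp [h2])⟩
  have hN : ∀ j, ω.MarkNeg j ↔ ∃ k, dn k = some j ∧ up k = none := by
    intro j
    constructor
    · rintro ⟨c, h1, h2⟩
      refine ⟨e.symm c, (hA2 j c).1 h1, Option.eq_none_iff_forall_ne_some.2 fun i => ?_⟩
      exact (hA1' i c).1 (h2 i)
    · rintro ⟨k, h1, h2⟩
      exact ⟨e k, (hA2 j _).2 (by simpa using h1), fun i => (hA1' i _).2 (by simp [h2])⟩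
  refine ⟨ω, ?_, ?_, ?_, ?_, ?_⟩
  · ext i
    rw [mem_I]
    simp [hE, up, dn]
  · ext j
    rw [mem_J]
    simp only [hE, up, dn, Sum.exists, Sum.elim_inl, Sum.elim_inr, Option.some.injEq, reduceCtorEq,
      and_false, false_and, exists_false, or_false]
    constructor
    · rintro ⟨i, a, -, rfl⟩
      exact (σ.symm a).2
    · intro hj
      exact ⟨_, σ ⟨j, hj⟩, rfl, by simp⟩
  · ext i
    rw [mem_L, hP]
    simp [up, dn]
  · ext j
    rw [mem_M, hN]
    simp [up, dn]
  · intro j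
    rw [hE]
    exact ⟨Sum.inl (Sum.inl (σ j)), by simp [up], by simp [dn]⟩

/-- The two bijections have different types until the sets are identified, so the comparison is made
on the resulting tableaux. -/
theorem rs_σ_eq {I : Finset (Fin p)} {J : Finset (Fin q)} (σ : J ≃ I) (hI : ω.I = I)
    (hJ : ω.J = J) (h : ∀ j : J, ω.Edge (σ j).1 j.1) : RS₁ ω.σ = RS₁ σ ∧ RS₂ ω.σ = RS₂ σ := by
  subst hI hJ
  have : ω.σ = σ := by
    ext j
    exact congrArg _ ((ω.edge_σ j).left_unique (h j))
  rw [this]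
  exact ⟨rfl, rfl⟩

/-- The contents of the tableaux recover `I` and `J`; once these agree, injectivity of the
correspondence applies. -/
theorem edge_iff_of_rs_eq {ω ω' : Param p q r} (h₁ : RS₁ ω.σ = RS₁ ω'.σ)
    (h₂ : RS₂ ω.σ = RS₂ ω'.σ) (i : Fin p) (j : Fin q) : ω.Edge i j ↔ ω'.Edge i j := by
  have key : ∀ {I I' : Finset (Fin p)} {J J' : Finset (Fin q)} (σ : J ≃ I) (σ' : J' ≃ I'),
      I = I' → J = J' → RS₁ σ = RS₁ σ' → RS₂ σ = RS₂ σ' →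
      ((∃ hj : j ∈ J, (σ ⟨j, hj⟩).1 = i) ↔ ∃ hj : j ∈ J', (σ' ⟨j, hj⟩).1 = i) := by
    rintro I _ J _ σ σ' rfl rfl h₁ h₂
    rw [rs_injective h₁ h₂]
  rw [edge_iff, edge_iff]
  refine key ω.σ ω'.σ ?_ ?_ h₁ h₂
  · rw [← Finset.coe_inj, ← (rs_spec ω.σ).2.2.1, h₁, (rs_spec ω'.σ).2.2.1]
  · rw [← Finset.coe_inj, ← (rs_spec ω.σ).2.2.2.1, h₂, (rs_spec ω'.σ).2.2.2.1]

end Param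

end GenRS

namespace GenRS

/-! ### The generalized Robinson-Schensted correspondence -/

/-! ### Young diagrams of tableaux -/

section Diagrams
variable {α : Type} [LinearOrder α]

/-- The Young diagram of a tableau. -/
noncomputable def STab.diagram {F : Filling α} (h : STab F) : YoungDiagram where
  cells := h.finite.toFinset
  isLowerSet := by simpa using h.lower

theorem STab.coe_diagram {F : Filling α} (h : STab F) :
    (h.diagram : Set (ℕ × ℕ)) = shape F := by
  ext c
  exact h.finite.mem_toFinset

theorem STab.mem_diagram {F : Filling α} (h : STab F) {c : ℕ × ℕ} :
    c ∈ h.diagram ↔ c ∈ shape F := h.finite.mem_toFinset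

theorem STab.card_diagram {F : Filling α} (h : STab F) :
    h.diagram.card = (content F).ncard := by
  have h1 : h.diagram.card = (shape F).ncard := by
    rw [YoungDiagram.card, Set.ncard_eq_toFinset_card _ h.finite]
    rfl
  rw [h1]
  refine Set.ncard_congr (fun c hc => (F c).get (Option.ne_none_iff_isSome.1 hc)) ?_ ?_ ?_
  · exact fun c hc => ⟨c, by simp⟩
  · intro c d hc hd hcd
    refine h.injective c d ((F c).get (Option.ne_none_iff_isSome.1 hc)) (Option.some_get _).symm ?_
    rw [hcd, Option.some_get]
  · rintro a ⟨c, hc⟩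
    exact ⟨c, by simp [shape, hc], by simp [hc]⟩

theorem isColumnStrip_diagram {F G : Filling α} (hF : STab F) (hG : STab G)
    (hsub : shape F ⊆ shape G) (hinj : Set.InjOn Prod.fst (shape G \ shape F)) :
    IsColumnStrip hF.diagram hG.diagram := by
  constructor
  · intro c hc
    exact hG.mem_diagram.2 (hsub (hF.mem_diagram.1 hc))
  · intro i j j' h1 h2 h3 h4
    rw [hG.mem_diagram] at h1 h3
    rw [hF.mem_diagram] at h2 h4
    exact congrArg Prod.snd (hinj ⟨h1, h2⟩ ⟨h3, h4⟩ rfl)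

theorem IsColumnStrip.injOn {mu lam : YoungDiagram} (h : IsColumnStrip mu lam) :
    Set.InjOn Prod.fst ((lam : Set (ℕ × ℕ)) \ (mu : Set (ℕ × ℕ))) := by
  rintro ⟨i, j⟩ ⟨h1, h2⟩ ⟨i', j'⟩ ⟨h3, h4⟩ hij
  obtain rfl : i = i' := hij
  rw [h.2 i j j' h1 h2 h3 h4]

end Diagrams

section Standard
variable {n : ℕ}

/-- A tableau with entries `0, …, n - 1`, as a standard Young tableau. -/
noncomputable def STab.standard {F : Filling (Fin n)} (h : STab F) (hF : content F = Set.univ) :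
    StandardTableau (⟨h.diagram, by rw [h.card_diagram, hF]; simp⟩ : Partitions n) where
  toFilling := F
  shape_eq := h.coe_diagram.symm
  existsUnique_box x := by
    obtain ⟨c, hc⟩ : x ∈ content F := by rw [hF]; trivial
    exact ⟨c, hc, fun d hd => h.injective d c x hd hc⟩
  row_lt i j a b ha hb :=
    h.increasing _ _ a b ha hb (Prod.mk_lt_mk_iff_right.2 (Nat.lt_succ_self j))
  col_lt i j a b ha hb :=
    h.increasing _ _ a b ha hb (Prod.mk_lt_mk_iff_left.2 (Nat.lt_succ_self i))

theorem StandardTableau.sTab {lam : Partitions n} (T : StandardTableau lam) :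
    STab T.toFilling := by
  have hlow : IsLowerSet (shape T.toFilling) := by rw [T.shape_eq]; exact lam.1.isLowerSet
  refine ⟨?_, hlow, increasing_of_steps hlow T.row_lt T.col_lt, ?_⟩
  · rw [T.shape_eq]; exact lam.1.cells.finite_toSet
  · intro c d a hc hd
    exact (T.existsUnique_box a).unique hc hd

theorem StandardTableau.content_eq {lam : Partitions n} (T : StandardTableau lam) :
    content T.toFilling = Set.univ :=
  Set.eq_univ_of_forall fun x => (T.existsUnique_box x).exists

end Standard

variable {p q r : ℕ}

/-- The partitions indexing the disjoint union are the shapes of the two tableaux, so equality of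
the fillings suffices and no dependent equality has to be checked. -/
theorem target_ext {t t' : Target p q r} (h₁ : t.2.T₁.toFilling = t'.2.T₁.toFilling)
    (h₂ : t.2.T₂.toFilling = t'.2.T₂.toFilling) (h₃ : t.2.lam' = t'.2.lam')
    (h₄ : t.2.mu' = t'.2.mu') (h₅ : t.2.nu = t'.2.nu) : t = t' := by
  obtain ⟨⟨lam, mu⟩, Q⟩ := t
  obtain ⟨⟨lam', mu'⟩, Q'⟩ := t'
  have e₁ : lam = lam' := by
    refine Subtype.ext (SetLike.coe_injective ?_)
    have h := congrArg shape h₁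
    rwa [Q.T₁.shape_eq, Q'.T₁.shape_eq] at h
  have e₂ : mu = mu' := by
    refine Subtype.ext (SetLike.coe_injective ?_)
    have h := congrArg shape h₂
    rwa [Q.T₂.shape_eq, Q'.T₂.shape_eq] at h
  subst e₁ e₂
  congr 1
  exact Quintuple.ext (StandardTableau.ext h₁) (StandardTableau.ext h₂) h₃ h₄ h₅

/-- Multiplication by a column on the left, and then by another one on the right. -/
structure Sandwich {n : ℕ} (L L' I : Finset (Fin n)) (P : Filling (Fin n)) : Prop where
  sTab : STab P
  content_eq : content P = I
  notMem : ∀ i ∈ L, i ∉ I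
  compl : L' = (I ∪ L)ᶜ

/-! ### The two column multiplications on one half -/

namespace Sandwich
variable {n : ℕ} {L L' I : Finset (Fin n)} {P : Filling (Fin n)}

theorem avoid_left (H : Sandwich L L' I P) : ∀ i ∈ L, i ∉ content P := by
  intro i hi
  rw [H.content_eq]
  exact H.notMem i hi

theorem sTab_left (H : Sandwich L L' I P) : STab (product (column L) P) :=
  pieri_left.sTab H.sTab H.avoid_left

theorem content_left (H : Sandwich L L' I P) : content (product (column L) P) = ↑(I ∪ L) := by
  rw [pieri_left.content_eq H.sTab H.avoid_left, H.content_eq, Finset.coe_union]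

theorem avoid_right (H : Sandwich L L' I P) : ∀ i ∈ L', i ∉ content (product (column L) P) := by
  intro i hi
  rw [H.content_left]
  rw [H.compl] at hi
  exact Finset.mem_compl.1 hi

theorem sTab_right (H : Sandwich L L' I P) : STab (product (product (column L) P) (column L')) :=
  pieri_right.sTab H.sTab_left H.avoid_right

theorem content_right (H : Sandwich L L' I P) :
    content (product (product (column L) P) (column L')) = Set.univ := by
  rw [pieri_right.content_eq H.sTab_left H.avoid_right, H.content_left, H.compl,
    Finset.coe_compl, Set.union_compl_self]

theorem card_left (H : Sandwich L L' I P) : H.sTab_left.diagram.card = I.card + L.card := by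
  rw [H.sTab_left.card_diagram, H.content_left, Set.ncard_coe_finset,
    Finset.card_union_of_disjoint]
  exact Finset.disjoint_right.2 H.notMem

theorem card_middle (H : Sandwich L L' I P) : H.sTab.diagram.card = I.card := by
  rw [H.sTab.card_diagram, H.content_eq, Set.ncard_coe_finset]

theorem strip_left (H : Sandwich L L' I P) :
    IsColumnStrip H.sTab.diagram H.sTab_left.diagram :=
  isColumnStrip_diagram _ _ (pieri_left.subset H.sTab H.avoid_left)
    (pieri_left.injOn H.sTab H.avoid_left)

theorem strip_right (H : Sandwich L L' I P) :
    IsColumnStrip H.sTab_left.diagram H.sTab_right.diagram :=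
  isColumnStrip_diagram _ _ (pieri_right.subset H.sTab_left H.avoid_right)
    (pieri_right.injOn H.sTab_left H.avoid_right)

/-- The columns are peeled off from the outside: the intermediate shape determines the right factor,
and then the inner shape determines the left one. -/
theorem unique {M M' J : Finset (Fin n)} {Q : Filling (Fin n)} (H : Sandwich L L' I P)
    (H' : Sandwich M M' J Q)
    (h : product (product (column L) P) (column L') = product (product (column M) Q) (column M'))
    (h₁ : shape (product (column L) P) = shape (product (column M) Q))
    (h₂ : shape P = shape Q) : P = Q ∧ L = M := by
  have h3 := (pieri_right.unique H.sTab_left H'.sTab_left H.avoid_right H'.avoid_right h₁ h).1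
  exact pieri_left.unique H.sTab H'.sTab H.avoid_left H'.avoid_left h₂ h3

/-- The existence part of the Pieri rule is applied to the outer strip on the right, and then to the
inner strip on the left. The right-hand set is the required complement because the content of `T` is
everything. -/
theorem exists_of_standard {lam : Partitions n} (T : StandardTableau lam) {lam' nu : YoungDiagram}
    (h₁ : IsColumnStrip nu lam') (h₂ : IsColumnStrip lam' lam.1) :
    ∃ L L' I P, Sandwich L L' I P ∧
      product (product (column L) P) (column L') = T.toFilling ∧
      shape (product (column L) P) = lam' ∧ shape P = nu := by
  obtain ⟨A, L', hA, hL', hs, hAT⟩ := pieri_right.exists_eq (κ := (lam' : Set (ℕ × ℕ))) T.sTab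
    lam'.isLowerSet (by rw [T.shape_eq]; exact h₂.1) (by rw [T.shape_eq]; exact h₂.injOn)
  obtain ⟨P, L, hP, hL, hs', hPA⟩ := pieri_left.exists_eq (κ := (nu : Set (ℕ × ℕ))) hA
    nu.isLowerSet (by rw [hs]; exact h₁.1) (by rw [hs]; exact h₁.injOn)
  classical
  have hI : content P = ↑(Finset.univ.filter fun i => i ∈ content P) := by simp
  have hcA := pieri_left.content_eq hP hL
  have hcT := pieri_right.content_eq hA hL'
  rw [hPA] at hcA
  rw [hAT, T.content_eq] at hcT
  refine ⟨L, L', _, P, ⟨hP, hI, ?_, ?_⟩, by rw [hPA, hAT], by rw [hPA, hs], hs'⟩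
  · intro i hi
    simpa using hL i hi
  · ext i
    have h3 : i ∈ content A ∨ i ∈ L' := by
      have : i ∈ content A ∪ ↑L' := by rw [← hcT]; trivial
      simpa using this
    have h4 : i ∈ content A ↔ i ∈ content P ∨ i ∈ L := by rw [hcA]; simp
    have h5 := hL' i
    simp only [Finset.mem_compl, Finset.mem_union, Finset.mem_filter, Finset.mem_univ, true_and]
    tauto

end Sandwich

theorem Param.sandwich_pos (ω : Param p q r) : Sandwich ω.L ω.L' ω.I (RS₁ ω.σ) :=
  ⟨(rs_spec ω.σ).1, (rs_spec ω.σ).2.2.1, fun _ => ω.notMem_I_of_mem_L, rfl⟩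

theorem Param.sandwich_neg (ω : Param p q r) : Sandwich ω.M ω.M' ω.J (RS₂ ω.σ) :=
  ⟨(rs_spec ω.σ).2.1, (rs_spec ω.σ).2.2.2.1, fun _ => ω.notMem_J_of_mem_M, rfl⟩

theorem Param.diagram_eq (ω : Param p q r) :
    ω.sandwich_pos.sTab.diagram = ω.sandwich_neg.sTab.diagram := by
  refine SetLike.coe_injective ?_
  rw [STab.coe_diagram, STab.coe_diagram]
  exact (rs_spec ω.σ).2.2.2.2

/-- The generalized Robinson-Schensted map. -/
noncomputable def gRSMap (ω : Param p q r) : Target p q r where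
  fst := (⟨ω.sandwich_pos.sTab_right.diagram, by
      rw [STab.card_diagram, ω.sandwich_pos.content_right]; simp⟩,
    ⟨ω.sandwich_neg.sTab_right.diagram, by
      rw [STab.card_diagram, ω.sandwich_neg.content_right]; simp⟩)
  snd :=
    { T₁ := ω.sandwich_pos.sTab_right.standard ω.sandwich_pos.content_right
      T₂ := ω.sandwich_neg.sTab_right.standard ω.sandwich_neg.content_right
      lam' := ω.sandwich_pos.sTab_left.diagram
      mu' := ω.sandwich_neg.sTab_left.diagram
      nu := ω.sandwich_pos.sTab.diagram
      strip_nu_lam' := ω.sandwich_pos.strip_left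
      strip_lam' := ω.sandwich_pos.strip_right
      strip_nu_mu' := by rw [ω.diagram_eq]; exact ω.sandwich_neg.strip_left
      strip_mu' := ω.sandwich_neg.strip_right
      -- Since `|J| = |I| = |ν|`, the left side is `2|I| + |L| + |M|`, which is `|ν| + r` by the
      -- count of columns.
      card_add_card := by
        have h1 := ω.sandwich_pos.card_left
        have h2 := ω.sandwich_neg.card_left
        have h3 := ω.sandwich_pos.card_middle
        have h4 := ω.sandwich_neg.card_middle
        rw [← ω.diagram_eq] at h4
        have h5 := ω.card_add_card_add_card
        omega }

theorem shape_eq_of_diagram_eq {α : Type} [LinearOrder α] {F G : Filling α} (hF : STab F)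
    (hG : STab G) (h : hF.diagram = hG.diagram) : shape F = shape G := by
  rw [← hF.coe_diagram, h, hG.coe_diagram]

theorem gRSMap_injective : Function.Injective (gRSMap (p := p) (q := q) (r := r)) := by
  intro ω ω' h
  have h₁ := congrArg (fun t : Target p q r => t.2.T₁.toFilling) h
  have h₂ := congrArg (fun t : Target p q r => t.2.T₂.toFilling) h
  have h₃ := shape_eq_of_diagram_eq ω.sandwich_pos.sTab_left ω'.sandwich_pos.sTab_left
    (congrArg (fun t : Target p q r => t.2.lam') h)
  have h₄ := shape_eq_of_diagram_eq ω.sandwich_neg.sTab_left ω'.sandwich_neg.sTab_left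
    (congrArg (fun t : Target p q r => t.2.mu') h)
  have h₅ := shape_eq_of_diagram_eq ω.sandwich_pos.sTab ω'.sandwich_pos.sTab
    (congrArg (fun t : Target p q r => t.2.nu) h)
  have h₆ : shape (RS₂ ω.σ) = shape (RS₂ ω'.σ) := by
    rw [← (rs_spec ω.σ).2.2.2.2, ← (rs_spec ω'.σ).2.2.2.2, h₅]
  obtain ⟨hP, hL⟩ := ω.sandwich_pos.unique ω'.sandwich_pos h₁ h₃ h₅
  obtain ⟨hQ, hM⟩ := ω.sandwich_neg.unique ω'.sandwich_neg h₂ h₄ h₆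
  refine Param.ext_graph (Param.edge_iff_of_rs_eq hP hQ) ?_ ?_
  · intro i
    rw [← Param.mem_L, ← Param.mem_L, hL]
  · intro j
    rw [← Param.mem_M, ← Param.mem_M, hM]

theorem gRSMap_surjective : Function.Surjective (gRSMap (p := p) (q := q) (r := r)) := by
  rintro ⟨⟨lam, mu⟩, Q⟩
  obtain ⟨L, L', I, A, HA, hA₁, hA₂, hA₃⟩ :=
    Sandwich.exists_of_standard Q.T₁ Q.strip_nu_lam' Q.strip_lam'
  obtain ⟨M, M', J, B, HB, hB₁, hB₂, hB₃⟩ :=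
    Sandwich.exists_of_standard Q.T₂ Q.strip_nu_mu' Q.strip_mu'
  obtain ⟨σ, hσ₁, hσ₂⟩ := exists_rs_eq HA.sTab HB.sTab (hA₃.trans hB₃.symm) HA.content_eq
    HB.content_eq
  have hlam : HA.sTab_left.diagram = Q.lam' :=
    SetLike.coe_injective (HA.sTab_left.coe_diagram.trans hA₂)
  have hmu : HB.sTab_left.diagram = Q.mu' :=
    SetLike.coe_injective (HB.sTab_left.coe_diagram.trans hB₂)
  have hnu : HA.sTab.diagram = Q.nu := SetLike.coe_injective (HA.sTab.coe_diagram.trans hA₃)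
  have hnu' : HB.sTab.diagram = Q.nu := SetLike.coe_injective (HB.sTab.coe_diagram.trans hB₃)
  -- The cardinality condition of the quintuple is exactly what makes the number of columns equal to
  -- `r`.
  obtain ⟨ω, hI, hJ, hL, hM, hE⟩ := Param.exists_of_data (r := r) σ HA.notMem HB.notMem (by
    have h1 := HA.card_left
    have h2 := HB.card_left
    have h3 := HA.card_middle
    have h4 := HB.card_middle
    have h5 := Q.card_add_card
    rw [hlam] at h1
    rw [hmu] at h2
    rw [hnu] at h3
    rw [hnu'] at h4
    omega)
  obtain ⟨hP, hQ⟩ := ω.rs_σ_eq σ hI hJ hE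
  rw [hσ₁] at hP
  rw [hσ₂] at hQ
  have hL' : ω.L' = L' := by rw [Param.L', hI, hL, HA.compl]
  have hM' : ω.M' = M' := by rw [Param.M', hJ, hM, HB.compl]
  refine ⟨ω, target_ext ?_ ?_ ?_ ?_ ?_⟩
  · change product (product (column ω.L) (RS₁ ω.σ)) (column ω.L') = _
    rw [hL, hP, hL', hA₁]
  · change product (product (column ω.M) (RS₂ ω.σ)) (column ω.M') = _
    rw [hM, hQ, hM', hB₁]
  · refine SetLike.coe_injective (ω.sandwich_pos.sTab_left.coe_diagram.trans ?_)
    rw [hL, hP, hA₂]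
  · refine SetLike.coe_injective (ω.sandwich_neg.sTab_left.coe_diagram.trans ?_)
    rw [hM, hQ, hB₂]
  · refine SetLike.coe_injective (ω.sandwich_pos.sTab.coe_diagram.trans ?_)
    rw [hP, hA₃]

end GenRS

open GenRS
theorem theorem3 (p q r : ℕ) :
    ∃ gRS : Param p q r ≃ Target p q r, ∀ ω : Param p q r,
      (gRS ω).2.T₁.toFilling = product (product (column ω.L) (RS₁ ω.σ)) (column ω.L') ∧
      (gRS ω).2.T₂.toFilling = product (product (column ω.M) (RS₂ ω.σ)) (column ω.M') ∧
      ((gRS ω).2.lam' : Set (ℕ × ℕ)) = shape (product (column ω.L) (RS₁ ω.σ)) ∧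
      ((gRS ω).2.mu' : Set (ℕ × ℕ)) = shape (product (column ω.M) (RS₂ ω.σ)) ∧
      ((gRS ω).2.nu : Set (ℕ × ℕ)) = shape (RS₁ ω.σ) :=
  ⟨Equiv.ofBijective gRSMap ⟨gRSMap_injective, gRSMap_surjective⟩, fun ω =>
    ⟨rfl, rfl, ω.sandwich_pos.sTab_left.coe_diagram, ω.sandwich_neg.sTab_left.coe_diagram,
      ω.sandwich_pos.sTab.coe_diagram⟩⟩
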